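/- \textbf{Setting.} The double pentagon is the translation surface obtained from a regular pentagon and its image under a central symmetry by gluing parallel sides by translations; the five glued pairs of sides are labelled $1,\dots,5$ so that the directions of the sides with consecutive labels modulo $5$ differ by the angle $\pi/5$. Opposite directions are identified, so directions form $\mathbb{RP}^1$, which is regarded as the circle at infinity of the hyperbolic plane, by $\theta\mapsto 2\theta$ on angles. The five directions of the sides of the pentagon are the vertices of a regular ideal pentagon, the pentagon of generation $0$; by repeated reflections in sides it generates a tiling of the hyperbolic plane by ideal pentagons, and the generation of a tile is the least number of reflections needed to reach it. A direction is periodic if there is a closed linear trajectory (not through a vertex) in this direction. The closed trajectories in a periodic direction form two strips, a shorter and a longer one (with respect to the length of the closed trajectories, each traversed once). The labels of the sides crossed by a closed trajectory traversed once form a cyclic word; the cyclic words of the trajectories of the shorter and of the longer strip are called the short and the long orbit of the direction. \textbf{Theorem.} Let $\beta$ be a periodic direction that is not parallel to a side of the pentagon, and let $\dots,\gamma_{-2},\gamma_{-1},\gamma_1,\gamma_2,\dots$ (there is no $\gamma_0$) be all the points joined to $\beta$ by sides of pentagons of the tiling, in the order in which they lie on the circle at infinity with $\beta$ removed (in either orientation),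 numbered so that $\gamma_{-1}$ and $\gamma_1$ are the two neighbours of $\beta$ in the pentagon of least generation that has $\beta$ as a vertex. Then there are (possibly empty) words $u,v,x,y,z,w$ such that $a=uv$ represents the short orbit of $\beta$, $A=xy$ represents the long orbit of $\beta$, $\overline A=zw$ is a cyclic shift of $A$, and for all $n\ge 0$, as cyclic words: (1) the short orbit of $\gamma_{-1-n}$ is $A^nx$, and its long orbit is $\overline A^{\,n}zva^n$; (2) the short orbit of $\gamma_{1+n}$ is $yA^n$, and its long orbit is $a^nuw\overline A^{\,n}$. -/

import Mathlib

noncomputable section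

namespace DoublePentagon

/-! ### The double pentagon and its closed linear trajectories -/

/-- The labels `1, 2, 3, 4, 5` of the five pairs of parallel sides (`5` is written as `0`). -/
abbrev Label : Type := ZMod 5

/-- Directions in the plane, opposite directions being identified: the real projective line. -/
abbrev Direction : Type := Projectivization ℝ ℂ

/-- `exp (2πi/5)`. The first pentagon has the vertices `ω ^ k`, `k = 0, …, 4`; the second one is
its image under `z ↦ -z`. -/
def ω : ℂ := Complex.exp (2 * Real.pi * Complex.I / (5 : ℕ))

/-- The sheet `1` is the first pentagon, the sheet `-1` is the second one. -/
abbrev Sheet : Type := ℤˣ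

/-- The first endpoint of the side labelled `j` of the pentagon `e`. Sides whose labels
are consecutive modulo `5` are two steps apart on the boundary of the pentagon; their directions
differ by an angle `π/5`. -/
def sideStart (e : Sheet) (j : Label) : ℂ := ((e : ℤ) : ℂ) * ω ^ (2 * j.val)

/-- The second endpoint of the side labelled `j` of the pentagon `e`. -/
def sideEnd (e : Sheet) (j : Label) : ℂ := ((e : ℤ) : ℂ) * ω ^ (2 * j.val + 1)

/-- The side labelled `j` of the pentagon `e`, without its endpoints. -/
def openSide (e : Sheet) (j : Label) : Set ℂ := openSegment ℝ (sideStart e j) (sideEnd e j)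

/-- The translation vector that glues the side `j` of the pentagon `e` to the side `j` of the
other pentagon `-e`: it maps `sideStart e j` to `sideEnd (-e) j` and `sideEnd e j` to
`sideStart (-e) j`. -/
def gluing (e : Sheet) (j : Label) : ℂ := sideEnd (-e) j - sideStart e j

/-- A crossing: the trajectory crosses the side labelled `side` and enters the pentagon `sheet` at
the point `pt` of this side. -/
structure Crossing where
  sheet : Sheet
  side : Label
  pt : ℂ

/-- After the crossing `X`, the point moves with velocity `v` for the time `t` inside the pentagon
`X.sheet`, until it reaches the interior of another side, which it crosses: `Y` is this next
crossing. -/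
structure IsNextCrossing (v : ℂ) (X Y : Crossing) (t : ℝ) : Prop where
  time_pos : 0 < t
  start_mem : X.pt ∈ openSide X.sheet X.side
  side_ne : Y.side ≠ X.side
  end_mem : X.pt + t * v ∈ openSide X.sheet Y.side
  sheet_eq : Y.sheet = -X.sheet
  pt_eq : Y.pt = X.pt + t * v + gluing X.sheet Y.side

/-- A closed linear trajectory in the direction `d` on the double pentagon that avoids the
vertices, traversed once; it is given by its consecutive crossings of sides, of which there are
`period`, and the times between them. -/
structure ClosedTrajectory (d : Direction) where
  velocity : ℂ
  velocity_ne : velocity ≠ 0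
  velocity_dir : Projectivization.mk ℝ velocity velocity_ne = d
  period : ℕ
  period_pos : 0 < period
  crossing : ℕ → Crossing
  time : ℕ → ℝ
  next : ∀ i, IsNextCrossing velocity (crossing i) (crossing (i + 1)) (time i)
  closed : ∀ i, crossing (i + period) = crossing i
  once : ∀ i < period, ∀ j < period, crossing i = crossing j → i = j

/-- The symbolic orbit: the cyclic word of the labels of the sides that are crossed. -/
def ClosedTrajectory.orbit {d : Direction} (T : ClosedTrajectory d) : Cycle Label :=
  (((List.range T.period).map fun i => (T.crossing i).side : List Label) : Cycle Label)

/-- The length of a closed trajectory. -/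
def ClosedTrajectory.length {d : Direction} (T : ClosedTrajectory d) : ℝ :=
  ∑ i ∈ Finset.range T.period, T.time i * ‖T.velocity‖

/-- A direction is periodic if it is the direction of a closed trajectory. -/
def IsPeriodicDirection (d : Direction) : Prop := Nonempty (ClosedTrajectory d)

/-- `c` is the symbolic orbit of the closed trajectories of the shorter one of the two strips of
parallel closed trajectories in the direction `d`. -/
def IsShortOrbit (d : Direction) (c : Cycle Label) : Prop :=
  (∃ T : ClosedTrajectory d, ∀ S : ClosedTrajectory d, T.length ≤ S.length) ∧
    ∀ T : ClosedTrajectory d, (∀ S : ClosedTrajectory d, T.length ≤ S.length) → T.orbit = c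

/-- `c` is the symbolic orbit of the closed trajectories of the longer one of the two strips of
parallel closed trajectories in the direction `d`. -/
def IsLongOrbit (d : Direction) (c : Cycle Label) : Prop :=
  (∃ T : ClosedTrajectory d, ∀ S : ClosedTrajectory d, S.length ≤ T.length) ∧
    ∀ T : ClosedTrajectory d, (∀ S : ClosedTrajectory d, S.length ≤ T.length) → T.orbit = c

/-! ### The tiling of the hyperbolic plane by ideal pentagons -/

theorem ω_pow_succ_sub_ne_zero (k : ℕ) : ω ^ (k + 1) - ω ^ k ≠ 0 := by
  have h : IsPrimitiveRoot ω 5 := Complex.isPrimitiveRoot_exp 5 (by norm_num)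
  have h0 : ω ≠ 0 := h.ne_zero (by norm_num)
  have h1 : ω ≠ 1 := h.ne_one (by norm_num)
  have h2 : ω ^ (k + 1) - ω ^ k = ω ^ k * (ω - 1) := by ring
  rw [h2]
  exact mul_ne_zero (pow_ne_zero k h0) (sub_ne_zero.mpr h1)

/-- The direction of the sides labelled `j`. When the projective line of directions is the circle
at infinity of the hyperbolic plane, these five points, in the cyclic order of `j`, are the
vertices of a regular ideal pentagon. -/
def sideDirection (j : Label) : Direction :=
  Projectivization.mk ℝ (ω ^ (2 * j.val + 1) - ω ^ (2 * j.val)) (ω_pow_succ_sub_ne_zero _)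

/-- The determinant of two vectors in the plane. -/
def cross (a b : ℂ) : ℝ := a.re * b.im - a.im * b.re

open Classical in
/-- The action on the circle at infinity of the reflection of the hyperbolic plane in the geodesic
with the distinct ideal endpoints `p` and `q`. It is the projective involution with the fixed points
`p` and `q`: if `P`, `Q` are vectors with the directions `p`, `q`, it is given by the linear map
`x P + y Q ↦ x P - y Q`, which is written here up to the factor `cross P Q`. (The value for
`p = q` is irrelevant.) -/
def idealReflection (p q r : Direction) : Direction :=
  if h : ((cross r.rep q.rep : ℝ) : ℂ) * p.rep - ((cross p.rep r.rep : ℝ) : ℂ) * q.rep ≠ 0 then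
    Projectivization.mk ℝ _ h
  else r

/-- `IsTile k V`: the ideal pentagon with the consecutive vertices `V 0, …, V 4` is obtained from
the pentagon of the side directions by `k` successive reflections of pentagons in their sides. The
least such `k` is the generation of the pentagon. -/
inductive IsTile : ℕ → (Label → Direction) → Prop
  | base : IsTile 0 sideDirection
  | reflect {k : ℕ} {V : Label → Direction} (i : Label) (hV : IsTile k V) :
      IsTile (k + 1) fun j => idealReflection (V i) (V (i + 1)) (V j)

/-- Two directions are joined if they are the endpoints of a side of an ideal pentagon of the
tiling. -/
def Joined (p q : Direction) : Prop :=
  ∃ (k : ℕ) (V : Label → Direction) (j : Label), IsTile k V ∧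
    ((V j = p ∧ V (j + 1) = q) ∨ (V j = q ∧ V (j + 1) = p))

/-- The cotangent of the angle in `(0, π)` from `β` to `r`: a coordinate that increases or decreases
monotonically as `r` moves once along the circle at infinity from `β` back to `β`. -/
def circleCoord (β r : Direction) : ℝ := (r.rep / β.rep).re / (r.rep / β.rep).im

/-- `γ` is the list `…, γ₋₂, γ₋₁, γ₁, γ₂, …` (there is no `γ₀`) of all points joined to `β`, in
the order in which they lie on the circle at infinity without `β`, where `γ₋₁` and `γ₁` are
the two neighbours of `β` in the pentagon of the least generation that has `β` as a vertex. -/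
structure IsOrderedNeighbours (β : Direction) (γ : {i : ℤ // i ≠ 0} → Direction) : Prop where
  range_eq : Set.range γ = {r | Joined β r}
  ordered : StrictMono (fun i => circleCoord β (γ i)) ∨ StrictAnti (fun i => circleCoord β (γ i))
  first : ∃ (k : ℕ) (V : Label → Direction) (j : Label), IsTile k V ∧ V j = β ∧
    (∀ m < k, ∀ W : Label → Direction, IsTile m W → ∀ i, W i ≠ β) ∧
    ((γ ⟨-1, by norm_num⟩ = V (j - 1) ∧ γ ⟨1, by norm_num⟩ = V (j + 1)) ∨
      (γ ⟨-1, by norm_num⟩ = V (j + 1) ∧ γ ⟨1, by norm_num⟩ = V (j - 1)))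

/-- The linear word `w` repeated `n` times. -/
def wordPow (w : List Label) (n : ℕ) : List Label := (List.replicate n w).flatten

end DoublePentagon

end

/-! A sector of directions is bounded by two adjacent vertices of the tiling with suitably scaled
vectors `P`, `Q`. In the direction `x P + y Q` with `x, y ≥ 0` the flow has a first return map that
exchanges four intervals of lengths `x, φx, φy, y`, where `φ` is the golden ratio. Each interval has
a word of side labels. When `y = 0` the last two intervals are empty and the first two do not move:
they are cross-sections of the two strips in the direction `P`, so their words are the short and the
long orbit of `P`. The case `x = 0` treats `Q` likewise. Hence four words per sector record the
orbits at both ends.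

For sectors between consecutive side directions this is a computation in coordinates
(`induces_base`). Beyond the side `PQ` lies a pentagon with the vertices `P, φP + Q, φP + φQ, P +
φQ, Q`, which cuts the sector into four. Rauzy-type induction of the exchange gives for each
subsector an exchange of the same shape, because `φ² = φ + 1`, and the words change by the
substitution `subst` (`Edge.IsCoded.child`). The holonomies of the words are `φP, φ²P, φ²Q, φQ`
(`Edge.IsHolonomic.child`); this shows which strip is the shorter one.

On the side of the tiling, every pentagon but the first lies beyond the outer side of a unique step
of this subdivision (`Reach.cases_sector`). So `β` appears first as one of the three new vertices in
some sector, with its neighbours in that pentagon on either side (`exists_sector_of_first`). If `B`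
is a vector of `β` and `C` one of a neighbour, all neighbours are `C + nφB` with `n` an integer
(`joined_iff_of_reach`): they come from repeated subdivision next to `β`. This iterates one fixed
substitution, which produces the powers of the short and the long orbit (`Edge.childrenP_word`,
`Edge.childrenQ_word`). What remains is to match words up to rotation for each of the three
positions of `β` (`Edge.IsValid.hasOrbitWords`) and to identify the numbering of the neighbours with
`n` (`IsOrderedNeighbours.exists_numbering`). -/

noncomputable section

namespace DoublePentagon

open Real (goldenRatio)

/-! ### Labelled transition systems and induced systems -/

/-- `Path S x w y`: the labelled transition system `S` leads from `x` to `y` along the word `w`. -/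
def Path {X Λ : Type*} (S : X → Λ → X → Prop) : X → List Λ → X → Prop
  | x, [], y => x = y
  | x, l :: w, y => ∃ z, S x l z ∧ Path S z w y

section Path

variable {X Λ : Type*} {S : X → Λ → X → Prop}

@[simp] theorem path_nil {x y : X} : Path S x [] y ↔ x = y := Iff.rfl

@[simp] theorem path_cons {x y : X} {l : Λ} {w : List Λ} :
    Path S x (l :: w) y ↔ ∃ z, S x l z ∧ Path S z w y := Iff.rfl

theorem path_append {x y : X} {w₁ w₂ : List Λ} :
    Path S x (w₁ ++ w₂) y ↔ ∃ z, Path S x w₁ z ∧ Path S z w₂ y := by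
  induction w₁ generalizing x with
  | nil => simp
  | cons l w ih =>
    simp only [List.cons_append, path_cons, ih]
    constructor
    · rintro ⟨z, h, z', h1, h2⟩
      exact ⟨z', ⟨z, h, h1⟩, h2⟩
    · rintro ⟨z', ⟨z, h, h1⟩, h2⟩
      exact ⟨z, h, z', h1, h2⟩

theorem Path.trans {x y z : X} {w₁ w₂ : List Λ} (h₁ : Path S x w₁ y) (h₂ : Path S y w₂ z) :
    Path S x (w₁ ++ w₂) z := path_append.2 ⟨y, h₁, h₂⟩

/-- The label of a step determines its target. -/
def IsDeterministic (S : X → Λ → X → Prop) : Prop :=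
  ∀ ⦃x l y y'⦄, S x l y → S x l y' → y = y'

theorem IsDeterministic.path_eq (hS : IsDeterministic S) {x y y' : X} {w : List Λ}
    (h : Path S x w y) (h' : Path S x w y') : y = y' := by
  induction w generalizing x with
  | nil => exact h.symm.trans h'
  | cons l w ih =>
    obtain ⟨z, hz, h⟩ := h
    obtain ⟨z', hz', h'⟩ := h'
    obtain rfl := hS hz hz'
    exact ih h h'

end Path

/-- The closed paths of `S` are coded by the closed paths of `S'` by means of the substitution
`σ`. -/
structure Induces {X Λ X' Λ' : Type*} (S : X → Λ → X → Prop) (S' : X' → Λ' → X' → Prop)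
    (ι : X' → X) (σ : Λ' → List Λ) : Prop where
  -- Only paths that are part of a closed path have to lift: a starting point of an open path may
  -- correspond to a vertex of the surface, where the flow is undefined.
  lift : ∀ ⦃x y w w'⦄, Path S' x w y → Path S' y w' x → Path S (ι x) (w.flatMap σ) (ι y)
  parse : ∀ ⦃x u⦄, (∃ l y, S' x l y) → Path S (ι x) u (ι x) →
    ∃ u', u = u'.flatMap σ ∧ Path S' x u' x
  reach : ∀ ⦃p w⦄, Path S p w p → w ≠ [] → ∃ a b x, w = a ++ b ∧ (∃ l y, S' x l y) ∧
    Path S p a (ι x) ∧ Path S (ι x) b p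

/-- The point is `reach`: a closed path is cut at the first section, the rotated path is parsed and
cut again at the second section. The second cut falls into one of the two pieces of the first one,
and determinism identifies the states there. -/
theorem Induces.comp {X Λ X' Λ' X'' Λ'' : Type*} {S : X → Λ → X → Prop}
    {S' : X' → Λ' → X' → Prop} {S'' : X'' → Λ'' → X'' → Prop} {ι : X' → X} {σ : Λ' → List Λ}
    {ι' : X'' → X'} {σ' : Λ'' → List Λ'} (h : Induces S S' ι σ) (h' : Induces S' S'' ι' σ')
    (hS : IsDeterministic S) (hdom : ∀ x l y, S'' x l y → ∃ l y, S' (ι' x) l y) :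
    Induces S S'' (ι ∘ ι') (fun l => (σ' l).flatMap σ) where
  lift x y w w' h1 h2 := by
    have := h.lift (h'.lift h1 h2) (h'.lift h2 h1)
    rwa [List.flatMap_assoc] at this
  parse x u hx hu := by
    obtain ⟨l, y, hl⟩ := hx
    obtain ⟨u', rfl, hu'⟩ := h.parse (hdom x l y hl) hu
    obtain ⟨u'', rfl, hu''⟩ := h'.parse ⟨l, y, hl⟩ hu'
    exact ⟨u'', by rw [List.flatMap_assoc], hu''⟩
  reach p w hp hw := by
    obtain ⟨a, b, x, rfl, hx, ha, hb⟩ := h.reach hp hw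
    obtain ⟨u', hu, hu'⟩ := h.parse hx (hb.trans ha)
    have hne : u' ≠ [] := by
      rintro rfl
      simp at hu
      exact hw (by simp [hu.1, hu.2])
    obtain ⟨a', b', x', rfl, hx', ha', hb'⟩ := h'.reach hu' hne
    have hA := h.lift ha' hb'
    have hB := h.lift hb' ha'
    rw [List.flatMap_append] at hu
    rcases List.append_eq_append_iff.1 hu with ⟨c, h1, h2⟩ | ⟨c, h1, h2⟩
    · rw [h1] at hA
      obtain ⟨z, hz, hc⟩ := path_append.1 hA
      obtain rfl := hS.path_eq hz hb
      exact ⟨c, b'.flatMap σ ++ b, x', by rw [h2, List.append_assoc], hx', hc, hB.trans hb⟩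
    · rw [h1] at hb
      obtain ⟨z, hz, hc⟩ := path_append.1 hb
      obtain rfl := hS.path_eq hz hA
      exact ⟨a ++ a'.flatMap σ, c, x', by rw [h1, List.append_assoc], hx', ha.trans hA, hc⟩

/-- Passing to an isomorphic labelled transition system. -/
theorem Induces.comp_equiv {X Λ X' Λ' X'' Λ'' : Type*} {S : X → Λ → X → Prop}
    {S' : X' → Λ' → X' → Prop} {S'' : X'' → Λ'' → X'' → Prop} {ι : X' → X} {σ : Λ' → List Λ}
    (h : Induces S S' ι σ) (κ : X'' ≃ X') (π : Λ'' ≃ Λ')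
    (hκ : ∀ x l y, S'' x l y ↔ S' (κ x) (π l) (κ y)) :
    Induces S S'' (ι ∘ κ) (σ ∘ π) := by
  have hpath : ∀ {x w y}, Path S'' x w y ↔ Path S' (κ x) (w.map π) (κ y) := by
    intro x w y
    induction w generalizing x with
    | nil => simp
    | cons l w ih =>
      simp only [path_cons, List.map_cons, hκ, ih]
      exact ⟨fun ⟨z, hz⟩ => ⟨κ z, hz⟩, fun ⟨z, hz⟩ => ⟨κ.symm z, by simpa using hz⟩⟩
  have hdom : ∀ x, (∃ l y, S'' x l y) ↔ ∃ l y, S' (κ x) l y := by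
    intro x
    constructor
    · rintro ⟨l, y, hl⟩
      exact ⟨_, _, (hκ _ _ _).1 hl⟩
    · rintro ⟨l, y, hl⟩
      exact ⟨π.symm l, κ.symm y, (hκ _ _ _).2 (by simpa using hl)⟩
  refine ⟨?_, ?_, ?_⟩
  · intro x y w w' h1 h2
    have := h.lift (hpath.1 h1) (hpath.1 h2)
    rwa [List.flatMap_map] at this
  · intro x u hx hu
    obtain ⟨u', rfl, hu'⟩ := h.parse ((hdom x).1 hx) hu
    refine ⟨u'.map π.symm, ?_, hpath.2 ?_⟩
    · rw [List.flatMap_map]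
      congr 1
      funext l
      simp
    · simpa using hu'
  · intro p w hp hw
    obtain ⟨a, b, x, rfl, hx, ha, hb⟩ := h.reach hp hw
    exact ⟨a, b, κ.symm x, rfl, (hdom _).2 (by simpa using hx), by simpa using ha,
      by simpa using hb⟩

/-! ### Piecewise translations -/

/-- The transitions of a piecewise translation: a point `x` of `I l` is translated by `δ l`. -/
def shiftStep {Λ : Type*} (I : Λ → Set ℝ) (δ : Λ → ℝ) (x : ℝ) (l : Λ) (y : ℝ) : Prop :=
  x ∈ I l ∧ x + δ l = y

section shiftStep

variable {Λ : Type*} [DecidableEq Λ] {I I' : Λ → Set ℝ} {δ δ' : Λ → ℝ} {b z : Λ}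

theorem exists_path_last {X Λ : Type*} {S : X → Λ → X → Prop} {x y : X} {l : Λ} {w : List Λ}
    (h : Path S x (l :: w) y) :
    ∃ w' m p, l :: w = w' ++ [m] ∧ Path S x w' p ∧ S p m y := by
  obtain ⟨w', m, hw⟩ : ∃ w' m, l :: w = w' ++ [m] :=
    ⟨_, _, (List.dropLast_append_getLast (List.cons_ne_nil l w)).symm⟩
  rw [hw] at h
  obtain ⟨p, hp, q, hq, rfl⟩ := path_append.1 h
  exact ⟨w', m, p, hw, hp, hq⟩

/-- Induction of a piecewise translation for which the image of `I b` lies in `I z`: the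
transitions `b`, `z` are replaced by one transition, so that `b` is replaced by `bz`. -/
theorem induces_merge_next (hbz : b ≠ z) (hI : ∀ l, l ≠ z → I' l = I l) (hIz : I' z ⊆ I z)
    (hδ : ∀ l, l ≠ b → δ' l = δ l) (hδb : δ' b = δ b + δ z)
    (hdisj : ∀ l, l ≠ z → ∀ x ∈ I l, x ∉ I z)
    (hb : ∀ x ∈ I b, x + δ b ∈ I z) (hb' : ∀ x ∈ I b, x + δ b ∉ I' z)
    (hret : ∀ l, l ≠ b → ∀ x ∈ I l, x + δ l ∈ I z → x + δ l ∈ I' z) :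
    Induces (shiftStep I δ) (shiftStep I' δ') id (fun l => if l = b then [b, z] else [l]) := by
  have hloc : ∀ {x l y}, shiftStep I' δ' x l y →
      Path (shiftStep I δ) x (if l = b then [b, z] else [l]) y := by
    rintro x l y ⟨hx, rfl⟩
    split_ifs with hl
    · subst hl
      rw [hI l hbz] at hx
      exact ⟨_, ⟨hx, rfl⟩, _, ⟨hb x hx, rfl⟩, by rw [hδb, ← add_assoc]; rfl⟩
    · refine ⟨_, ⟨?_, rfl⟩, by rw [hδ l hl]; rfl⟩
      by_cases hlz : l = z
      · subst hlz; exact hIz hx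
      · rwa [hI l hlz] at hx
  have hdomsub : ∀ {x}, (∃ l y, shiftStep I' δ' x l y) → ∃ l, x ∈ I' l := by
    rintro x ⟨l, y, h, -⟩
    exact ⟨l, h⟩
  have hI'I : ∀ {l x}, x ∈ I' l → x ∈ I l := by
    intro l x hx
    by_cases hlz : l = z
    · subst hlz; exact hIz hx
    · rwa [hI l hlz] at hx
  have hIl : ∀ {l m x}, x ∈ I' m → x ∈ I l → x ∈ I' l := by
    intro l m x hm hl
    by_cases hlz : l = z
    · subst hlz
      by_cases hml : m = l
      · rwa [hml] at hm
      · exact absurd hl (hdisj m hml x (hI'I hm))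
    · rwa [hI l hlz]
  refine ⟨?_, ?_, ?_⟩
  · intro x y w w' h1 h2
    clear h2
    induction w generalizing x with
    | nil => simpa using h1
    | cons l w ih =>
      obtain ⟨q, hq, h1⟩ := h1
      simp only [List.flatMap_cons]
      exact (hloc hq).trans (ih h1)
  · intro x u hx hu
    obtain ⟨m, hm⟩ := hdomsub hx
    -- The hypothesis on `q` says that it is not in the part of `I z` hit by `I b`; it survives
    -- every step other than `b`, and every pair `b`, `z`.
    have key : ∀ (n : ℕ) (u : List Λ) (q : ℝ), u.length ≤ n →
        (∀ l r, u = l :: r → q ∈ I l → q ∈ I' l) → Path (shiftStep I δ) q u x →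
        ∃ u' : List Λ, u = u'.flatMap (fun l => if l = b then [b, z] else [l]) ∧
          Path (shiftStep I' δ') q u' x := by
      intro n
      induction n with
      | zero =>
        intro u q hn _ hu
        obtain rfl : u = [] := List.length_eq_zero_iff.1 (by omega)
        exact ⟨[], rfl, hu⟩
      | succ n ih =>
        intro u q hn hq hu
        rcases u with _ | ⟨l, r⟩
        · exact ⟨[], rfl, hu⟩
        obtain ⟨q1, ⟨hql, rfl⟩, hr⟩ := hu
        have hql' := hq l r rfl hql
        by_cases hlb : l = b
        · subst hlb
          rcases r with _ | ⟨l2, r⟩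
          · exfalso
            obtain rfl : q + δ l = x := hr
            have := hIl hm (hb q hql)
            exact hb' q hql this
          · obtain ⟨q2, ⟨hq2, rfl⟩, hr⟩ := hr
            have hl2 : l2 = z := by
              by_contra hne
              exact hdisj l2 hne _ hq2 (hb q hql)
            subst hl2
            obtain ⟨u', rfl, hu'⟩ := ih r (q + δ l + δ l2) (by simp at hn ⊢; omega) (by
              intro l3 r3 _ h3
              by_cases h3z : l3 = l2
              · subst h3z; exact hret l3 hbz.symm _ hq2 h3
              · rwa [hI l3 h3z]) hr
            refine ⟨l :: u', by simp, _, ⟨hql', rfl⟩, ?_⟩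
            rwa [hδb, ← add_assoc]
        · obtain ⟨u', rfl, hu'⟩ := ih r (q + δ l) (by simp at hn ⊢; omega) (by
              intro l3 r3 _ h3
              by_cases h3z : l3 = z
              · subst h3z; exact hret l hlb _ hql h3
              · rwa [hI l3 h3z]) hr
          refine ⟨l :: u', by simp [hlb], _, ⟨hql', rfl⟩, ?_⟩
          rwa [hδ l hlb]
    exact key _ u x le_rfl (fun l r _ h => hIl hm h) hu
  · intro p w hp hw
    rcases w with _ | ⟨l, r⟩
    · exact absurd rfl hw
    by_cases hpl : p ∈ I' l
    · exact ⟨[], l :: r, p, rfl, ⟨l, _, hpl, rfl⟩, rfl, hp⟩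
    -- The only points missed by the new system lie in `I z` and were reached by `b`; one step `z`
    -- leads back to its domain.
    have hlz : l = z := by
      by_contra hlz
      obtain ⟨q, hq, -⟩ := hp
      rw [hI l hlz] at hpl
      exact hpl hq.1
    subst hlz
    obtain ⟨q, hq, hr⟩ := id hp
    obtain ⟨w', m, p', hw', -, hm⟩ := exists_path_last hp
    have hmb : m = b := by
      by_contra hmb
      have h2 := hret m hmb p' hm.1
      rw [hm.2] at h2
      exact hpl (h2 hq.1)
    rcases r with _ | ⟨n, r⟩
    · obtain ⟨q', hq', h2⟩ := hp
      exfalso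
      rcases w' with _ | ⟨t, w'⟩
      · simp at hw'
        exact hbz (hmb.symm.trans hw'.symm)
      · simp at hw'
    · obtain ⟨q2, hq2, hr2⟩ := id hr
      refine ⟨[l], n :: r, q, rfl, ⟨n, _, ?_, rfl⟩, ⟨q, hq, rfl⟩, hr⟩
      by_cases hnl : n = l
      · subst hnl
        have := hret n hbz.symm p hq.1
        rw [hq.2] at this
        exact this hq2.1
      · rw [hI n hnl]; exact hq2.1

/-- Induction of a piecewise translation for which `I z` lies in the image of `I b`: the
transitions `b`, `z` are replaced by one transition, so that `z` is replaced by `bz`. -/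
theorem induces_merge_prev (hbz : b ≠ z) (hI : ∀ l, l ≠ z → l ≠ b → I' l = I l)
    (hIb : I' b ⊆ I b) (hδ : ∀ l, l ≠ z → δ' l = δ l) (hδz : δ' z = δ b + δ z)
    (hdisj : ∀ l m, l ≠ m → ∀ x ∈ I l, x ∉ I m)
    (hz : ∀ x ∈ I' z, x ∈ I b ∧ x + δ b ∈ I z)
    (hprev : ∀ l, l ≠ b → ∀ x ∈ I l, x + δ l ∉ I z)
    (hret : ∀ x ∈ I b, x + δ b ∈ I z → x ∈ I' z)
    (hret' : ∀ x ∈ I b, ∀ m, m ≠ z → x + δ b ∈ I m → x ∈ I' b) :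
    Induces (shiftStep I δ) (shiftStep I' δ') id (fun l => if l = z then [b, z] else [l]) := by
  have hI'I : ∀ {l x}, l ≠ z → x ∈ I' l → x ∈ I l := by
    intro l x hl hx
    by_cases hlb : l = b
    · subst hlb; exact hIb hx
    · rwa [hI l hl hlb] at hx
  have hloc : ∀ {x l y}, shiftStep I' δ' x l y →
      Path (shiftStep I δ) x (if l = z then [b, z] else [l]) y := by
    rintro x l y ⟨hx, rfl⟩
    split_ifs with hl
    · subst hl
      exact ⟨_, ⟨(hz x hx).1, rfl⟩, _, ⟨(hz x hx).2, rfl⟩, by rw [hδz, ← add_assoc]; rfl⟩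
    · exact ⟨_, ⟨hI'I hl hx, rfl⟩, by rw [hδ l hl]; rfl⟩
  have hdom : ∀ {x}, (∃ l y, shiftStep I' δ' x l y) → ∃ l, l ≠ z ∧ x ∈ I l := by
    rintro x ⟨l, y, h, -⟩
    by_cases hl : l = z
    · subst hl
      exact ⟨b, hbz, (hz x h).1⟩
    · exact ⟨l, hl, hI'I hl h⟩
  refine ⟨?_, ?_, ?_⟩
  · intro x y w w' h1 h2
    clear h2
    induction w generalizing x with
    | nil => simpa using h1
    | cons l w ih =>
      obtain ⟨q, hq, h1⟩ := h1
      simp only [List.flatMap_cons]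
      exact (hloc hq).trans (ih h1)
  · intro x u hx hu
    obtain ⟨m, hmz, hm⟩ := hdom hx
    -- The section is the complement of `I z`. A step `b` into `I z` is read together with the
    -- following `z`; by `hprev` no other step enters `I z`.
    have key : ∀ (n : ℕ) (u : List Λ) (q : ℝ), u.length ≤ n →
        q ∉ I z → Path (shiftStep I δ) q u x →
        ∃ u' : List Λ, u = u'.flatMap (fun l => if l = z then [b, z] else [l]) ∧
          Path (shiftStep I' δ') q u' x := by
      intro n
      induction n with
      | zero =>
        intro u q hn _ hu
        obtain rfl : u = [] := List.length_eq_zero_iff.1 (by omega)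
        exact ⟨[], rfl, hu⟩
      | succ n ih =>
        intro u q hn hq hu
        rcases u with _ | ⟨l, r⟩
        · exact ⟨[], rfl, hu⟩
        obtain ⟨q1, ⟨hql, rfl⟩, hr⟩ := hu
        have hlz : l ≠ z := fun h => hq (h ▸ hql)
        by_cases hlb : l = b
        · subst hlb
          by_cases hq1 : q + δ l ∈ I z
          · rcases r with _ | ⟨l2, r⟩
            · obtain rfl : q + δ l = x := hr
              exact absurd hq1 (hdisj m z hmz _ hm)
            · obtain ⟨q2, ⟨hq2, rfl⟩, hr⟩ := hr
              have hl2 : l2 = z := by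
                by_contra hne
                exact hdisj l2 z hne _ hq2 hq1
              subst hl2
              obtain ⟨u', rfl, hu'⟩ := ih r (q + δ l + δ l2) (by simp at hn ⊢; omega)
                (hprev l2 hlz.symm _ hq2) hr
              refine ⟨l2 :: u', by simp, _, ⟨hret q hql hq1, rfl⟩, ?_⟩
              rwa [hδz, ← add_assoc]
          · have hq' : q ∈ I' l := by
              rcases r with _ | ⟨l2, r⟩
              · obtain rfl : q + δ l = x := hr
                exact hret' q hql m hmz hm
              · obtain ⟨q2, ⟨hq2, rfl⟩, hr⟩ := hr
                exact hret' q hql l2 (fun h => hq1 (h ▸ hq2)) hq2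
            obtain ⟨u', rfl, hu'⟩ := ih r (q + δ l) (by simp at hn ⊢; omega) hq1 hr
            refine ⟨l :: u', by simp [hlz], _, ⟨hq', rfl⟩, ?_⟩
            rwa [hδ l hlz]
        · obtain ⟨u', rfl, hu'⟩ := ih r (q + δ l) (by simp at hn ⊢; omega)
            (hprev l hlb _ hql) hr
          refine ⟨l :: u', by simp [hlz], _, ⟨by rwa [hI l hlz hlb], rfl⟩, ?_⟩
          rwa [hδ l hlz]
    exact key _ u x le_rfl (hdisj m z hmz x hm) hu
  · intro p w hp hw
    rcases w with _ | ⟨l, r⟩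
    · exact absurd rfl hw
    obtain ⟨w', m, p', hw', hp', hm⟩ := exists_path_last hp
    obtain ⟨q, hq, hr⟩ := id hp
    by_cases hlz : l = z
    · subst hlz
      have hmb : m = b := by
        by_contra hmb
        have h2 := hprev m hmb p' hm.1
        rw [hm.2] at h2
        exact h2 hq.1
      subst hmb
      refine ⟨w', [m], p', hw', ⟨l, _, hret p' hm.1 ?_, rfl⟩, hp', ⟨p, hm, rfl⟩⟩
      rw [hm.2]
      exact hq.1
    · refine ⟨[], l :: r, p, rfl, ?_, rfl, hp⟩
      by_cases hlb : l = b
      · subst hlb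
        -- A point of `I b` sent to an endpoint of an interval belongs to neither new interval; on a
        -- closed path there is always a next letter, which excludes this.
        have hnext : ∃ n, q ∈ I n := by
          rcases r with _ | ⟨n, r⟩
          · obtain rfl : q = p := hr
            exact ⟨l, hq.1⟩
          · obtain ⟨q2, hq2, -⟩ := hr
            exact ⟨n, hq2.1⟩
        obtain ⟨n, hn⟩ := hnext
        rw [← hq.2] at hn
        by_cases hnz : n = z
        · subst hnz
          exact ⟨n, _, hret p hq.1 hn, rfl⟩
        · exact ⟨l, _, hret' p hq.1 n hnz hn, rfl⟩
      · exact ⟨l, _, by rw [hI l hlz hlb]; exact hq.1, rfl⟩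

end shiftStep

section shiftStep

variable {X Λ₀ Λ : Type*} {S : X → Λ₀ → X → Prop} {ι : ℝ → X} {τ τ' : Λ → List Λ₀}
  [DecidableEq Λ] {I I' : Λ → Set ℝ} {δ δ' : Λ → ℝ}

theorem Induces.merge_next (h : Induces S (shiftStep I δ) ι τ) (hS : IsDeterministic S)
    (b z : Λ) (hbz : b ≠ z) (hI : ∀ l, l ≠ z → I' l = I l) (hIz : I' z ⊆ I z)
    (hδ : ∀ l, l ≠ b → δ' l = δ l) (hδb : δ' b = δ b + δ z)
    (hdisj : ∀ l, l ≠ z → ∀ x ∈ I l, x ∉ I z)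
    (hb : ∀ x ∈ I b, x + δ b ∈ I z) (hb' : ∀ x ∈ I b, x + δ b ∉ I' z)
    (hret : ∀ l, l ≠ b → ∀ x ∈ I l, x + δ l ∈ I z → x + δ l ∈ I' z)
    (hτ : ∀ l, τ' l = if l = b then τ b ++ τ z else τ l) :
    Induces S (shiftStep I' δ') ι τ' := by
  have := h.comp (induces_merge_next hbz hI hIz hδ hδb hdisj hb hb' hret) hS (by
    rintro x l y ⟨hx, -⟩
    refine ⟨l, _, ?_, rfl⟩
    by_cases hl : l = z
    · subst hl; exact hIz hx
    · rwa [hI l hl] at hx)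
  obtain rfl : τ' = fun l => (if l = b then [b, z] else [l]).flatMap τ := by
    funext l
    rw [hτ]
    split_ifs <;> simp
  exact this

theorem Induces.merge_prev (h : Induces S (shiftStep I δ) ι τ) (hS : IsDeterministic S)
    (b z : Λ) (hbz : b ≠ z) (hI : ∀ l, l ≠ z → l ≠ b → I' l = I l)
    (hIb : I' b ⊆ I b) (hδ : ∀ l, l ≠ z → δ' l = δ l) (hδz : δ' z = δ b + δ z)
    (hdisj : ∀ l m, l ≠ m → ∀ x ∈ I l, x ∉ I m)
    (hz : ∀ x ∈ I' z, x ∈ I b ∧ x + δ b ∈ I z)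
    (hprev : ∀ l, l ≠ b → ∀ x ∈ I l, x + δ l ∉ I z)
    (hret : ∀ x ∈ I b, x + δ b ∈ I z → x ∈ I' z)
    (hret' : ∀ x ∈ I b, ∀ m, m ≠ z → x + δ b ∈ I m → x ∈ I' b)
    (hτ : ∀ l, τ' l = if l = z then τ b ++ τ z else τ l) :
    Induces S (shiftStep I' δ') ι τ' := by
  have := h.comp (induces_merge_prev hbz hI hIb hδ hδz hdisj hz hprev hret hret') hS (by
    rintro x l y ⟨hx, -⟩
    by_cases hl : l = z
    · subst hl; exact ⟨b, _, (hz x hx).1, rfl⟩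
    · refine ⟨l, _, ?_, rfl⟩
      by_cases hlb : l = b
      · subst hlb; exact hIb hx
      · rwa [hI l hl hlb] at hx)
  obtain rfl : τ' = fun l => (if l = z then [b, z] else [l]).flatMap τ := by
    funext l
    rw [hτ]
    split_ifs <;> simp
  exact this

end shiftStep

/-! ### Interval exchanges with four intervals -/

/-- The letters stand for the short and the long closed trajectories in the two directions that
bound a sector. -/
inductive Letter
  | sP | lP | lQ | sQ
  deriving DecidableEq

open Letter

/-- The function on the letters with the given values. -/
def quad {α : Type*} (a b c d : α) : Letter → α
  | sP => a
  | lP => b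
  | lQ => c
  | sQ => d

section quad

variable {α : Type*} (a b c d : α)

@[simp] theorem quad_sP : quad a b c d sP = a := rfl
@[simp] theorem quad_lP : quad a b c d lP = b := rfl
@[simp] theorem quad_lQ : quad a b c d lQ = c := rfl
@[simp] theorem quad_sQ : quad a b c d sQ = d := rfl

end quad

/-- Translation of four intervals: the interval of `l` is `(lo l, hi l)`. -/
abbrev quadStep (lo hi δ : Letter → ℝ) : ℝ → Letter → ℝ → Prop :=
  shiftStep (fun l => Set.Ioo (lo l) (hi l)) δ

/-- The exchange of four consecutive intervals of lengths `a`, `b`, `c`, `d`, starting at `o`, whose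
images have the order `c`, `a`, `d`, `b`. -/
def iet (o a b c d : ℝ) : ℝ → Letter → ℝ → Prop :=
  quadStep (quad o (o + a) (o + a + b) (o + a + b + c))
    (quad (o + a) (o + a + b) (o + a + b + c) (o + a + b + c + d)) (quad c (c + d) (-(a + b)) (-b))

section children

variable {X Λ₀ : Type*} {S : X → Λ₀ → X → Prop} {ι : ℝ → X} {τ τ' : Letter → List Λ₀}
  {o a b c d : ℝ}

theorem Letter.forall {p : Letter → Prop} : (∀ l, p l) ↔ p sP ∧ p lP ∧ p lQ ∧ p sQ :=
  ⟨fun h => ⟨h _, h _, h _, h _⟩, fun ⟨h1, h2, h3, h4⟩ l => by cases l <;> assumption⟩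

/-- Induction on `(o + a + b, o + a + c + d)`. As `b ≤ d`, the image of `lP` lies in the interval of
`sQ`; as `a + b ≤ c`, the intervals of `sP` and `lP` lie in the image of `lQ`. These facts permit
the three merges. -/
theorem Induces.iet_right_right (h : Induces S (iet o a b c d) ι τ) (hS : IsDeterministic S)
    (ha : 0 ≤ a) (hb : 0 ≤ b) (hbd : b ≤ d) (habc : a + b ≤ c) :
    Induces S (iet (o + a + b) a b (c - a - b) (d - b)) ι
      (quad (τ lQ ++ τ sP) (τ lQ ++ τ lP ++ τ sQ) (τ lQ) (τ sQ)) := by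
  have h1 : Induces S (quadStep (quad o (o + a) (o + a + b) (o + a + b + c))
      (quad (o + a) (o + a + b) (o + a + b + c) (o + a + c + d))
      (quad c (c + d - b) (-(a + b)) (-b))) ι
      (quad (τ sP) (τ lP ++ τ sQ) (τ lQ) (τ sQ)) := by
    apply h.merge_next hS lP sQ
    all_goals simp only [Letter.forall, quad_sP, quad_lP, quad_lQ, quad_sQ, ne_eq, reduceCtorEq,
      not_true_eq_false, not_false_eq_true, Set.mem_Ioo, not_and, not_lt, if_true, if_false,
      forall_true_left, true_and, and_true, false_imp_iff, and_imp, Set.subset_def]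
    all_goals repeat' first | apply And.intro | intro _
    all_goals first | rfl | linarith
  have h2 : Induces S (quadStep (quad (o + a + b) (o + a) (o + a + b + a) (o + a + b + c))
      (quad (o + a + b + a) (o + a + b) (o + a + b + c) (o + a + c + d))
      (quad (c - a - b) (c + d - b) (-(a + b)) (-b))) ι
      (quad (τ lQ ++ τ sP) (τ lP ++ τ sQ) (τ lQ) (τ sQ)) := by
    apply h1.merge_prev hS lQ sP
    all_goals simp only [Letter.forall, quad_sP, quad_lP, quad_lQ, quad_sQ, ne_eq, reduceCtorEq,
      not_true_eq_false, not_false_eq_true, Set.mem_Ioo, not_and, not_lt, if_true, if_false,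
      forall_true_left, true_and, and_true, false_imp_iff, and_imp, Set.subset_def]
    all_goals repeat' first | apply And.intro | intro _
    all_goals first | rfl | linarith
  have h3 : Induces S (quadStep
      (quad (o + a + b) (o + a + b + a) (o + a + b + a + b) (o + a + b + c))
      (quad (o + a + b + a) (o + a + b + a + b) (o + a + b + c) (o + a + c + d))
      (quad (c - a - b) (c + d - a - 2 * b) (-(a + b)) (-b))) ι
      (quad (τ lQ ++ τ sP) (τ lQ ++ τ lP ++ τ sQ) (τ lQ) (τ sQ)) := by
    apply h2.merge_prev hS lQ lP
    all_goals simp only [Letter.forall, quad_sP, quad_lP, quad_lQ, quad_sQ, ne_eq, reduceCtorEq,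
      not_true_eq_false, not_false_eq_true, Set.mem_Ioo, not_and, not_lt, if_true, if_false,
      forall_true_left, true_and, and_true, false_imp_iff, and_imp, Set.subset_def]
    all_goals repeat' first | apply And.intro | intro _
    all_goals first | rfl | linarith | simp only [List.append_assoc]
  unfold iet
  convert h3 using 3 <;> ring

/-- Induction on `(o + a, o + a + c)` by five merges, each permitted by one of the inequalities
between the lengths. The result has the same combinatorics only after the letters have been renamed.
-/
theorem Induces.iet_right_left (h : Induces S (iet o a b c d) ι τ) (hS : IsDeterministic S)
    (ha : 0 ≤ a) (hd : 0 ≤ d) (hdb : d ≤ b) (hbc : b ≤ c) (h₁ : a + b ≤ c + d)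
    (h₂ : c ≤ a + b) :
    Induces S (iet (o + a) (b - d) (a + b - c) (c + d - a - b) (c - b)) ι
      (quad (τ lP ++ τ lQ) (τ lP ++ τ sQ ++ τ lQ ++ τ sP) (τ lP ++ τ sQ ++ τ lQ)
        (τ lQ ++ τ sP)) := by
  have h1 : Induces S (quadStep (quad o (o + a) (o + a + b) (o + a + b - d))
      (quad (o + a) (o + a + b - d) (o + a + b + c) (o + a + b))
      (quad c (c + d) (-(a + b)) (c + d - b))) ι
      (quad (τ sP) (τ lP) (τ lQ) (τ lP ++ τ sQ)) := by
    apply h.merge_prev hS lP sQ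
    all_goals simp only [Letter.forall, quad_sP, quad_lP, quad_lQ, quad_sQ, ne_eq, reduceCtorEq,
      not_true_eq_false, not_false_eq_true, Set.mem_Ioo, not_and, not_lt, if_true, if_false,
      forall_true_left, true_and, and_true, false_imp_iff, and_imp, Set.subset_def]
    all_goals repeat' first | apply And.intro | intro _
    all_goals first | rfl | linarith
  have h2 : Induces S (quadStep (quad o (o + a) (o + a + b) (o + a + b - d))
      (quad (o + a) (o + a + b - d) (o + a + c + d) (o + a + b))
      (quad c (c + d - a - b) (-(a + b)) (c + d - b))) ι
      (quad (τ sP) (τ lP ++ τ lQ) (τ lQ) (τ lP ++ τ sQ)) := by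
    apply h1.merge_next hS lP lQ
    all_goals simp only [Letter.forall, quad_sP, quad_lP, quad_lQ, quad_sQ, ne_eq, reduceCtorEq,
      not_true_eq_false, not_false_eq_true, Set.mem_Ioo, not_and, not_lt, if_true, if_false,
      forall_true_left, true_and, and_true, false_imp_iff, and_imp, Set.subset_def]
    all_goals repeat' first | apply And.intro | intro _
    all_goals first | rfl | linarith
  have h3 : Induces S (quadStep (quad (o + a + b) (o + a) (o + 2 * a + b) (o + a + b - d))
      (quad (o + 2 * a + b) (o + a + b - d) (o + a + c + d) (o + a + b))
      (quad (c - a - b) (c + d - a - b) (-(a + b)) (c + d - b))) ι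
      (quad (τ lQ ++ τ sP) (τ lP ++ τ lQ) (τ lQ) (τ lP ++ τ sQ)) := by
    apply h2.merge_prev hS lQ sP
    all_goals simp only [Letter.forall, quad_sP, quad_lP, quad_lQ, quad_sQ, ne_eq, reduceCtorEq,
      not_true_eq_false, not_false_eq_true, Set.mem_Ioo, not_and, not_lt, if_true, if_false,
      forall_true_left, true_and, and_true, false_imp_iff, and_imp, Set.subset_def]
    all_goals repeat' first | apply And.intro | intro _
    all_goals first | rfl | linarith
  have h4 : Induces S (quadStep
      (quad (o + a + b) (o + a) (o + 2 * a + 2 * b - c - d) (o + a + b - d))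
      (quad (o + 2 * a + b) (o + a + b - d) (o + a + b) (o + 2 * a + 2 * b - c - d))
      (quad (c - a - b) (c + d - a - b) (c + d - a - 2 * b) (c + d - b))) ι
      (quad (τ lQ ++ τ sP) (τ lP ++ τ lQ) (τ lP ++ τ sQ ++ τ lQ) (τ lP ++ τ sQ)) := by
    apply h3.merge_prev hS sQ lQ
    all_goals simp only [Letter.forall, quad_sP, quad_lP, quad_lQ, quad_sQ, ne_eq, reduceCtorEq,
      not_true_eq_false, not_false_eq_true, Set.mem_Ioo, not_and, not_lt, if_true, if_false,
      forall_true_left, true_and, and_true, false_imp_iff, and_imp, Set.subset_def]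
    all_goals repeat' first | apply And.intro | intro _
    all_goals first | rfl | linarith
  have h5 : Induces S (quadStep
      (quad (o + a + b) (o + a) (o + 2 * a + 2 * b - c - d) (o + a + b - d))
      (quad (o + a + c) (o + a + b - d) (o + a + b) (o + 2 * a + 2 * b - c - d))
      (quad (c - a - b) (c + d - a - b) (c + d - a - 2 * b) (2 * c + d - a - 2 * b))) ι
      (quad (τ lQ ++ τ sP) (τ lP ++ τ lQ) (τ lP ++ τ sQ ++ τ lQ)
        (τ lP ++ τ sQ ++ τ lQ ++ τ sP)) := by
    apply h4.merge_next hS sQ sP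
    all_goals simp only [Letter.forall, quad_sP, quad_lP, quad_lQ, quad_sQ, ne_eq, reduceCtorEq,
      not_true_eq_false, not_false_eq_true, Set.mem_Ioo, not_and, not_lt, if_true, if_false,
      forall_true_left, true_and, and_true, false_imp_iff, and_imp, Set.subset_def]
    all_goals repeat' first | apply And.intro | intro _
    all_goals first | rfl | linarith | simp only [List.append_assoc]
  -- From left to right the intervals now belong to `lP`, `sQ`, `lQ`, `sP`; `π` renames them by
  -- position.
  let π : Letter ≃ Letter :=
    ⟨quad lP sQ lQ sP, quad sQ sP lQ lP, fun l => by cases l <;> rfl, fun l => by cases l <;> rfl⟩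
  have h6 := h5.comp_equiv (Equiv.refl ℝ) π
    (S'' := iet (o + a) (b - d) (a + b - c) (c + d - a - b) (c - b)) (by
      intro x l y
      cases l <;> simp only [iet, quadStep, shiftStep, Set.mem_Ioo, Equiv.refl_apply, π,
        Equiv.coe_fn_mk, quad_sP, quad_lP, quad_lQ, quad_sQ] <;>
      ring_nf)
  have hπ : quad (τ lP ++ τ lQ) (τ lP ++ τ sQ ++ τ lQ ++ τ sP) (τ lP ++ τ sQ ++ τ lQ)
      (τ lQ ++ τ sP) = quad (τ lQ ++ τ sP) (τ lP ++ τ lQ) (τ lP ++ τ sQ ++ τ lQ)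
        (τ lP ++ τ sQ ++ τ lQ ++ τ sP) ∘ π := by
    funext l
    cases l <;> rfl
  rw [hπ]
  exact h6

/-- The reflection of the letters. -/
def Letter.swap : Letter ≃ Letter :=
  ⟨quad sQ lQ lP sP, quad sQ lQ lP sP, fun l => by cases l <;> rfl, fun l => by cases l <;> rfl⟩

/-- The reflection `x ↦ -x` reverses the orders of the intervals and of their images, which
exchanges the roles of `P` and `Q`. Time is not reversed, so the words stay as they are. The
relation between `ι'` and `ι` keeps the section in the first pentagon. -/
theorem Induces.iet_swap (h : Induces S (iet o a b c d) ι τ) :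
    ∃ o' ι', (∀ x, ∃ y, ι' x = ι y) ∧
      Induces S (iet o' d c b a) ι' (quad (τ sQ) (τ lQ) (τ lP) (τ sP)) := by
  have h6 := h.comp_equiv (Equiv.neg ℝ) Letter.swap
    (S'' := iet (-(o + a + b + c + d)) d c b a) (by
      intro x l y
      cases l <;> simp only [iet, quadStep, shiftStep, Set.mem_Ioo, Letter.swap,
        Equiv.coe_fn_mk, quad_sP, quad_lP, quad_lQ, quad_sQ, Equiv.neg_apply] <;>
      (constructor <;> rintro ⟨⟨h1, h2⟩, h3⟩ <;> refine ⟨⟨?_, ?_⟩, ?_⟩ <;> linarith))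
  have hτ : quad (τ sQ) (τ lQ) (τ lP) (τ sP) = τ ∘ Letter.swap := by
    funext l
    cases l <;> rfl
  rw [hτ]
  exact ⟨_, _, fun x => ⟨-x, rfl⟩, h6⟩

end children

/-! ### Arithmetic of the pentagon -/

theorem ω_pow_five : ω ^ 5 = 1 := (Complex.isPrimitiveRoot_exp 5 (by norm_num)).pow_eq_one

theorem ω_ne_one : ω ≠ 1 := (Complex.isPrimitiveRoot_exp 5 (by norm_num)).ne_one (by norm_num)

theorem ω_sum : ω ^ 4 + ω ^ 3 + ω ^ 2 + ω + 1 = 0 := by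
  have h : (ω - 1) * (ω ^ 4 + ω ^ 3 + ω ^ 2 + ω + 1) = 0 := by
    linear_combination ω_pow_five
  exact (mul_eq_zero.1 h).resolve_left (sub_ne_zero.2 ω_ne_one)

theorem goldenRatio_eq : ((goldenRatio : ℝ) : ℂ) = -ω ^ 2 - ω ^ 3 := by
  have h5 : Real.cos (Real.pi / 5) = (1 + Real.sqrt 5) / 4 := Real.cos_pi_div_five
  have h1 : ω ^ 2 + ω ^ 3 = ((2 * Real.cos (4 * Real.pi / 5) : ℝ) : ℂ) := by
    have e2 : ω ^ 2 = Complex.exp ((4 * Real.pi / 5 : ℝ) * Complex.I) := by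
      rw [ω, ← Complex.exp_nat_mul]; congr 1; push_cast; ring
    have e3 : ω ^ 3 = Complex.exp (-((4 * Real.pi / 5 : ℝ) * Complex.I)) := by
      have : ω ^ 3 * ω ^ 2 = 1 := by rw [← ω_pow_five]; ring
      rw [Complex.exp_neg, ← e2]
      exact eq_inv_of_mul_eq_one_left this
    rw [e2, e3]
    push_cast
    rw [Complex.two_cos, neg_mul]
  have h2 : Real.cos (4 * Real.pi / 5) = -Real.cos (Real.pi / 5) := by
    rw [← Real.cos_pi_sub]; congr 1; ring
  have h3 : (-ω ^ 2 - ω ^ 3 : ℂ) = -(ω ^ 2 + ω ^ 3) := by ring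
  rw [h3, h1, h2, h5, ← Complex.ofReal_neg]
  congr 1
  rw [Real.goldenRatio]; ring

theorem ω_pow_val_add (j k : Label) : ω ^ (2 * (j + k).val) = ω ^ (2 * j.val) * ω ^ (2 * k.val) := by
  rw [ZMod.val_add, ← pow_add, ← Nat.mul_add]
  have : ∀ n : ℕ, ω ^ (2 * (n % 5)) = ω ^ (2 * n) := by
    intro n
    conv_rhs => rw [← Nat.div_add_mod n 5]
    rw [Nat.mul_add, pow_add, show 2 * (5 * (n / 5)) = 5 * (2 * (n / 5)) by ring, pow_mul ω 5,
      ω_pow_five, one_pow, one_mul]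
  exact this _

/-- The direction vector of the side labelled `j` of the first pentagon. -/
def sideVec (j : Label) : ℂ := ω ^ (2 * j.val) * (ω - 1)

/-- The second boundary vector of the sector bounded by the directions of the sides `j` and
`j + 1`. -/
def sideVec' (j : Label) : ℂ := -ω ^ 2 * sideVec j

/-- The point of the plane with the coordinates `a`, `b`: the origin is a vertex of the first
pentagon, the axes have the directions of the sides `j` and `j + 1`. -/
def affPt (j : Label) (a b : ℝ) : ℂ :=
  ω ^ (2 * j.val) * ω ^ 3 + (a : ℂ) * sideVec j + (b : ℂ) * sideVec' j

/-- The coordinates of the endpoints of the side `j + k`. -/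
def startA : Label → ℝ := ![-goldenRatio ^ 2, 0, -goldenRatio, -goldenRatio, 0]
def startB : Label → ℝ := ![goldenRatio ^ 2, 1, 1, goldenRatio ^ 2, 0]
def endA : Label → ℝ := ![-goldenRatio, 0, -goldenRatio ^ 2, 0, -goldenRatio]
def endB : Label → ℝ := ![goldenRatio ^ 2, 0, goldenRatio ^ 2, 1, 1]

/-- Once `φ` is replaced by `-ω² - ω³`, these are polynomial identities modulo `1 + ω + ω² + ω³ +
ω⁴`; the coefficients of `h` are the cofactors. -/
theorem sideStart_eq (e : Sheet) (j k : Label) :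
    sideStart e (j + k) = ((e : ℤ) : ℂ) * affPt j (startA k) (startB k) := by
  rw [sideStart, ω_pow_val_add]
  congr 1
  have h := ω_sum
  have hg := goldenRatio_eq
  unfold affPt sideVec' sideVec startA startB
  generalize ω ^ (2 * j.val) = u
  generalize goldenRatio = g at *
  fin_cases k <;> simp [ZMod.val, hg]
  · linear_combination (u * (1 - ω - ω ^ 3 + ω ^ 5)) * h
  · ring
  · ring
  · linear_combination (u * (ω ^ 2 - 2 * ω ^ 3 + ω ^ 5)) * h
  · left
    linear_combination (-ω ^ 3 + ω ^ 4) * h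

theorem sideEnd_eq (e : Sheet) (j k : Label) :
    sideEnd e (j + k) = ((e : ℤ) : ℂ) * affPt j (endA k) (endB k) := by
  rw [sideEnd, pow_succ, ω_pow_val_add]
  congr 1
  have h := ω_sum
  have hg := goldenRatio_eq
  unfold affPt sideVec' sideVec endA endB
  generalize ω ^ (2 * j.val) = u
  generalize goldenRatio = g at *
  fin_cases k <;> simp [ZMod.val, hg]
  · linear_combination (u * (ω - 2 * ω ^ 3 + ω ^ 5)) * h
  · ring
  · linear_combination (u * (-ω ^ 3 + ω ^ 5)) * h
  · linear_combination (u * (-ω ^ 2 + ω ^ 3)) * h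
  · linear_combination (u * (-ω ^ 4 + ω ^ 5)) * h

theorem ω_sq_im_pos : 0 < (ω ^ 2).im := by
  have : ω ^ 2 = Complex.exp ((4 * Real.pi / 5 : ℝ) * Complex.I) := by
    rw [ω, ← Complex.exp_nat_mul]; congr 1; push_cast; ring
  rw [this, Complex.exp_ofReal_mul_I_im]
  apply Real.sin_pos_of_pos_of_lt_pi <;> linarith [Real.pi_pos]

theorem ω_ne_zero : ω ≠ 0 := (Complex.isPrimitiveRoot_exp 5 (by norm_num)).ne_zero (by norm_num)

theorem sideVec_ne_zero (j : Label) : sideVec j ≠ 0 :=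
  mul_ne_zero (pow_ne_zero _ ω_ne_zero) (sub_ne_zero.2 ω_ne_one)

/-- The quotient of the two axis vectors is `-ω²`, which is not real. -/
theorem sideVec_combination_eq_zero {j : Label} {a b : ℝ}
    (h : (a : ℂ) * sideVec j + (b : ℂ) * sideVec' j = 0) : a = 0 ∧ b = 0 := by
  have h1 : ((a : ℂ) - b * ω ^ 2) * sideVec j = 0 := by
    rw [← h, sideVec']; ring
  have h2 := (mul_eq_zero.1 h1).resolve_right (sideVec_ne_zero j)
  have him := congrArg Complex.im h2
  have hre := congrArg Complex.re h2
  simp only [Complex.sub_im, Complex.ofReal_im, Complex.im_ofReal_mul,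
    Complex.zero_im, zero_sub, neg_eq_zero, mul_eq_zero, ω_sq_im_pos.ne', or_false] at him
  subst him
  simpa using hre

theorem affPt_inj {j : Label} {a b a' b' : ℝ} (h : affPt j a b = affPt j a' b') :
    a = a' ∧ b = b' := by
  have := sideVec_combination_eq_zero (j := j) (a := a - a') (b := b - b') (by
    unfold affPt at h
    push_cast
    linear_combination h)
  exact ⟨by linarith [this.1], by linarith [this.2]⟩

/-- The point with coordinates `a`, `b` lies in the interior of the side `j + k`. -/
def OnSide (k : Label) (a b : ℝ) : Prop :=
  ∃ θ : ℝ, 0 < θ ∧ θ < 1 ∧ a = startA k + θ * (endA k - startA k) ∧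
    b = startB k + θ * (endB k - startB k)

theorem mem_openSide_iff {e : Sheet} {j k : Label} {z : ℂ} :
    z ∈ openSide e (j + k) ↔ ∃ a b, OnSide k a b ∧ z = ((e : ℤ) : ℂ) * affPt j a b := by
  rw [openSide, sideStart_eq, sideEnd_eq, openSegment_eq_image_lineMap]
  constructor
  · rintro ⟨θ, ⟨h0, h1⟩, rfl⟩
    refine ⟨_, _, ⟨θ, h0, h1, rfl, rfl⟩, ?_⟩
    simp only [AffineMap.lineMap_apply, vsub_eq_sub, vadd_eq_add, Complex.real_smul, affPt]
    push_cast
    ring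
  · rintro ⟨a, b, ⟨θ, h0, h1, rfl, rfl⟩, rfl⟩
    refine ⟨θ, ⟨h0, h1⟩, ?_⟩
    simp only [AffineMap.lineMap_apply, vsub_eq_sub, vadd_eq_add, Complex.real_smul, affPt]
    push_cast
    ring

/-- The growth of the transverse coordinate along the side `j + k`. -/
def rate (k : Label) (x y : ℝ) : ℝ :=
  x * (endB k - startB k) - y * (endA k - startA k)

/-- The affine function that vanishes on the side `j + k` and is positive on the rest of the
pentagon. -/
def depth (k : Label) (a b : ℝ) : ℝ :=
  (endB k - startB k) * (a - startA k) - (endA k - startA k) * (b - startB k)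

/-- The same determinant `rate` is the growth of the transverse coordinate along a side and the
growth of the depth along the velocity. Hence its sign decides whether the flow enters or leaves
through the side. -/
theorem depth_add (k : Label) (a b p q : ℝ) :
    depth k (a + p) (b + q) = depth k a b + rate k p q := by
  unfold depth rate; ring

theorem OnSide.depth_eq_zero {k : Label} {a b : ℝ} (h : OnSide k a b) : depth k a b = 0 := by
  obtain ⟨θ, -, -, rfl, rfl⟩ := h
  unfold depth; ring

/-- Convexity of the pentagon. One of the two depths vanishes if the sides are adjacent, but never
both. -/
theorem depth_vertices (k m : Label) (h : m ≠ k) :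
    0 ≤ depth k (startA m) (startB m) ∧ 0 ≤ depth k (endA m) (endB m) ∧
      0 < depth k (startA m) (startB m) + depth k (endA m) (endB m) := by
  have g2 := Real.goldenRatio_sq
  have g1 := Real.one_lt_goldenRatio
  unfold depth startA startB endA endB
  generalize goldenRatio = g at *
  have g3 : g ^ 3 = 2 * g + 1 := by linear_combination (g + 1) * g2
  have g4 : g ^ 4 = 3 * g + 2 := by linear_combination (g ^ 2 + g + 2) * g2
  revert h
  fin_cases k <;> fin_cases m <;> intro h <;> first | exact absurd rfl h | skip
  all_goals
    clear h
    simp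
    repeat' apply And.intro
  all_goals linarith

theorem OnSide.depth_pos {k m : Label} {a b : ℝ} (h : OnSide m a b) (hk : m ≠ k) :
    0 < depth k a b := by
  obtain ⟨θ, h0, h1, rfl, rfl⟩ := h
  obtain ⟨e1, e2, e3⟩ := depth_vertices k m hk
  have : depth k (startA m + θ * (endA m - startA m)) (startB m + θ * (endB m - startB m)) =
      (1 - θ) * depth k (startA m) (startB m) + θ * depth k (endA m) (endB m) := by
    unfold depth; ring
  rw [this]
  rcases e1.lt_or_eq with h | h
  · exact add_pos_of_pos_of_nonneg (mul_pos (by linarith) h) (mul_nonneg h0.le e2)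
  · rw [← h] at e3 ⊢
    simpa using mul_pos h0 (by simpa using e3)

/-! ### The flow as a labelled transition system -/

/-- The step from a crossing to the next one, labelled by the side that is crossed next. -/
def flowStep (v : ℂ) (X : Crossing) (l : Label) (Y : Crossing) : Prop :=
  Y.side = l ∧ ∃ t, IsNextCrossing v X Y t

/-- The crossing of the side `j + k` at the point with the coordinates `a`, `b`. -/
def crossingAt (j : Label) (e : Sheet) (k : Label) (a b : ℝ) : Crossing :=
  ⟨e, j + k, ((e : ℤ) : ℂ) * affPt j a b⟩

theorem sheet_mul_self (e : Sheet) : ((e : ℤ) : ℂ) * ((e : ℤ) : ℂ) = 1 := by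
  rcases Int.units_eq_one_or e with rfl | rfl <;> simp

theorem sheet_mul_self_real (e : Sheet) : ((e : ℤ) : ℝ) * ((e : ℤ) : ℝ) = 1 := by
  rcases Int.units_eq_one_or e with rfl | rfl <;> simp

theorem sheet_neg (e : Sheet) : (((-e : Sheet) : ℤ) : ℂ) = -((e : ℤ) : ℂ) := by
  push_cast; rfl

theorem sheet_mul_inj {e : Sheet} {z w : ℂ} (h : ((e : ℤ) : ℂ) * z = ((e : ℤ) : ℂ) * w) : z = w := by
  have := congrArg (((e : ℤ) : ℂ) * ·) h
  simpa [← mul_assoc, sheet_mul_self] using this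

theorem gluing_eq (e : Sheet) (j k : Label) :
    gluing e (j + k) = -((e : ℤ) : ℂ) * (affPt j (startA k) (startB k) +
      affPt j (endA k) (endB k)) := by
  rw [gluing, sideStart_eq, sideEnd_eq, sheet_neg]
  ring

theorem affPt_reflect (j : Label) (a b a' b' a'' b'' : ℝ) :
    affPt j a b + affPt j a' b' - affPt j a'' b'' = affPt j (a + a' - a'') (b + b' - b'') := by
  unfold affPt; push_cast; ring

theorem affPt_add (j : Label) (a b x y t : ℝ) (e : Sheet) :
    ((e : ℤ) : ℂ) * affPt j a b + t * ((x : ℂ) * sideVec j + (y : ℂ) * sideVec' j) =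
      ((e : ℤ) : ℂ) * affPt j (a + ((e : ℤ) : ℝ) * t * x) (b + ((e : ℤ) : ℝ) * t * y) := by
  have := sheet_mul_self e
  unfold affPt; push_cast
  linear_combination (-(t * (x * sideVec j + y * sideVec' j))) * this

section flow

variable {j : Label} {x y : ℝ}

/-- The velocity with the coordinates `x`, `y`. -/
def velocityAt (j : Label) (x y : ℝ) : ℂ := (x : ℂ) * sideVec j + (y : ℂ) * sideVec' j

/-- With the sign of the sheet factored out, both pentagons have the same coordinates. The flow then
moves by `e t (x, y)`, and the gluing becomes the reflection of a side in its midpoint. -/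
theorem flowStep_iff {X Y : Crossing} {l : Label} :
    flowStep (velocityAt j x y) X l Y ↔ ∃ (e : Sheet) (k m : Label) (a b t : ℝ), l = j + m ∧
      m ≠ k ∧ 0 < t ∧ OnSide k a b ∧
      OnSide m (a + ((e : ℤ) : ℝ) * t * x) (b + ((e : ℤ) : ℝ) * t * y) ∧
      X = crossingAt j e k a b ∧ Y = crossingAt j (-e) m
        (startA m + endA m - (a + ((e : ℤ) : ℝ) * t * x))
        (startB m + endB m - (b + ((e : ℤ) : ℝ) * t * y)) := by
  constructor
  · rintro ⟨hl, t, h⟩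
    obtain ⟨e, sX, pX⟩ := X
    obtain ⟨e', sY, pY⟩ := Y
    obtain ⟨k, rfl⟩ : ∃ k, sX = j + k := ⟨sX - j, by ring⟩
    obtain ⟨m, rfl⟩ : ∃ m, sY = j + m := ⟨sY - j, by ring⟩
    obtain ⟨ht, h1, h2, h3, h4, h5⟩ := h
    simp only at h1 h2 h3 h4 h5 hl
    obtain ⟨a, b, hab, rfl⟩ := mem_openSide_iff.1 h1
    obtain ⟨a', b', hab', h6⟩ := mem_openSide_iff.1 h3
    unfold velocityAt at h5 h6
    rw [affPt_add] at h5 h6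
    obtain ⟨rfl, rfl⟩ := affPt_inj (sheet_mul_inj h6)
    refine ⟨e, k, m, a, b, t, hl.symm, fun h => h2 (by rw [h]), ht, hab, hab', rfl, ?_⟩
    subst h4
    rw [h5, crossingAt, gluing_eq, ← affPt_reflect, sheet_neg]
    congr 1
    ring
  · rintro ⟨e, k, m, a, b, t, rfl, hmk, ht, hab, hab', rfl, rfl⟩
    refine ⟨rfl, t, ht, mem_openSide_iff.2 ⟨a, b, hab, rfl⟩, fun h => hmk (add_left_cancel h),
      ?_, rfl, ?_⟩
    · refine mem_openSide_iff.2 ⟨_, _, hab', ?_⟩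
      simp only [crossingAt, velocityAt]
      rw [affPt_add]
    · simp only [crossingAt, velocityAt]
      rw [affPt_add, gluing_eq, ← affPt_reflect, sheet_neg]
      ring

theorem exists_velocityAt (j : Label) (v : ℂ) : ∃ x y, v = velocityAt j x y := by
  set r := v / sideVec j with hr
  have hv : v = r * sideVec j := by rw [hr, div_mul_cancel₀ _ (sideVec_ne_zero j)]
  refine ⟨r.re - r.im / (ω ^ 2).im * (ω ^ 2).re, -(r.im / (ω ^ 2).im), ?_⟩
  have h1 : r = ((r.re - r.im / (ω ^ 2).im * (ω ^ 2).re : ℝ) : ℂ) +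
      ((r.im / (ω ^ 2).im : ℝ) : ℂ) * ω ^ 2 := by
    apply Complex.ext
    · simp [-Complex.ofReal_sub, -Complex.ofReal_div]
    · simp [-Complex.ofReal_sub, -Complex.ofReal_div]
      rw [div_mul_cancel₀ _ ω_sq_im_pos.ne']
  conv_lhs => rw [hv, h1]
  unfold velocityAt sideVec'
  rw [Complex.ofReal_neg]
  ring

/-- The depth with respect to the target side is affine in time, positive at the start and zero at
the end, so it fixes the time. -/
theorem flowStep_isDeterministic (v : ℂ) : IsDeterministic (flowStep v) := by
  intro X l Y Y' h h'
  obtain ⟨x, y, rfl⟩ := exists_velocityAt 0 v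
  obtain ⟨e, k, m, a, b, t, rfl, hmk, ht, hab, hab', rfl, rfl⟩ := flowStep_iff.1 h
  obtain ⟨e1, k1, m1, a1, b1, t1, hl, hmk1, ht1, hab1, hab1', hX, rfl⟩ := flowStep_iff.1 h'
  obtain rfl := add_left_cancel hl
  obtain ⟨rfl, hk, hz⟩ : e = e1 ∧ 0 + k = 0 + k1 ∧ _ := by
    simpa only [crossingAt, Crossing.mk.injEq] using hX
  obtain rfl := add_left_cancel hk
  obtain ⟨rfl, rfl⟩ := affPt_inj (sheet_mul_inj hz)
  have d0 := hab.depth_pos hmk.symm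
  have d1 := hab'.depth_eq_zero
  have d2 := hab1'.depth_eq_zero
  rw [depth_add] at d1 d2
  have e1 : rate m (((e : ℤ) : ℝ) * t * x) (((e : ℤ) : ℝ) * t * y) =
      t * (((e : ℤ) : ℝ) * rate m x y) := by unfold rate; ring
  have e2 : rate m (((e : ℤ) : ℝ) * t1 * x) (((e : ℤ) : ℝ) * t1 * y) =
      t1 * (((e : ℤ) : ℝ) * rate m x y) := by unfold rate; ring
  rw [e1] at d1
  rw [e2] at d2
  have h0 : ((e : ℤ) : ℝ) * rate m x y ≠ 0 := by
    intro h0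
    rw [h0] at d1
    linarith
  have : t = t1 := mul_right_cancel₀ h0 (by linarith)
  rw [this]

/-- The next crossing is determined by the present one. -/
theorem flowStep_label_unique {v : ℂ} {X Y Y' : Crossing} {l l' : Label} (h : flowStep v X l Y)
    (h' : flowStep v X l' Y') : Y = Y' := by
  obtain ⟨x, y, rfl⟩ := exists_velocityAt 0 v
  suffices hl : l = l' from flowStep_isDeterministic _ h (hl ▸ h')
  obtain ⟨e, k, m, a, b, t, rfl, hmk, ht, hab, hab', rfl, rfl⟩ := flowStep_iff.1 h
  obtain ⟨e1, k1, m1, a1, b1, t1, rfl, hmk1, ht1, hab1, hab1', hX, rfl⟩ := flowStep_iff.1 h'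
  by_contra hne
  have hm : m ≠ m1 := fun h => hne (by rw [h])
  obtain ⟨rfl, hk, hz⟩ : e = e1 ∧ 0 + k = 0 + k1 ∧ _ := by
    simpa only [crossingAt, Crossing.mk.injEq] using hX
  obtain rfl := add_left_cancel hk
  obtain ⟨rfl, rfl⟩ := affPt_inj (sheet_mul_inj hz)
  have e0 : ∀ m t, rate m (((e : ℤ) : ℝ) * t * x) (((e : ℤ) : ℝ) * t * y) =
      t * (((e : ℤ) : ℝ) * rate m x y) := by intro m t; unfold rate; ring
  have a0 := hab.depth_pos hmk.symm
  have a1 := hab'.depth_eq_zero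
  have a2 := hab1'.depth_pos hm.symm
  have b0 := hab.depth_pos hmk1.symm
  have b1 := hab1'.depth_eq_zero
  have b2 := hab'.depth_pos hm
  rw [depth_add, e0] at a1 a2 b1 b2
  set r := ((e : ℤ) : ℝ) * rate m x y
  set r1 := ((e : ℤ) : ℝ) * rate m1 x y
  have hr : r < 0 := by by_contra hr; nlinarith
  have hr1 : r1 < 0 := by by_contra hr1; nlinarith
  -- At the moment when one side is hit, the depth of the other is still positive and decreasing; so
  -- each side would be hit before the other.
  have : t1 < t := by nlinarith
  have : t < t1 := by nlinarith
  linarith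

end flow

/-! ### Transverse coordinates of crossings -/

/-- The transverse coordinate with respect to the velocity `(x, y)`. -/
def transv (x y a b : ℝ) : ℝ := x * b - y * a

/-- The transverse coordinate of the first endpoint of the side `j + k`. -/
def transvStart (k : Label) (x y : ℝ) : ℝ := transv x y (startA k) (startB k)

theorem rate_eq (x y : ℝ) : rate 0 x y = -y ∧ rate 1 x y = -x ∧ rate 2 x y = goldenRatio * x + y ∧
    rate 3 x y = -(goldenRatio * x) - goldenRatio * y ∧ rate 4 x y = x + goldenRatio * y := by
  have g2 := Real.goldenRatio_sq
  unfold rate startA startB endA endB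
  generalize goldenRatio = g at *
  simp only [Matrix.cons_val]
  refine ⟨?_, ?_, ?_, ?_, ?_⟩
  · linear_combination (-y) * g2
  · ring
  · linear_combination (x + y) * g2
  · linear_combination (-x) * g2
  · ring

theorem transvStart_eq (x y : ℝ) :
    transvStart 0 x y = x + goldenRatio * x + goldenRatio * y + y ∧ transvStart 1 x y = x ∧
    transvStart 2 x y = x + goldenRatio * y ∧
    transvStart 3 x y = x + goldenRatio * x + goldenRatio * y ∧ transvStart 4 x y = 0 := by
  have g2 := Real.goldenRatio_sq
  unfold transvStart transv startA startB
  generalize goldenRatio = g at *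
  simp only [Matrix.cons_val]
  refine ⟨?_, ?_, ?_, ?_, ?_⟩
  · linear_combination (x + y) * g2
  · ring
  · ring
  · linear_combination x * g2
  · ring

theorem OnSide.transv_eq {k : Label} {a b : ℝ} (h : OnSide k a b) (x y : ℝ) :
    ∃ θ, 0 < θ ∧ θ < 1 ∧ a = startA k + θ * (endA k - startA k) ∧
      b = startB k + θ * (endB k - startB k) ∧
      transv x y a b = transvStart k x y + θ * rate k x y := by
  obtain ⟨θ, h0, h1, rfl, rfl⟩ := h
  exact ⟨θ, h0, h1, rfl, rfl, by unfold transvStart transv rate; ring⟩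

theorem OnSide.reflect {k : Label} {a b : ℝ} (h : OnSide k a b) :
    OnSide k (startA k + endA k - a) (startB k + endB k - b) := by
  obtain ⟨θ, h0, h1, rfl, rfl⟩ := h
  exact ⟨1 - θ, by linarith, by linarith, by ring, by ring⟩

theorem transv_reflect (k : Label) (x y a b : ℝ) :
    transv x y (startA k + endA k - a) (startB k + endB k - b) =
      2 * transvStart k x y + rate k x y - transv x y a b := by
  unfold transvStart transv rate; ring

/-- The position on the side `j + k` of the point with the transverse coordinate `h`. -/
def sideParam (k : Label) (x y h : ℝ) : ℝ := (h - transvStart k x y) / rate k x y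

/-- The coordinates of the point of the side `j + k` with the transverse coordinate `h`. -/
def sideA (k : Label) (x y h : ℝ) : ℝ := startA k + sideParam k x y h * (endA k - startA k)
def sideB (k : Label) (x y h : ℝ) : ℝ := startB k + sideParam k x y h * (endB k - startB k)

theorem OnSide.eq_side {k : Label} {a b x y : ℝ} (h : OnSide k a b) (hr : rate k x y ≠ 0) :
    a = sideA k x y (transv x y a b) ∧ b = sideB k x y (transv x y a b) := by
  obtain ⟨θ, -, -, ha, hb, ht⟩ := h.transv_eq x y
  have : sideParam k x y (transv x y a b) = θ := by
    rw [sideParam, ht, add_sub_cancel_left, mul_div_cancel_right₀ _ hr]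
  unfold sideA sideB
  rw [this]
  exact ⟨ha, hb⟩

theorem onSide_side {k : Label} {x y h : ℝ}
    (hp : 0 < sideParam k x y h) (hp' : sideParam k x y h < 1) :
    OnSide k (sideA k x y h) (sideB k x y h) := ⟨_, hp, hp', rfl, rfl⟩

theorem transv_side {k : Label} {x y h : ℝ} (hr : rate k x y ≠ 0) :
    transv x y (sideA k x y h) (sideB k x y h) = h := by
  have : transv x y (sideA k x y h) (sideB k x y h) =
      transvStart k x y + sideParam k x y h * rate k x y := by
    unfold sideA sideB transvStart transv rate; ring
  rw [this, sideParam, div_mul_cancel₀ _ hr]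
  ring

/-- The crossing with the transverse coordinate `h` through which a trajectory with the velocity
`(x, y)` enters the first pentagon. -/
def entry (j : Label) (x y h : ℝ) : Crossing :=
  if h < x + goldenRatio * y then crossingAt j 1 4 (sideA 4 x y h) (sideB 4 x y h)
  else crossingAt j 1 2 (sideA 2 x y h) (sideB 2 x y h)

/-- The words along the sides of the double pentagon that correspond to the letters. -/
def baseWord (j : Label) : Letter → List Label :=
  quad [j + 1, j + 4] [j + 3, j + 2] [j + 3, j + 4] [j, j + 2]

/-! ### The first return to the entry sides of the first pentagon -/

section sector

variable {j : Label} {x y : ℝ}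

theorem rate_sign (hx : 0 ≤ x) (hy : 0 ≤ y) (k : Label) :
    (0 < rate k x y → k = 4 ∨ k = 2) ∧ (rate k x y < 0 → k = 0 ∨ k = 1 ∨ k = 3) := by
  have g0 := Real.goldenRatio_pos
  obtain ⟨r0, r1, r2, r3, r4⟩ := rate_eq x y
  have hgx := mul_nonneg g0.le hx
  have hgy := mul_nonneg g0.le hy
  fin_cases k
  · refine ⟨fun h => ?_, fun _ => Or.inl rfl⟩
    change 0 < rate 0 x y at h
    linarith
  · refine ⟨fun h => ?_, fun _ => Or.inr (Or.inl rfl)⟩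
    change 0 < rate 1 x y at h
    linarith
  · refine ⟨fun _ => Or.inr rfl, fun h => ?_⟩
    change rate 2 x y < 0 at h
    linarith
  · refine ⟨fun h => ?_, fun _ => Or.inr (Or.inr rfl)⟩
    change 0 < rate 3 x y at h
    linarith
  · refine ⟨fun _ => Or.inl rfl, fun h => ?_⟩
    change rate 4 x y < 0 at h
    linarith

/-- The end of the step has positive depth with respect to the side `k` just left behind, and the
depth with respect to `m` has dropped from a positive value to zero. -/
theorem rate_of_step {e : Sheet} {k m : Label} {a b t : ℝ} (ht : 0 < t) (hmk : m ≠ k)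
    (hab : OnSide k a b)
    (hab' : OnSide m (a + ((e : ℤ) : ℝ) * t * x) (b + ((e : ℤ) : ℝ) * t * y)) :
    0 < ((e : ℤ) : ℝ) * rate k x y ∧ ((e : ℤ) : ℝ) * rate m x y < 0 := by
  have e0 : ∀ m, rate m (((e : ℤ) : ℝ) * t * x) (((e : ℤ) : ℝ) * t * y) =
      t * (((e : ℤ) : ℝ) * rate m x y) := by intro m; unfold rate; ring
  have a0 := hab.depth_pos hmk.symm
  have a1 := hab'.depth_eq_zero
  have b0 := hab.depth_eq_zero
  have b1 := hab'.depth_pos hmk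
  rw [depth_add, e0] at a1 b1
  rw [b0, zero_add] at b1
  refine ⟨(pos_iff_pos_of_mul_pos b1).1 ht, ?_⟩
  by_contra hr
  have := mul_nonneg ht.le (not_lt.1 hr)
  linarith

theorem transv_of_step {e : Sheet} {a b t : ℝ} :
    transv x y (a + ((e : ℤ) : ℝ) * t * x) (b + ((e : ℤ) : ℝ) * t * y) = transv x y a b := by
  unfold transv; ring

theorem rate_in_pos (hx : 0 ≤ x) (hy : 0 ≤ y) (hxy : 0 < x + y) :
    0 < rate 4 x y ∧ 0 < rate 2 x y := by
  obtain ⟨-, -, r2, -, r4⟩ := rate_eq x y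
  have g1 := Real.one_lt_goldenRatio
  rw [r2, r4]
  constructor <;> nlinarith

/-- The sides `4` and `2` project to adjacent intervals of the transverse coordinate, separated by
the image `x + φy` of their common vertex. -/
theorem crossingAt_eq_entry (hx : 0 ≤ x) (hy : 0 ≤ y) (hxy : 0 < x + y) {k : Label} {a b : ℝ}
    (hk : k = 4 ∨ k = 2) (h : OnSide k a b) :
    crossingAt j 1 k a b = entry j x y (transv x y a b) := by
  obtain ⟨p4, p2⟩ := rate_in_pos hx hy hxy
  obtain ⟨θ, h0, h1, -, -, ht⟩ := h.transv_eq x y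
  obtain ⟨-, -, r2, -, r4⟩ := rate_eq x y
  obtain ⟨-, -, s2, -, s4⟩ := transvStart_eq x y
  rcases hk with rfl | rfl
  · obtain ⟨ha, hb⟩ := h.eq_side p4.ne'
    rw [entry, if_pos, ← ha, ← hb]
    rw [ht, s4, ← r4]
    nlinarith
  · obtain ⟨ha, hb⟩ := h.eq_side p2.ne'
    rw [entry, if_neg, ← ha, ← hb]
    rw [ht, s2, not_lt]
    nlinarith

/-- The first pentagon is left through one of the sides `1, 3, 0`, the second one through `4` or
`2`. The transverse coordinate is preserved inside a pentagon and reflected at a gluing, so two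
steps translate it. -/
theorem two_steps (hx : 0 ≤ x) (hy : 0 ≤ y) (hxy : 0 < x + y) {X Y Z : Crossing} {l₁ l₂ : Label}
    (hX : X.sheet = 1) (h₁ : flowStep (velocityAt j x y) X l₁ Y)
    (h₂ : flowStep (velocityAt j x y) Y l₂ Z) :
    ∃ h l h', X = entry j x y h ∧ Z = entry j x y h' ∧ [l₁, l₂] = baseWord j l ∧
      iet 0 x (goldenRatio * x) (goldenRatio * y) y h l h' := by
  obtain ⟨e, k, m, a, b, t, rfl, hmk, ht, hab, hab', rfl, rfl⟩ := flowStep_iff.1 h₁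
  obtain ⟨e1, k1, m', a1, b1, t1, rfl, hmk1, ht1, hab1, hab1', hY, rfl⟩ := flowStep_iff.1 h₂
  obtain rfl : e = 1 := hX
  obtain ⟨rfl, hk, hz⟩ : -1 = e1 ∧ j + m = j + k1 ∧ _ := by
    simpa only [crossingAt, Crossing.mk.injEq] using hY
  obtain rfl := add_left_cancel hk
  obtain ⟨ha1, hb1⟩ := affPt_inj (sheet_mul_inj hz)
  have hr := rate_of_step ht hmk hab hab'
  have hr1 := rate_of_step ht1 hmk1 hab1 hab1'
  simp only [Units.val_one, Int.cast_one, one_mul, Units.val_neg, Int.cast_neg, neg_mul,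
    neg_pos] at hr hr1
  have hk := (rate_sign hx hy k).1 hr.1
  have hm := (rate_sign hx hy m).2 hr.2
  have hm' := (rate_sign hx hy m').1 (by linarith [hr1.2])
  have hZ := crossingAt_eq_entry (j := j) hx hy hxy hm' hab1'.reflect
  rw [neg_neg]
  suffices h : ∃ l, [j + m, j + m'] = baseWord j l ∧
      iet 0 x (goldenRatio * x) (goldenRatio * y) y (transv x y a b) l
        (transv x y (startA m' + endA m' - (a1 + ((-1 : Sheet) : ℤ) * t1 * x))
          (startB m' + endB m' - (b1 + ((-1 : Sheet) : ℤ) * t1 * y))) from by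
    obtain ⟨l, h1, h2⟩ := h
    exact ⟨_, l, _, crossingAt_eq_entry hx hy hxy hk hab, hZ, h1, h2⟩
  have q1 := (transv_of_step (x := x) (y := y) (e := 1) (a := a) (b := b) (t := t)).symm
  obtain ⟨θ, θ0, θ1, -, -, q2⟩ := hab'.transv_eq x y
  obtain ⟨θ', θ0', θ1', -, -, q3⟩ := hab1'.transv_eq x y
  have q4 := transv_reflect m x y (a + ((1 : Sheet) : ℤ) * t * x) (b + ((1 : Sheet) : ℤ) * t * y)
  rw [ha1, hb1, q2] at q4
  have q5 := q3
  rw [transv_of_step] at q5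
  rw [transv_reflect, q3, q1, q2]
  clear q1 q2 q3 hZ
  have ρ : ∀ m, rate m x y < 0 → rate m x y < θ * rate m x y ∧ θ * rate m x y < 0 := by
    intro m hm
    constructor <;> nlinarith
  have ρ' : ∀ m, 0 < rate m x y → θ' * rate m x y < rate m x y ∧ 0 < θ' * rate m x y := by
    intro m hm
    constructor <;> nlinarith
  replace ρ := ρ m hr.2
  replace ρ' := ρ' m' (by linarith [hr1.2])
  obtain ⟨r0, r1, r2, r3, r4⟩ := rate_eq x y
  obtain ⟨s0, s1, s2, s3, s4⟩ := transvStart_eq x y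
  have g0 := Real.goldenRatio_pos
  have hgx := mul_nonneg g0.le hx
  have hgy := mul_nonneg g0.le hy
  generalize θ * rate m x y = u at *
  generalize θ' * rate m' x y = u' at *
  generalize goldenRatio * x = X' at *
  generalize goldenRatio * y = Y' at *
  -- Of the six pairs of exit sides, `0, 4` and `1, 2` are impossible; the other four are the four
  -- letters.
  rcases hm with rfl | rfl | rfl <;> rcases hm' with rfl | rfl <;>
    simp only [r0, r1, r2, r3, r4, s0, s1, s2, s3, s4] at ρ ρ' q4 q5 ⊢
  · exfalso; linarith
  · exact ⟨sQ, by simp [baseWord], ⟨by simp; linarith, by simp; linarith⟩, by simp; linarith⟩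
  · exact ⟨sP, by simp [baseWord], ⟨by simp; linarith, by simp; linarith⟩, by simp; linarith⟩
  · exfalso; linarith
  · exact ⟨lQ, by simp [baseWord], ⟨by simp; linarith, by simp; linarith⟩, by simp; linarith⟩
  · exact ⟨lP, by simp [baseWord], ⟨by simp; linarith, by simp; linarith⟩, by simp; linarith⟩

/-- Points with equal transverse coordinates lie on one flow line. The time is read off from the sum
of the coordinates, since `x` or `y` alone may vanish; it is positive by convexity. -/
theorem flowStep_of_onSide {s : Sheet} {k m : Label} {a b a' b' : ℝ} (hxy : 0 < x + y)
    (hmk : m ≠ k) (hab : OnSide k a b) (hab' : OnSide m a' b')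
    (ht : transv x y a b = transv x y a' b') (hs : 0 ≤ ((s : ℤ) : ℝ) * rate k x y) :
    flowStep (velocityAt j x y) (crossingAt j s k a b) (j + m)
      (crossingAt j (-s) m (startA m + endA m - a') (startB m + endB m - b')) := by
  have hs2 := sheet_mul_self_real s
  set t := ((s : ℤ) : ℝ) * (((a' - a) + (b' - b)) / (x + y)) with htdef
  have ht' : x * (b' - b) = y * (a' - a) := by unfold transv at ht; linarith
  have hst : ((s : ℤ) : ℝ) * t = ((a' - a) + (b' - b)) / (x + y) := by
    rw [htdef, ← mul_assoc, hs2, one_mul]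
  have ha : a' = a + ((s : ℤ) : ℝ) * t * x := by
    rw [hst]
    field_simp
    linear_combination (-1 : ℝ) * ht'
  have hb : b' = b + ((s : ℤ) : ℝ) * t * y := by
    rw [hst]
    field_simp
    linear_combination ht'
  have hpos : 0 < t := by
    have h1 := hab'.depth_pos hmk
    have h0 := hab.depth_eq_zero
    rw [ha, hb, depth_add, h0, zero_add] at h1
    have e0 : rate k (((s : ℤ) : ℝ) * t * x) (((s : ℤ) : ℝ) * t * y) =
        t * (((s : ℤ) : ℝ) * rate k x y) := by unfold rate; ring
    rw [e0] at h1
    by_contra hneg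
    have := mul_nonneg (neg_nonneg.2 (not_lt.1 hneg)) hs
    linarith
  rw [ha, hb] at hab' ⊢
  exact flowStep_iff.2 ⟨s, k, m, a, b, t, rfl, hmk, hpos, hab, hab', rfl, rfl⟩

theorem onSide_of_pos {k : Label} {h : ℝ} (h0 : 0 < h - transvStart k x y)
    (h1 : h - transvStart k x y < rate k x y) :
    ∃ a b, OnSide k a b ∧ transv x y a b = h :=
  ⟨_, _, onSide_side (div_pos h0 (h0.trans h1)) ((div_lt_one (h0.trans h1)).2 h1),
    transv_side (h0.trans h1).ne'⟩

theorem onSide_of_neg {k : Label} {h : ℝ} (h0 : h - transvStart k x y < 0)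
    (h1 : rate k x y < h - transvStart k x y) :
    ∃ a b, OnSide k a b ∧ transv x y a b = h :=
  ⟨_, _, onSide_side (div_pos_of_neg_of_neg h0 (h1.trans h0))
    ((div_lt_one_of_neg (h1.trans h0)).2 h1), transv_side (h1.trans h0).ne⟩

/-- The excluded value of `h` is the vertex between the two entry sides, where the exchange is
defined inside the interval of a letter but the flow is not. -/
theorem path_of_iet (hx : 0 ≤ x) (hy : 0 ≤ y) (hxy : 0 < x + y) {h h' : ℝ} {l : Letter}
    (hl : iet 0 x (goldenRatio * x) (goldenRatio * y) y h l h') (hc : h ≠ x + goldenRatio * y) :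
    Path (flowStep (velocityAt j x y)) (entry j x y h) (baseWord j l) (entry j x y h') := by
  obtain ⟨r0, r1, r2, r3, r4⟩ := rate_eq x y
  obtain ⟨s0, s1, s2, s3, s4⟩ := transvStart_eq x y
  obtain ⟨p4, p2⟩ := rate_in_pos hx hy hxy
  have g0 := Real.goldenRatio_pos
  have hgx := mul_nonneg g0.le hx
  have hgy := mul_nonneg g0.le hy
  have hrange : 0 < h ∧ h < x + goldenRatio * x + goldenRatio * y + y := by
    obtain ⟨⟨h1, h2⟩, -⟩ := hl
    cases l <;> simp at h1 h2 <;> constructor <;> linarith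
  obtain ⟨k, hk, a, b, hab, hh⟩ : ∃ k, (k = 4 ∨ k = 2) ∧ ∃ a b, OnSide k a b ∧
      transv x y a b = h := by
    rcases lt_or_gt_of_ne hc with hlt | hgt
    · exact ⟨4, Or.inl rfl, onSide_of_pos (by rw [s4]; linarith) (by rw [s4, r4]; linarith)⟩
    · exact ⟨2, Or.inr rfl, onSide_of_pos (by rw [s2]; linarith) (by rw [s2, r2]; linarith)⟩
  have hkpos : 0 ≤ (((1 : Sheet) : ℤ) : ℝ) * rate k x y := by
    rcases hk with rfl | rfl <;> simpa using le_of_lt (by assumption)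
  have main : ∀ m m', (m = 0 ∨ m = 1 ∨ m = 3) → (m' = 4 ∨ m' = 2) →
      (∃ a b, OnSide m a b ∧ transv x y a b = h) →
      (∃ a b, OnSide m' a b ∧ transv x y a b = 2 * transvStart m x y + rate m x y - h) →
      rate m x y ≤ 0 →
      h' = 2 * transvStart m' x y + rate m' x y - (2 * transvStart m x y + rate m x y - h) →
      baseWord j l = [j + m, j + m'] →
      Path (flowStep (velocityAt j x y)) (entry j x y h) (baseWord j l) (entry j x y h') := by
    rintro m m' hm hm' ⟨a1, b1, h1, h1'⟩ ⟨a2, b2, h2, h2'⟩ hr hh' hw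
    rw [hw, ← hh, ← crossingAt_eq_entry (j := j) hx hy hxy hk hab]
    have hmk : m ≠ k := by
      rintro rfl
      rcases hm with rfl | rfl | rfl <;> revert hk <;> decide
    have hmm : m' ≠ m := by
      rintro rfl
      rcases hm with rfl | rfl | rfl <;> revert hm' <;> decide
    have e1 := transv_reflect m x y a1 b1
    have e2 := transv_reflect m' x y a2 b2
    rw [h1'] at e1
    rw [h2', ← hh'] at e2
    refine ⟨_, flowStep_of_onSide hxy hmk hab h1 (hh.trans h1'.symm) hkpos, _,
      flowStep_of_onSide hxy hmm h1.reflect h2 (e1.trans h2'.symm) ?_, ?_⟩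
    · simpa using hr
    · rw [neg_neg, path_nil, crossingAt_eq_entry hx hy hxy hm' h2.reflect, e2]
  obtain ⟨⟨i1, i2⟩, i3⟩ := hl
  cases l <;> simp only [quad_sP, quad_lP, quad_lQ, quad_sQ] at i1 i2 i3
  · exact main 1 4 (by simp) (by simp)
      (onSide_of_neg (by rw [s1]; linarith) (by rw [s1, r1]; linarith))
      (onSide_of_pos (by rw [s4, s1, r1]; linarith) (by rw [s4, r4, s1, r1]; linarith))
      (by rw [r1]; linarith) (by rw [s4, r4, s1, r1]; linarith) (by simp [baseWord])
  · exact main 3 2 (by simp) (by simp)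
      (onSide_of_neg (by rw [s3]; linarith) (by rw [s3, r3]; linarith))
      (onSide_of_pos (by rw [s2, s3, r3]; linarith) (by rw [s2, r2, s3, r3]; linarith))
      (by rw [r3]; linarith) (by rw [s2, r2, s3, r3]; linarith) (by simp [baseWord])
  · exact main 3 4 (by simp) (by simp)
      (onSide_of_neg (by rw [s3]; linarith) (by rw [s3, r3]; linarith))
      (onSide_of_pos (by rw [s4, s3, r3]; linarith) (by rw [s4, r4, s3, r3]; linarith))
      (by rw [r3]; linarith) (by rw [s4, r4, s3, r3]; linarith) (by simp [baseWord])
  · exact main 0 2 (by simp) (by simp)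
      (onSide_of_neg (by rw [s0]; linarith) (by rw [s0, r0]; linarith))
      (onSide_of_pos (by rw [s2, s0, r0]; linarith) (by rw [s2, r2, s0, r0]; linarith))
      (by rw [r0]; linarith) (by rw [s2, r2, s0, r0]; linarith) (by simp [baseWord])

theorem entry_injective (hx : 0 ≤ x) (hy : 0 ≤ y) (hxy : 0 < x + y) {h h' : ℝ}
    (he : entry j x y h = entry j x y h') : h = h' := by
  obtain ⟨p4, p2⟩ := rate_in_pos hx hy hxy
  have key : ∀ k k', (k = 4 ∨ k = 2) → crossingAt j 1 k (sideA k x y h) (sideB k x y h) =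
      crossingAt j 1 k' (sideA k' x y h') (sideB k' x y h') → h = h' := by
    intro k k' hk hkk
    obtain ⟨hk', hz⟩ : j + k = j + k' ∧ _ := by
      simpa only [crossingAt, Crossing.mk.injEq, true_and] using hkk
    obtain rfl := add_left_cancel hk'
    obtain ⟨ha, hb⟩ := affPt_inj (sheet_mul_inj hz)
    have hr : rate k x y ≠ 0 := by rcases hk with rfl | rfl <;> exact ne_of_gt (by assumption)
    rw [← transv_side (x := x) (y := y) (h := h) hr, ha, hb, transv_side hr]
  unfold entry at he
  split_ifs at he
  · exact key _ _ (by simp) he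
  · exact key _ _ (by simp) he
  · exact key _ _ (by simp) he
  · exact key _ _ (by simp) he

theorem entry_sheet (h : ℝ) : (entry j x y h).sheet = 1 := by
  unfold entry; split_ifs <;> rfl

theorem flowStep.sheet_eq {v : ℂ} {X Y : Crossing} {l : Label} (h : flowStep v X l Y) :
    Y.sheet = -X.sheet := by
  obtain ⟨-, t, ht⟩ := h
  exact ht.sheet_eq

/-- The flow in a sector bounded by consecutive side directions is coded by an interval exchange. -/
theorem induces_base (hx : 0 ≤ x) (hy : 0 ≤ y) (hxy : 0 < x + y) :
    Induces (flowStep (velocityAt j x y))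
      (iet 0 x (goldenRatio * x) (goldenRatio * y) y) (entry j x y) (baseWord j) where
  lift h h' w w' h1 h2 := by
    have g0 := Real.goldenRatio_pos
    have hgx := mul_nonneg g0.le hx
    have hgy := mul_nonneg g0.le hy
    have htarget : ∀ {p l q}, iet 0 x (goldenRatio * x) (goldenRatio * y) y p l q →
        q ≠ x + goldenRatio * y := by
      rintro p l q ⟨⟨i1, i2⟩, i3⟩ rfl
      cases l <;> simp at i1 i2 i3 <;> linarith
    rcases w with _ | ⟨l, w⟩
    · obtain rfl : h = h' := h1
      rfl
    -- No step of the exchange ends at the vertex value, because it is an endpoint of images; and on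
    -- a closed path the starting point is also the end of a step.
    have hc : h ≠ x + goldenRatio * y := by
      obtain ⟨-, m, p, -, -, hm⟩ := exists_path_last (h1.trans h2)
      exact htarget hm
    clear h2
    generalize l :: w = w at h1
    induction w generalizing h with
    | nil =>
      obtain rfl : h = h' := h1
      rfl
    | cons l w ih =>
      obtain ⟨q, hq, h1⟩ := h1
      rw [List.flatMap_cons]
      exact (path_of_iet hx hy hxy hq hc).trans (ih q (htarget hq) h1)
  parse h u _ hu := by
    have key : ∀ (n : ℕ) (u : List Label) (h' : ℝ), u.length ≤ n →
        Path (flowStep (velocityAt j x y)) (entry j x y h') u (entry j x y h) →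
        ∃ u' : List Letter, u = u'.flatMap (baseWord j) ∧
          Path (iet 0 x (goldenRatio * x) (goldenRatio * y) y) h' u' h := by
      intro n
      induction n with
      | zero =>
        intro u h' hn hu
        obtain rfl : u = [] := List.length_eq_zero_iff.1 (by omega)
        exact ⟨[], rfl, entry_injective hx hy hxy hu⟩
      | succ n ih =>
        intro u h' hn hu
        rcases u with _ | ⟨l₁, _ | ⟨l₂, r⟩⟩
        · exact ⟨[], rfl, entry_injective hx hy hxy hu⟩
        · obtain ⟨Y, hY, rfl⟩ := hu
          have := hY.sheet_eq
          rw [entry_sheet, entry_sheet] at this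
          exact absurd this (by decide)
        · obtain ⟨Y, hY, Z, hZ, hr⟩ := hu
          obtain ⟨h1, l, h2, e1, rfl, hw, hl⟩ := two_steps hx hy hxy (entry_sheet h') hY hZ
          obtain rfl := entry_injective hx hy hxy e1
          obtain ⟨u', rfl, hu'⟩ := ih r h2 (by simp at hn ⊢; omega) hr
          exact ⟨l :: u', by rw [List.flatMap_cons, ← hw]; rfl, _, hl, hu'⟩
    exact key _ u h le_rfl hu
  reach p w hp hw := by
    rcases w with _ | ⟨l, r⟩
    · exact absurd rfl hw
    obtain ⟨q, hq, hr⟩ := id hp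
    have hpq : q ≠ p := by
      rintro rfl
      have := hq.sheet_eq
      rcases Int.units_eq_one_or q.sheet with h | h <;> rw [h] at this <;>
        exact absurd this (by decide)
    rcases r with _ | ⟨l₂, r⟩
    · exact absurd hr hpq
    obtain ⟨q2, hq2, hr2⟩ := id hr
    by_cases hs : p.sheet = 1
    · obtain ⟨h, m, h', rfl, -, -, hm⟩ := two_steps hx hy hxy hs hq hq2
      exact ⟨[], _, h, rfl, ⟨m, h', hm⟩, rfl, hp⟩
    · have hqs : q.sheet = 1 := by
        rw [hq.sheet_eq, (Int.units_eq_one_or p.sheet).resolve_left hs, neg_neg]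
      obtain ⟨l₃, q3, hq3⟩ : ∃ l₃ q3, flowStep (velocityAt j x y) q2 l₃ q3 := by
        rcases r with _ | ⟨l₃, r⟩
        · obtain rfl : q2 = p := hr2
          exact ⟨l, q, hq⟩
        · obtain ⟨q3, hq3, -⟩ := hr2
          exact ⟨l₃, q3, hq3⟩
      obtain ⟨h, m, h', rfl, -, -, hm⟩ := two_steps hx hy hxy hqs hq2 hq3
      exact ⟨[l], _, h, rfl, ⟨m, h', hm⟩, ⟨_, hq, rfl⟩, hr⟩

end sector

/-! ### The sectors of the tiling -/

/-- A sector of directions, bounded by the directions of `P` and `Q`, with the words that correspond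
to the letters. -/
structure Edge where
  P : ℂ
  Q : ℂ
  word : Letter → List Label

namespace Edge

/-- The vertices of the ideal pentagon beyond the side with the endpoints `P` and `Q`. -/
def vtx (e : Edge) : Fin 5 → ℂ :=
  ![e.P, goldenRatio * e.P + e.Q, goldenRatio * e.P + goldenRatio * e.Q,
    e.P + goldenRatio * e.Q, e.Q]

end Edge

/-- The substitutions that correspond to the four subsectors of a sector. -/
def subst : Fin 4 → Letter → List Letter :=
  ![quad [sP] [lP] [lP, lQ, sP] [lP, sQ],
    quad [lP, sQ] [lQ, sP, lP] [lQ, sP, lP, sQ] [lQ, lP],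
    quad [lP, lQ] [lP, sQ, lQ, sP] [lP, sQ, lQ] [lQ, sP],
    quad [lQ, sP] [lQ, lP, sQ] [lQ] [sQ]]

namespace Edge

/-- The subsector bounded by two consecutive vertices. -/
def child (e : Edge) (c : Fin 4) : Edge :=
  ⟨e.vtx c.castSucc, e.vtx c.succ, fun l => (subst c l).flatMap e.word⟩

/-- The sector bounded by the directions of the sides `j` and `j + 1`. -/
def base (j : Label) : Edge := ⟨sideVec j, sideVec' j, baseWord j⟩

/-- The closed trajectories in the directions of the sector are coded by an interval exchange. -/
def IsCoded (e : Edge) : Prop :=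
  ∀ x y : ℝ, 0 ≤ x → 0 ≤ y → 0 < x + y → ∃ o ι, (∀ h, (ι h).sheet = 1) ∧
    Induces (flowStep (x * e.P + y * e.Q)) (iet o x (goldenRatio * x) (goldenRatio * y) y) ι e.word

theorem isCoded_base (j : Label) : (base j).IsCoded := fun _ _ hx hy hxy =>
  ⟨0, _, entry_sheet, induces_base hx hy hxy⟩

theorem _root_.DoublePentagon.Induces.iet_congr {v v' : ℂ} {o a b c d a' b' c' d' : ℝ}
    {ι : ℝ → Crossing} {τ τ' : Letter → List Label}
    (h : Induces (flowStep v) (iet o a b c d) ι τ) (hv : v' = v) (ha : a' = a) (hb : b' = b)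
    (hc : c' = c) (hd : d' = d) (hτ : ∀ l, τ' l = τ l) :
    Induces (flowStep v') (iet o a' b' c' d') ι τ' := by
  obtain rfl : τ' = τ := funext hτ
  subst hv ha hb hc hd
  exact h

/-- The coordinates of a velocity with respect to the subsector are converted into those with
respect to `P`, `Q`; the inductions turn the resulting lengths back into `x, φx, φy, y` by `φ² = φ +
1`. The subsectors `0` and `1` are mirror images of `3` and `2`. -/
theorem IsCoded.child {e : Edge} (he : e.IsCoded) (c : Fin 4) : (e.child c).IsCoded := by
  intro x y hx hy hxy
  have g2 := Real.goldenRatio_sq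
  have g1 := Real.one_lt_goldenRatio
  have hgx : 0 ≤ goldenRatio * x := mul_nonneg (by linarith) hx
  have hgy : 0 ≤ goldenRatio * y := mul_nonneg (by linarith) hy
  have hgxy : 0 < goldenRatio * x + goldenRatio * y := by
    rw [← mul_add]; exact mul_pos (by linarith) hxy
  have hggx : goldenRatio * (goldenRatio * x) = goldenRatio * x + x := by linear_combination x * g2
  have hggy : goldenRatio * (goldenRatio * y) = goldenRatio * y + y := by linear_combination y * g2
  have hD : ∀ v, IsDeterministic (flowStep v) := flowStep_isDeterministic
  fin_cases c
  · obtain ⟨o, ι, hι, h⟩ := he (x + goldenRatio * y) y (by linarith) hy (by linarith)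
    obtain ⟨o₁, ι₁, hι₁, h₁⟩ := h.iet_swap
    have h₂ := h₁.iet_right_right (hD _) hy hgy (by linarith) (by linarith)
    obtain ⟨o₃, ι₃, hι₃, h₃⟩ := h₂.iet_swap
    refine ⟨o₃, ι₃, fun t => ?_, h₃.iet_congr ?_ ?_ ?_ ?_ ?_ ?_⟩
    · obtain ⟨t', ht⟩ := hι₃ t
      obtain ⟨t'', ht'⟩ := hι₁ t'
      rw [ht, ht', hι]
    · simp [Edge.child, Edge.vtx]; ring
    · ring
    · linarith
    · rfl
    · rfl
    · intro l; cases l <;> simp [Edge.child, subst]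
  · obtain ⟨o, ι, hι, h⟩ := he (goldenRatio * x + goldenRatio * y) (x + goldenRatio * y)
      (by linarith) (by linarith) (by linarith)
    obtain ⟨o₁, ι₁, hι₁, h₁⟩ := h.iet_swap
    have h₂ := h₁.iet_right_left (hD _) (by linarith) (by linarith) (by linarith) (by linarith)
      (by linarith) (by linarith)
    obtain ⟨o₃, ι₃, hι₃, h₃⟩ := h₂.iet_swap
    refine ⟨o₃, ι₃, fun t => ?_, h₃.iet_congr ?_ ?_ ?_ ?_ ?_ ?_⟩
    · obtain ⟨t', ht⟩ := hι₃ t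
      obtain ⟨t'', ht'⟩ := hι₁ t'
      rw [ht, ht', hι]
    · simp [Edge.child, Edge.vtx]; ring
    · linarith
    · linarith
    · linarith
    · linarith
    · intro l; cases l <;> simp [Edge.child, subst]
  · obtain ⟨o, ι, hι, h⟩ := he (goldenRatio * x + y) (goldenRatio * x + goldenRatio * y)
      (by linarith) (by linarith) (by linarith)
    have h₂ := h.iet_right_left (hD _) (by linarith) (by linarith) (by linarith) (by linarith)
      (by linarith) (by linarith)
    refine ⟨_, ι, hι, h₂.iet_congr ?_ ?_ ?_ ?_ ?_ ?_⟩
    · simp [Edge.child, Edge.vtx]; ring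
    · linarith
    · linarith
    · linarith
    · linarith
    · intro l; cases l <;> simp [Edge.child, subst]
  · obtain ⟨o, ι, hι, h⟩ := he x (goldenRatio * x + y) hx (by linarith) (by linarith)
    have h₂ := h.iet_right_right (hD _) hx hgx (by linarith) (by linarith)
    refine ⟨_, ι, hι, h₂.iet_congr ?_ ?_ ?_ ?_ ?_ ?_⟩
    · simp [Edge.child, Edge.vtx]; ring
    · rfl
    · rfl
    · linarith
    · ring
    · intro l; cases l <;> simp [Edge.child, subst]

end Edge

/-! ### Holonomy -/

/-- The holonomy of a trajectory that starts in the pentagon `s` and crosses the sides in `w`. -/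
def hol : Sheet → List Label → ℂ
  | _, [] => 0
  | s, l :: w => -gluing s l + hol (-s) w

theorem hol_append (s : Sheet) (w w' : List Label) :
    hol s (w ++ w') = hol s w + hol ((-1) ^ w.length * s) w' := by
  induction w generalizing s with
  | nil => simp [hol]
  | cons l w ih =>
    have h : ((-1) ^ (w.length + 1) * s : Sheet) = (-1) ^ w.length * -s := by
      rw [pow_succ, mul_assoc, neg_one_mul]
    rw [List.cons_append, hol, hol, ih, List.length_cons, h, add_assoc]

namespace Edge

/-- The words of an edge lead back to the first pentagon, and their holonomies are multiples of
the boundary vectors. -/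
def IsHolonomic (e : Edge) : Prop :=
  ∀ l, Even (e.word l).length ∧ hol 1 (e.word l) =
    goldenRatio * quad e.P (goldenRatio * e.P) (goldenRatio * e.Q) e.Q l

theorem isHolonomic_base (j : Label) : (base j).IsHolonomic := by
  have hg : (goldenRatio : ℂ) ^ 2 = goldenRatio + 1 := by exact_mod_cast Real.goldenRatio_sq
  have key : ∀ k m : Label, hol 1 [j + k, j + m] =
      affPt j (startA k) (startB k) + affPt j (endA k) (endB k) -
        (affPt j (startA m) (startB m) + affPt j (endA m) (endB m)) := by
    intro k m
    simp only [hol, gluing_eq]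
    push_cast
    ring
  intro l
  cases l
  · refine ⟨by simp [base, baseWord], ?_⟩
    change hol 1 [j + 1, j + 4] = _
    rw [key]
    simp only [affPt, startA, startB, endA, endB, Matrix.cons_val, base, quad_sP]
    generalize goldenRatio = g at *
    push_cast
    ring
  · refine ⟨by simp [base, baseWord], ?_⟩
    change hol 1 [j + 3, j + 2] = _
    rw [key]
    simp only [affPt, startA, startB, endA, endB, Matrix.cons_val, base, quad_lP]
    generalize goldenRatio = g at *
    push_cast
    ring
  · refine ⟨by simp [base, baseWord], ?_⟩
    change hol 1 [j + 3, j + 4] = _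
    rw [key]
    simp only [affPt, startA, startB, endA, endB, Matrix.cons_val, base, quad_lQ]
    generalize goldenRatio = g at *
    push_cast
    ring
  · refine ⟨by simp [base, baseWord], ?_⟩
    change hol 1 [j, j + 2] = _
    have := key 0 2
    rw [add_zero] at this
    rw [this]
    simp only [affPt, startA, startB, endA, endB, Matrix.cons_val, base, quad_sQ]
    generalize goldenRatio = g at *
    push_cast
    linear_combination (sideVec' j) * hg

theorem IsHolonomic.flatMap {e : Edge} (he : e.IsHolonomic) (w : List Letter) :
    Even (w.flatMap e.word).length ∧ hol 1 (w.flatMap e.word) =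
      (w.map fun l => (goldenRatio : ℂ) *
        quad e.P (goldenRatio * e.P) (goldenRatio * e.Q) e.Q l).sum := by
  induction w with
  | nil => simp [hol]
  | cons l w ih =>
    rw [List.flatMap_cons, List.length_append, hol_append, (he l).1.neg_one_pow, one_mul, (he l).2,
      ih.2, List.map_cons, List.sum_cons]
    exact ⟨(he l).1.add ih.1, rfl⟩

/-- Words of even length return to the first pentagon, so their holonomies add up; the sums over the
substitution are the required multiples of the new boundary vectors by `φ² = φ + 1`. -/
theorem IsHolonomic.child {e : Edge} (he : e.IsHolonomic) (c : Fin 4) :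
    (e.child c).IsHolonomic := by
  have hg : (goldenRatio : ℂ) ^ 2 = goldenRatio + 1 := by exact_mod_cast Real.goldenRatio_sq
  intro l
  obtain ⟨h1, h2⟩ := he.flatMap (subst c l)
  refine ⟨h1, h2.trans ?_⟩
  clear h1 h2
  simp only [Edge.child, Edge.vtx]
  generalize (goldenRatio : ℂ) = g at *
  fin_cases c <;> cases l <;> simp [subst]
  all_goals first
    | linear_combination
    | linear_combination (-g * e.P) * hg
    | linear_combination (-g * e.Q) * hg
    | linear_combination (-g * (e.P + e.Q)) * hg

end Edge

/-! ### Closed trajectories and closed paths -/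

theorem Path.sheet_eq {v : ℂ} {X Y : Crossing} {w : List Label} (h : Path (flowStep v) X w Y) :
    Y.sheet = (-1) ^ w.length * X.sheet := by
  induction w generalizing X with
  | nil => obtain rfl : X = Y := h; simp
  | cons l w ih =>
    obtain ⟨Z, hZ, h⟩ := h
    rw [ih h, hZ.sheet_eq, List.length_cons, pow_succ]
    simp

/-- The path is determined by its starting point and its length. -/
theorem flow_path_unique {v : ℂ} {X Y Y' : Crossing} {w w' : List Label}
    (h : Path (flowStep v) X w Y) (h' : Path (flowStep v) X w' Y') (hw : w.length = w'.length) :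
    Y = Y' := by
  induction w generalizing X w' with
  | nil =>
    obtain rfl : w' = [] := List.length_eq_zero_iff.1 (by simpa using hw.symm)
    exact h.symm.trans h'
  | cons l w ih =>
    rcases w' with _ | ⟨l', w'⟩
    · simp at hw
    obtain ⟨Z, hZ, h⟩ := h
    obtain ⟨Z', hZ', h'⟩ := h'
    obtain rfl := flowStep_label_unique hZ hZ'
    exact ih h h' (by simpa using hw)

namespace ClosedTrajectory

variable {d : Direction} (T : ClosedTrajectory d)

/-- The sides crossed by `T` after the `i`-th crossing. -/
def labels (i k : ℕ) : List Label := (List.range k).map fun t => (T.crossing (i + t + 1)).side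

@[simp] theorem length_labels (i k : ℕ) : (T.labels i k).length = k := by simp [labels]

theorem labels_succ (i k : ℕ) :
    T.labels i (k + 1) = T.labels i k ++ [(T.crossing (i + k + 1)).side] := by
  simp [labels, List.range_succ]

theorem path_labels (i k : ℕ) :
    Path (flowStep T.velocity) (T.crossing i) (T.labels i k) (T.crossing (i + k)) := by
  induction k with
  | zero => rfl
  | succ k ih =>
    rw [labels_succ]
    exact ih.trans ⟨_, ⟨rfl, _, T.next _⟩, rfl⟩

theorem path_period : Path (flowStep T.velocity) (T.crossing 0) (T.labels 0 T.period)
    (T.crossing 0) := by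
  have := T.path_labels 0 T.period
  rwa [T.closed] at this

/-- `labels` begins with the side crossed next, whereas the orbit begins with the crossing `0`: a
rotation by one letter. -/
theorem orbit_eq : T.orbit = (T.labels 0 T.period : Cycle Label) := by
  rw [orbit, Cycle.coe_eq_coe]
  obtain ⟨n, hn⟩ : ∃ n, T.period = n + 1 := ⟨T.period - 1, by have := T.period_pos; omega⟩
  have h1 : (List.range T.period).map (fun i => (T.crossing i).side) =
      (T.crossing 0).side :: T.labels 0 n := by
    rw [hn, List.range_succ_eq_map]
    simp [labels, Function.comp_def]
  have h2 : (T.crossing 0).side = (T.crossing (0 + n + 1)).side := by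
    rw [← T.closed 0, hn]
    congr 2
  rw [h1]
  conv_rhs => rw [hn, labels_succ, ← h2]
  exact ⟨1, by simp⟩

theorem crossing_mod (i : ℕ) : T.crossing i = T.crossing (i % T.period) := by
  conv_lhs => rw [← Nat.mod_add_div i T.period]
  induction i / T.period with
  | zero => rfl
  | succ k ih => rw [Nat.mul_succ, ← add_assoc, T.closed, ih]

theorem crossing_eq_iff {i j : ℕ} : T.crossing i = T.crossing j ↔ i ≡ j [MOD T.period] := by
  rw [T.crossing_mod i, T.crossing_mod j]
  exact ⟨fun h => T.once _ (Nat.mod_lt _ T.period_pos) _ (Nat.mod_lt _ T.period_pos) h,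
    fun h => by rw [h]⟩

theorem pt_eq (i k : ℕ) : (T.crossing (i + k)).pt = (T.crossing i).pt +
    ((∑ t ∈ Finset.range k, T.time (i + t) : ℝ) : ℂ) * T.velocity -
      hol (T.crossing i).sheet (T.labels i k) := by
  induction k with
  | zero => simp [labels, hol]
  | succ k ih =>
    have h1 := (T.next (i + k)).pt_eq
    have h2 := (T.path_labels i k).sheet_eq
    rw [labels_succ, hol_append, Finset.sum_range_succ, ← add_assoc, h1, ih, length_labels]
    rw [length_labels] at h2
    rw [← h2, hol, hol]
    push_cast
    ring

/-- On a closed trajectory the total displacement equals the holonomy, and it is a nonnegative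
multiple of the velocity. -/
theorem length_eq : T.length = ‖hol (T.crossing 0).sheet (T.labels 0 T.period)‖ := by
  have h := T.pt_eq 0 T.period
  rw [T.closed] at h
  have h1 : hol (T.crossing 0).sheet (T.labels 0 T.period) =
      ((∑ t ∈ Finset.range T.period, T.time (0 + t) : ℝ) : ℂ) * T.velocity := by
    linear_combination h
  rw [h1, norm_mul, Complex.norm_real, Real.norm_of_nonneg, length, ← Finset.sum_mul]
  · simp
  · exact Finset.sum_nonneg fun t _ => (T.next _).time_pos.le

/-- The image of a trajectory under the central symmetry that exchanges the pentagons. -/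
def neg : ClosedTrajectory d where
  velocity := -T.velocity
  velocity_ne := neg_ne_zero.2 T.velocity_ne
  velocity_dir := by
    refine Eq.trans ?_ T.velocity_dir
    exact (Projectivization.mk_eq_mk_iff' ℝ _ _ _ _).2 ⟨-1, by simp⟩
  period := T.period
  period_pos := T.period_pos
  crossing i := ⟨-(T.crossing i).sheet, (T.crossing i).side, -(T.crossing i).pt⟩
  time := T.time
  next i := by
    have hs : ∀ (e : Sheet) (l : Label) (z : ℂ), z ∈ openSide e l → -z ∈ openSide (-e) l := by
      intro e l z hz
      rw [← zero_add l, mem_openSide_iff] at hz ⊢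
      obtain ⟨a, b, h, rfl⟩ := hz
      exact ⟨a, b, h, by rw [sheet_neg]; ring⟩
    have hgl : ∀ (e : Sheet) (l : Label), gluing (-e) l = -gluing e l := by
      intro e l
      rw [← zero_add l, gluing_eq, gluing_eq, sheet_neg]
      ring
    have h := T.next i
    exact ⟨h.time_pos, hs _ _ _ h.start_mem, h.side_ne, by
      have := hs _ _ _ h.end_mem
      convert this using 1
      ring, by simp [h.sheet_eq], by simp only [h.pt_eq, hgl]; ring⟩
  closed i := by simp [T.closed]
  once i hi j hj h := by
    apply T.once i hi j hj
    simp only [Crossing.mk.injEq, neg_inj] at h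
    cases hX : T.crossing i
    cases hY : T.crossing j
    simp_all

theorem neg_orbit : T.neg.orbit = T.orbit := rfl

theorem neg_length : T.neg.length = T.length := by simp [length, neg]

end ClosedTrajectory

theorem Path.exists_states {X Λ : Type*} {S : X → Λ → X → Prop} {x y : X} {w : List Λ}
    (h : Path S x w y) : ∃ f : ℕ → X, f 0 = x ∧ f w.length = y ∧
      (∀ i (hi : i < w.length), S (f i) w[i] (f (i + 1))) ∧
      ∀ i ≤ w.length, Path S x (w.take i) (f i) ∧ Path S (f i) (w.drop i) y := by
  induction w generalizing x with
  | nil =>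
    obtain rfl : x = y := h
    exact ⟨fun _ => x, rfl, rfl, fun i hi => absurd hi (by simp), fun i _ => by simp⟩
  | cons l w ih =>
    obtain ⟨z, hz, h⟩ := h
    obtain ⟨f, h0, h1, h2, h3⟩ := ih h
    refine ⟨fun i => Nat.casesOn i x f, rfl, h1, ?_, ?_⟩
    · rintro (_ | i) hi
      · simpa [h0] using hz
      · simpa using h2 i (by simpa using hi)
    · rintro (_ | i) hi
      · exact ⟨rfl, z, hz, h⟩
      · have := h3 i (by simpa using hi)
        exact ⟨⟨z, hz, this.1⟩, this.2⟩

/-- A closed path that does not return earlier to its starting point is a closed trajectory. -/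
theorem exists_closedTrajectory {v : ℂ} {X : Crossing} {w : List Label} (hv : v ≠ 0)
    (hw : w ≠ []) (h : Path (flowStep v) X w X)
    (hprim : ∀ u u', w = u ++ u' → u ≠ [] → u' ≠ [] → ¬ Path (flowStep v) X u X) :
    ∃ T : ClosedTrajectory (Projectivization.mk ℝ v hv), T.crossing 0 = X ∧
      T.labels 0 T.period = w := by
  obtain ⟨f, h0, h1, h2, h3⟩ := h.exists_states
  set n := w.length with hn
  have hn0 : 0 < n := List.length_pos_iff.2 hw
  have hstep : ∀ i, ∃ t, IsNextCrossing v (f (i % n)) (f ((i + 1) % n)) t := by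
    intro i
    have hi := Nat.mod_lt i hn0
    obtain ⟨-, t, ht⟩ := h2 (i % n) hi
    refine ⟨t, ?_⟩
    rcases Nat.lt_or_ge (i % n + 1) n with hlt | hge
    · have : (i + 1) % n = i % n + 1 := by
        rw [Nat.add_mod, ← Nat.mod_eq_of_lt hlt]
        simp
      rwa [this]
    · have h4 : i % n + 1 = n := by omega
      have : (i + 1) % n = 0 := by
        rw [← Nat.mod_add_mod, h4, Nat.mod_self]
      rw [this, h0, ← h1]
      rwa [h4] at ht
  choose time htime using hstep
  -- If the states `i < j` agreed, omitting the path between them would give a return to `X` after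
  -- `i + (n - j)` steps.
  have honce : ∀ i j, i < j → j < n → f i ≠ f j := by
    intro i j hij hj heq
    have e1 : f (i + (n - j)) = X := by
      have hA : Path (flowStep v) (f i) ((w.drop i).take (n - j)) (f (i + (n - j))) := by
        have h5 := (h3 (i + (n - j)) (by omega)).1
        rw [List.take_add] at h5
        obtain ⟨z, hz, h6⟩ := path_append.1 h5
        obtain rfl := (flowStep_isDeterministic v).path_eq hz (h3 i (by omega)).1
        exact h6
      rw [heq] at hA
      exact flow_path_unique hA (h3 j hj.le).2 (by simp; omega)
    have h5 := h3 (i + (n - j)) (by omega)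
    rw [e1] at h5
    refine hprim (w.take (i + (n - j))) (w.drop (i + (n - j))) (List.take_append_drop _ _).symm
      ?_ ?_ h5.1
    · rw [← List.length_pos_iff, List.length_take]; omega
    · rw [← List.length_pos_iff, List.length_drop]; omega
  refine ⟨⟨v, hv, rfl, n, hn0, fun i => f (i % n), time, htime, fun i => by simp, ?_⟩, ?_, ?_⟩
  · intro i hi j hj hij
    rw [Nat.mod_eq_of_lt hi, Nat.mod_eq_of_lt hj] at hij
    rcases lt_trichotomy i j with hlt | heq | hgt
    · exact absurd hij (honce i j hlt hj)
    · exact heq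
    · exact absurd hij.symm (honce j i hgt hi)
  · simpa using h0
  · apply List.ext_getElem
    · simp [hn]
    · intro i hi hi'
      simp only [ClosedTrajectory.labels, List.getElem_map, List.getElem_range, zero_add]
      have := (h2 i hi').1
      rcases Nat.lt_or_ge (i + 1) n with hlt | hge
      · rw [Nat.mod_eq_of_lt hlt, this]
      · have h4 : i + 1 = n := by omega
        rw [h4, Nat.mod_self, h0, ← h1, ← h4, this]

/-! ### The two strips of a periodic direction -/

section fixed

variable {v : ℂ} {X' : Type*} {S' : X' → Letter → X' → Prop} {ι : X' → Crossing}
  {τ : Letter → List Label}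

theorem path_eq_replicate (hfix : ∀ x m y, S' x m y → y = x)
    (huniq : ∀ x m m' y y', S' x m y → S' x m' y' → m = m') {x y z : X'} {m : Letter}
    {u : List Letter} (hm : S' x m y) (h : Path S' x u z) : u = List.replicate u.length m := by
  induction u with
  | nil => rfl
  | cons l u ih =>
    obtain ⟨q, hq, h⟩ := h
    obtain rfl := hfix _ _ _ hq
    rw [huniq _ _ _ _ _ hq hm]
    rw [List.length_cons, List.replicate_succ, ← ih h]

/-- A proper initial part of the word that returned to the start would parse as a power of `m`,
hence be empty or at least as long as the word. -/
theorem trajectory_of_fixed (hv : v ≠ 0) (h : Induces (flowStep v) S' ι τ)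
    (hfix : ∀ x m y, S' x m y → y = x)
    (huniq : ∀ x m m' y y', S' x m y → S' x m' y' → m = m') {x : X'} {m : Letter}
    (hx : S' x m x) (hne : τ m ≠ []) :
    ∃ T : ClosedTrajectory (Projectivization.mk ℝ v hv), T.crossing 0 = ι x ∧
      T.labels 0 T.period = τ m := by
  have hp : Path S' x [m] x := ⟨x, hx, rfl⟩
  have hflow := h.lift (w' := []) hp rfl
  rw [List.flatMap_singleton] at hflow
  refine exists_closedTrajectory hv hne hflow fun u u' hu hu0 hu0' hpath => ?_
  obtain ⟨u'', rfl, hu''⟩ := h.parse ⟨m, x, hx⟩ hpath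
  rw [path_eq_replicate hfix huniq hx hu''] at hu hu0
  rcases hn : u''.length with _ | n
  · rw [hn] at hu0
    exact hu0 rfl
  · have hl := congrArg List.length hu
    rw [hn, List.replicate_succ, List.flatMap_cons, List.append_assoc, List.length_append,
      List.length_append] at hl
    exact hu0' (List.length_eq_zero_iff.1 (by omega))

/-- Started at the section, the trajectory reads a power of the word of one letter. The exponent is
one because a trajectory is traversed once. -/
theorem fixed_of_trajectory {d : Direction} (T : ClosedTrajectory d) (hv : T.velocity = v)
    (hι : ∀ x, (ι x).sheet = 1) (h : Induces (flowStep v) S' ι τ)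
    (hfix : ∀ x m y, S' x m y → y = x)
    (huniq : ∀ x m m' y y', S' x m y → S' x m' y' → m = m') (hne : ∀ m, τ m ≠ []) :
    ∃ x m, S' x m x ∧ T.orbit = (τ m : Cycle Label) ∧ T.length = ‖hol 1 (τ m)‖ := by
  subst hv
  have hT0 : T.labels 0 T.period ≠ [] := by
    rw [← List.length_pos_iff, T.length_labels]; exact T.period_pos
  obtain ⟨a, b, x, hw, ⟨m, y, hm⟩, ha, hb⟩ := h.reach T.path_period hT0
  obtain ⟨u, hu, hpath⟩ := h.parse ⟨m, y, hm⟩ (hb.trans ha)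
  obtain rfl := hfix _ _ _ hm
  have hrep := path_eq_replicate hfix huniq hm hpath
  have hlen : a.length + b.length = T.period := by
    rw [← List.length_append, ← hw, T.length_labels]
  have hone : Path (flowStep T.velocity) (ι y) (τ m) (ι y) := by
    have hp : Path S' y [m] y := ⟨y, hm, rfl⟩
    have := h.lift (w' := []) hp rfl
    rwa [List.flatMap_singleton] at this
  have hword : b ++ a = τ m := by
    rw [hrep] at hu
    rcases hn : u.length with _ | n
    · rw [hn] at hu
      have := congrArg List.length hu
      rw [List.length_append] at this
      have := T.period_pos
      simp only [List.replicate_zero, List.flatMap_nil, List.length_nil] at *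
      omega
    · rw [hn, List.replicate_succ, List.flatMap_cons] at hu
      rw [hu]
      by_contra hrest
      replace hrest : List.flatMap τ (List.replicate n m) ≠ [] := fun h0 => hrest (by simp [h0])
      have hl := congrArg List.length hu
      rw [List.length_append, List.length_append] at hl
      have h1 := List.length_pos_iff.2 hrest
      have h2 := List.length_pos_iff.2 (hne m)
      have e1 : T.crossing (0 + a.length) = ι y :=
        flow_path_unique (T.path_labels 0 a.length) ha (by simp)
      have e2 : T.crossing (0 + a.length + (τ m).length) = ι y := by
        have := T.path_labels (0 + a.length) (τ m).length
        rw [e1] at this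
        exact flow_path_unique this hone (by simp)
      have h3 := T.crossing_eq_iff.1 (e1.trans e2.symm)
      have h4 : 0 ≡ (τ m).length [MOD T.period] :=
        Nat.ModEq.add_left_cancel' (0 + a.length) (by simpa using h3)
      have h5 := (Nat.modEq_zero_iff_dvd.1 h4.symm)
      have := Nat.le_of_dvd h2 h5
      omega
  refine ⟨y, m, hm, ?_, ?_⟩
  · rw [T.orbit_eq, hw, ← hword, Cycle.coe_eq_coe]
    exact List.isRotated_append
  · have hs1 := ha.sheet_eq
    have hs2 := hb.sheet_eq
    rw [hι] at hs1 hs2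
    rw [mul_one] at hs2
    rw [T.length_eq, hw, hol_append, ← hword, hol_append, ← hs1, mul_one, ← hs2, add_comm]

end fixed

/-- A criterion for the short and the long orbit of a direction. -/
theorem short_long_of_fixed {e : Edge} {V : ℂ} (hV : V ≠ 0) {s l : Letter} (hne : ∀ m, e.word m ≠ [])
    (hs : hol 1 (e.word s) = goldenRatio * V)
    (hl : hol 1 (e.word l) = goldenRatio * (goldenRatio * V))
    (h : ∀ c : ℝ, 0 < c → ∃ (S' : ℝ → Letter → ℝ → Prop) (ι : ℝ → Crossing),
      (∀ x, (ι x).sheet = 1) ∧ Induces (flowStep (c * V)) S' ι e.word ∧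
      (∀ x m y, S' x m y → y = x) ∧ (∀ x m m' y y', S' x m y → S' x m' y' → m = m') ∧
      (∀ x m y, S' x m y → m = s ∨ m = l) ∧ (∃ x, S' x s x) ∧ ∃ x, S' x l x) :
    IsShortOrbit (Projectivization.mk ℝ V hV) (e.word s) ∧
      IsLongOrbit (Projectivization.mk ℝ V hV) (e.word l) := by
  have hcases : ∀ T : ClosedTrajectory (Projectivization.mk ℝ V hV),
      (T.orbit = (e.word s : Cycle Label) ∧ T.length = ‖hol 1 (e.word s)‖) ∨
      (T.orbit = (e.word l : Cycle Label) ∧ T.length = ‖hol 1 (e.word l)‖) := by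
    have hpos : ∀ (T : ClosedTrajectory (Projectivization.mk ℝ V hV)) (c : ℝ), 0 < c →
        T.velocity = c * V → (T.orbit = (e.word s : Cycle Label) ∧ T.length = ‖hol 1 (e.word s)‖) ∨
      (T.orbit = (e.word l : Cycle Label) ∧ T.length = ‖hol 1 (e.word l)‖) := by
      intro T c hc hTc
      obtain ⟨S', ι, hι, hI, hfix, huniq, hsl, -, -⟩ := h c hc
      obtain ⟨x, m, hx, h1, h2⟩ := fixed_of_trajectory T hTc hι hI hfix huniq hne
      rcases hsl _ _ _ hx with rfl | rfl
      · exact Or.inl ⟨h1, h2⟩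
      · exact Or.inr ⟨h1, h2⟩
    intro T
    obtain ⟨c, hc⟩ := (Projectivization.mk_eq_mk_iff' ℝ _ _ _ _).1 T.velocity_dir
    rw [Complex.real_smul] at hc
    have hc0 : c ≠ 0 := by
      rintro rfl
      exact T.velocity_ne (by simp [← hc])
    -- The coding concerns positive multiples of `V`; the central symmetry reverses the velocity and
    -- preserves orbit and length.
    rcases lt_or_gt_of_ne hc0 with hneg | hp
    · have := hpos T.neg (-c) (by linarith) (by simp [ClosedTrajectory.neg, ← hc])
      rwa [T.neg_orbit, T.neg_length] at this
    · exact hpos T c hp hc.symm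
  have hexists : ∀ m, (m = s ∨ m = l) → ∃ T : ClosedTrajectory (Projectivization.mk ℝ V hV),
      T.length = ‖hol 1 (e.word m)‖ := by
    intro m hm
    obtain ⟨S', ι, hι, hI, hfix, huniq, -, ⟨x, hx⟩, ⟨x', hx'⟩⟩ := h 1 one_pos
    rw [Complex.ofReal_one, one_mul] at hI
    rcases hm with rfl | rfl
    · obtain ⟨T, h0, h1⟩ := trajectory_of_fixed hV hI hfix huniq hx (hne _)
      exact ⟨T, by rw [T.length_eq, h0, h1, hι]⟩
    · obtain ⟨T, h0, h1⟩ := trajectory_of_fixed hV hI hfix huniq hx' (hne _)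
      exact ⟨T, by rw [T.length_eq, h0, h1, hι]⟩
  have hlt : ‖hol 1 (e.word s)‖ < ‖hol 1 (e.word l)‖ := by
    rw [hs, hl, norm_mul _ ((goldenRatio : ℂ) * V), ← hs]
    have h0 : 0 < ‖hol 1 (e.word s)‖ := by
      rw [hs, norm_pos_iff]
      exact mul_ne_zero (by exact_mod_cast Real.goldenRatio_pos.ne') hV
    rw [Complex.norm_real, Real.norm_of_nonneg Real.goldenRatio_pos.le]
    exact lt_mul_of_one_lt_left h0 Real.one_lt_goldenRatio
  obtain ⟨Ts, hTs⟩ := hexists s (Or.inl rfl)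
  obtain ⟨Tl, hTl⟩ := hexists l (Or.inr rfl)
  refine ⟨⟨⟨Ts, fun S => ?_⟩, fun T hT => ?_⟩, ⟨Tl, fun S => ?_⟩, fun T hT => ?_⟩
  · rcases hcases S with ⟨-, h⟩ | ⟨-, h⟩ <;> rw [hTs, h]
    exact hlt.le
  · rcases hcases T with ⟨h, -⟩ | ⟨-, h⟩
    · exact h
    · have := hT Ts
      rw [h, hTs] at this
      exact absurd hlt (not_lt.2 this)
  · rcases hcases S with ⟨-, h⟩ | ⟨-, h⟩ <;> rw [hTl, h]
    exact hlt.le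
  · rcases hcases T with ⟨-, h⟩ | ⟨h, -⟩
    · have := hT Tl
      rw [h, hTl] at this
      exact absurd hlt (not_lt.2 this)
    · exact h

namespace Edge

/-- The words of the edge describe the closed trajectories in the directions of its sector. -/
structure IsValid (e : Edge) : Prop where
  coded : e.IsCoded
  holonomic : e.IsHolonomic
  indep : ∀ a b : ℝ, (a : ℂ) * e.P + b * e.Q = 0 → a = 0 ∧ b = 0

variable {e : Edge}

theorem IsValid.P_ne_zero (he : e.IsValid) : e.P ≠ 0 := fun h =>
  one_ne_zero (he.indep 1 0 (by simp [h])).1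

theorem IsValid.Q_ne_zero (he : e.IsValid) : e.Q ≠ 0 := fun h =>
  one_ne_zero (he.indep 0 1 (by simp [h])).2

theorem IsValid.word_ne_nil (he : e.IsValid) (l : Letter) : e.word l ≠ [] := by
  intro h
  have h1 := (he.holonomic l).2
  have hP := he.P_ne_zero
  have hQ := he.Q_ne_zero
  have hg : ((goldenRatio : ℝ) : ℂ) ≠ 0 := by exact_mod_cast Real.goldenRatio_pos.ne'
  rw [h, hol, eq_comm] at h1
  cases l <;> simp only [quad_sP, quad_lP, quad_lQ, quad_sQ, mul_eq_zero] at h1 <;> tauto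

theorem isValid_base (j : Label) : (base j).IsValid where
  coded := isCoded_base j
  holonomic := isHolonomic_base j
  indep _ _ h := sideVec_combination_eq_zero h

/-- On the boundary `y = 0` of the sector the intervals of `lQ` and `sQ` are empty and the other two
are translated by zero. They are the cross-sections of the two strips. -/
theorem IsValid.short_long_P (he : e.IsValid) :
    IsShortOrbit (Projectivization.mk ℝ e.P he.P_ne_zero) (e.word sP) ∧
      IsLongOrbit (Projectivization.mk ℝ e.P he.P_ne_zero) (e.word lP) := by
  refine short_long_of_fixed he.P_ne_zero he.word_ne_nil (he.holonomic sP).2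
    (he.holonomic lP).2 fun c hc => ?_
  obtain ⟨o, ι, hι, h⟩ := he.coded c 0 hc.le le_rfl (by simpa using hc)
  rw [Complex.ofReal_zero, zero_mul, add_zero, mul_zero] at h
  have hgc := mul_pos Real.goldenRatio_pos hc
  refine ⟨_, ι, hι, h, ?_, ?_, ?_, ⟨o + c / 2, ?_⟩, ⟨o + c + goldenRatio * c / 2, ?_⟩⟩
  · rintro x m y ⟨⟨h1, h2⟩, h3⟩
    cases m <;> simp at h1 h2 h3 <;> linarith
  · rintro x m m' y y' ⟨⟨h1, h2⟩, h3⟩ ⟨⟨h1', h2'⟩, h3'⟩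
    cases m <;> cases m' <;> first | rfl | (exfalso; simp at h1 h2 h1' h2'; linarith)
  · rintro x m y ⟨⟨h1, h2⟩, h3⟩
    cases m <;> simp at h1 h2 ⊢ <;> linarith
  · exact ⟨⟨by simp; linarith, by simp; linarith⟩, by simp⟩
  · exact ⟨⟨by simp; linarith, by simp; linarith⟩, by simp⟩

theorem IsValid.short_long_Q (he : e.IsValid) :
    IsShortOrbit (Projectivization.mk ℝ e.Q he.Q_ne_zero) (e.word sQ) ∧
      IsLongOrbit (Projectivization.mk ℝ e.Q he.Q_ne_zero) (e.word lQ) := by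
  refine short_long_of_fixed he.Q_ne_zero he.word_ne_nil (he.holonomic sQ).2
    (he.holonomic lQ).2 fun c hc => ?_
  obtain ⟨o, ι, hι, h⟩ := he.coded 0 c le_rfl hc.le (by simpa using hc)
  rw [Complex.ofReal_zero, zero_mul, zero_add, mul_zero] at h
  have hgc := mul_pos Real.goldenRatio_pos hc
  refine ⟨_, ι, hι, h, ?_, ?_, ?_, ⟨o + goldenRatio * c + c / 2, ?_⟩,
    ⟨o + goldenRatio * c / 2, ?_⟩⟩
  · rintro x m y ⟨⟨h1, h2⟩, h3⟩
    cases m <;> simp at h1 h2 h3 <;> linarith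
  · rintro x m m' y y' ⟨⟨h1, h2⟩, h3⟩ ⟨⟨h1', h2'⟩, h3'⟩
    cases m <;> cases m' <;> first | rfl | (exfalso; simp at h1 h2 h1' h2'; linarith)
  · rintro x m y ⟨⟨h1, h2⟩, h3⟩
    cases m <;> simp at h1 h2 ⊢ <;> linarith
  · exact ⟨⟨by simp; linarith, by simp; linarith⟩, by simp⟩
  · exact ⟨⟨by simp; linarith, by simp; linarith⟩, by simp⟩

end Edge

/-! ### Frames of ideal pentagons -/

theorem goldenRatio_sq' : (goldenRatio : ℂ) ^ 2 = goldenRatio + 1 := by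
  exact_mod_cast Real.goldenRatio_sq

/-- The consecutive vertices of the ideal pentagon that has `A` and `B` as consecutive vertices,
closed up by `-A`. -/
def pent (A B : ℂ) : Fin 6 → ℂ :=
  ![A, B, goldenRatio * B - A, goldenRatio * B - goldenRatio * A, B - goldenRatio * A, -A]

/-- The consecutive vertices of the ideal pentagon beyond the side with the endpoints `P`, `Q`. -/
def beyond (P Q : ℂ) : Fin 5 → ℂ :=
  ![P, goldenRatio * P + Q, goldenRatio * P + goldenRatio * Q, P + goldenRatio * Q, Q]

/-- `X` and `Y` are, up to sign and order, consecutive vertices of `pent A B`. -/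
def IsSideOf (A B X Y : ℂ) : Prop :=
  ∃ (i : Fin 5) (s : ℝ), (s = 1 ∨ s = -1) ∧
    ((X = s * pent A B i.castSucc ∧ Y = s * pent A B i.succ) ∨
      (X = s * pent A B i.succ ∧ Y = s * pent A B i.castSucc))

namespace IsSideOf

variable {A B X Y P Q : ℂ}

theorem refl (A B : ℂ) : IsSideOf A B A B :=
  ⟨0, 1, Or.inl rfl, Or.inl ⟨by simp [pent], by simp [pent]⟩⟩

theorem swap (h : IsSideOf A B X Y) : IsSideOf A B Y X := by
  obtain ⟨i, s, hs, h⟩ := h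
  exact ⟨i, s, hs, h.symm.imp And.symm And.symm⟩

theorem neg (h : IsSideOf A B X Y) : IsSideOf A B (-X) (-Y) := by
  obtain ⟨i, s, hs, h⟩ := h
  refine ⟨i, -s, by rcases hs with rfl | rfl <;> simp, ?_⟩
  push_cast
  simpa using h

theorem of_sign (h : IsSideOf A B P Q) {s : ℝ} (hs : s = 1 ∨ s = -1)
    (hXY : (X = s * P ∧ Y = s * Q) ∨ (X = s * Q ∧ Y = s * P)) : IsSideOf A B X Y := by
  rcases hs with rfl | rfl <;> rcases hXY with ⟨rfl, rfl⟩ | ⟨rfl, rfl⟩ <;> simp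
  exacts [h, h.swap, h.neg, h.swap.neg]

theorem reflect {s : ℝ} (hs : s = 1 ∨ s = -1)
    (hXY : (X = s * P ∧ Y = s * Q) ∨ (X = s * Q ∧ Y = s * P)) : IsSideOf P (-Q) X (-Y) := by
  have h := refl P (-Q)
  rcases hs with rfl | rfl <;> rcases hXY with ⟨rfl, rfl⟩ | ⟨rfl, rfl⟩ <;> simp
  exacts [h, by simpa using h.swap.neg, by simpa using h.neg, by simpa using h.swap]

/-- Consecutive vectors of `pent` obey `z'' = φz' - z`, and `φ = 2 cos (π/5)` makes the recurrence
return to its start with the opposite sign after five steps. -/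
theorem turn (h : IsSideOf A B X Y) : IsSideOf A B (goldenRatio * Y - X) Y := by
  have hg := goldenRatio_sq'
  obtain ⟨i, s, hs, h⟩ := h
  have hs' : -s = 1 ∨ -s = -1 := by rcases hs with rfl | rfl <;> simp
  simp only [IsSideOf, pent] at h ⊢
  generalize (goldenRatio : ℂ) = g at *
  rcases h with ⟨rfl, rfl⟩ | ⟨rfl, rfl⟩
  · fin_cases i
    · exact ⟨1, s, hs, Or.inr ⟨by simp; ring, rfl⟩⟩
    · exact ⟨2, s, hs, Or.inr ⟨by simp; linear_combination (s * B) * hg, rfl⟩⟩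
    · exact ⟨3, s, hs, Or.inr ⟨by simp; linear_combination (s * B - s * A) * hg, rfl⟩⟩
    · exact ⟨4, s, hs, Or.inr ⟨by simp; linear_combination (- s * A) * hg, rfl⟩⟩
    · exact ⟨0, -s, hs', Or.inr ⟨by simp; ring, by simp⟩⟩
  · fin_cases i
    · exact ⟨4, -s, hs', Or.inl ⟨by simp; ring, by simp⟩⟩
    · exact ⟨0, s, hs, Or.inl ⟨by simp; ring, rfl⟩⟩
    · exact ⟨1, s, hs, Or.inl ⟨by simp; linear_combination (s * B) * hg, rfl⟩⟩
    · exact ⟨2, s, hs, Or.inl ⟨by simp; linear_combination (s * B - s * A) * hg, rfl⟩⟩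
    · exact ⟨3, s, hs, Or.inl ⟨by simp; linear_combination (- s * A) * hg, rfl⟩⟩

theorem beyond (P Q : ℂ) (c : Fin 4) :
    IsSideOf P (-Q) (beyond P Q c.castSucc) (beyond P Q c.succ) := by
  simp only [IsSideOf, pent, DoublePentagon.beyond]
  generalize (goldenRatio : ℂ) = g
  fin_cases c
  · exact ⟨4, -1, Or.inr rfl, Or.inr ⟨by simp, by simp [add_comm]⟩⟩
  · exact ⟨3, -1, Or.inr rfl, Or.inr ⟨by simp [add_comm], by simp [add_comm]⟩⟩
  · exact ⟨2, -1, Or.inr rfl, Or.inr ⟨by simp [add_comm], by simp [add_comm]⟩⟩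
  · exact ⟨1, -1, Or.inr rfl, Or.inr ⟨by simp [add_comm], by simp⟩⟩

/-- A side of the pentagon beyond `P Q` is `P Q` itself or a side of `beyond P Q`. -/
theorem cases_beyond (h : IsSideOf P (-Q) X Y) :
    ∃ s : ℝ, (s = 1 ∨ s = -1) ∧ (((X = s * P ∧ -Y = s * Q) ∨ (X = s * Q ∧ -Y = s * P)) ∨
      ∃ c : Fin 4, (X = s * DoublePentagon.beyond P Q c.castSucc ∧
          Y = s * DoublePentagon.beyond P Q c.succ) ∨
        (X = s * DoublePentagon.beyond P Q c.succ ∧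
          Y = s * DoublePentagon.beyond P Q c.castSucc)) := by
  obtain ⟨i, s, hs, h⟩ := h
  have hs' : -s = 1 ∨ -s = -1 := by rcases hs with rfl | rfl <;> simp
  simp only [pent, DoublePentagon.beyond] at h ⊢
  generalize (goldenRatio : ℂ) = g at *
  fin_cases i
  · rcases h with ⟨rfl, rfl⟩ | ⟨rfl, rfl⟩
    · exact ⟨s, hs, Or.inl (Or.inl ⟨by simp, by simp⟩)⟩
    · exact ⟨-s, hs', Or.inl (Or.inr ⟨by simp, by simp⟩)⟩
  · rcases h with ⟨rfl, rfl⟩ | ⟨rfl, rfl⟩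
    · exact ⟨-s, hs', Or.inr ⟨3, Or.inr ⟨by simp, by simp; ring⟩⟩⟩
    · exact ⟨-s, hs', Or.inr ⟨3, Or.inl ⟨by simp; ring, by simp⟩⟩⟩
  · rcases h with ⟨rfl, rfl⟩ | ⟨rfl, rfl⟩
    · exact ⟨-s, hs', Or.inr ⟨2, Or.inr ⟨by simp; ring, by simp; ring⟩⟩⟩
    · exact ⟨-s, hs', Or.inr ⟨2, Or.inl ⟨by simp; ring, by simp; ring⟩⟩⟩
  · rcases h with ⟨rfl, rfl⟩ | ⟨rfl, rfl⟩
    · exact ⟨-s, hs', Or.inr ⟨1, Or.inr ⟨by simp; ring, by simp; ring⟩⟩⟩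
    · exact ⟨-s, hs', Or.inr ⟨1, Or.inl ⟨by simp; ring, by simp; ring⟩⟩⟩
  · rcases h with ⟨rfl, rfl⟩ | ⟨rfl, rfl⟩
    · exact ⟨-s, hs', Or.inr ⟨0, Or.inr ⟨by simp; ring, by simp⟩⟩⟩
    · exact ⟨-s, hs', Or.inr ⟨0, Or.inl ⟨by simp, by simp; ring⟩⟩⟩

end IsSideOf

/-! ### Reflected pentagons and the tree of sectors -/

/-- The pairs of consecutive vertices of ideal pentagons obtained from the pentagon `pent A B` by
`n` reflections. -/
inductive Reach (A B : ℂ) : ℕ → ℂ → ℂ → Prop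
  | refl : Reach A B 0 A B
  | swap {n X Y} (h : Reach A B n X Y) : Reach A B n Y X
  | neg {n X Y} (h : Reach A B n X Y) : Reach A B n (-X) (-Y)
  | turn {n X Y} (h : Reach A B n X Y) : Reach A B n (goldenRatio * Y - X) Y
  | reflect {n X Y} (h : Reach A B n X Y) : Reach A B (n + 1) X (-Y)

namespace Reach

variable {A B X Y Z W : ℂ} {m n : ℕ}

theorem trans (h : Reach A B n X Y) (h' : Reach X Y m Z W) : Reach A B (n + m) Z W := by
  induction h' with
  | refl => exact h
  | swap _ ih => exact ih.swap
  | neg _ ih => exact ih.neg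
  | turn _ ih => exact ih.turn
  | reflect _ ih => exact ih.reflect

/-- Up to sign and order, turns and reflections are involutions. So any pentagon of the tiling can
serve as the initial one. -/
theorem symm (h : Reach A B n X Y) : Reach X Y n A B := by
  induction h with
  | refl => exact refl
  | swap _ ih => simpa using (refl.swap : Reach _ _ _ _ _).trans ih
  | neg _ ih =>
    rename_i X Y _
    have h1 : Reach (-X) (-Y) 0 X Y := by simpa using (refl.neg : Reach (-X) (-Y) 0 _ _)
    simpa using h1.trans ih
  | @turn n X Y _ ih =>
    have h1 : Reach (goldenRatio * Y - X) Y 0 X Y := by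
      simpa using (refl.turn : Reach (goldenRatio * Y - X) Y 0 _ _)
    simpa using h1.trans ih
  | @reflect n X Y _ ih =>
    have h1 : Reach X (-Y) 1 X Y := by simpa using (refl.reflect : Reach X (-Y) _ _ _)
    simpa [add_comm] using h1.trans ih

theorem shift (h : Reach A B n X Y) : Reach A B n Y (goldenRatio * Y - X) := h.turn.swap

theorem pent_side (h : Reach A B n X Y) (i : Fin 5) :
    Reach A B n (pent X Y i.castSucc) (pent X Y i.succ) := by
  have hg := goldenRatio_sq'
  have h1 := h.shift
  have h2 := h1.shift
  have h3 := h2.shift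
  have h4 := h3.shift
  have e1 : goldenRatio * (goldenRatio * Y - X) - Y = goldenRatio * Y - goldenRatio * X := by
    linear_combination Y * hg
  rw [e1] at h2 h3 h4
  have e2 : goldenRatio * (goldenRatio * Y - goldenRatio * X) - (goldenRatio * Y - X) =
      Y - goldenRatio * X := by
    linear_combination (Y - X) * hg
  rw [e2] at h3 h4
  have e3 : goldenRatio * (Y - goldenRatio * X) - (goldenRatio * Y - goldenRatio * X) = -X := by
    linear_combination - X * hg
  rw [e3] at h4
  fin_cases i
  exacts [h, h1, h2, h3, h4]

theorem of_isSideOf (h : Reach A B n X Y) (h' : IsSideOf X Y Z W) : Reach A B n Z W := by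
  obtain ⟨i, s, rfl | rfl, ⟨rfl, rfl⟩ | ⟨rfl, rfl⟩⟩ := h'
  · simpa using h.pent_side i
  · simpa using (h.pent_side i).swap
  · simpa using (h.pent_side i).neg
  · simpa using (h.pent_side i).swap.neg

end Reach

/-- The sectors outside of the ideal pentagon `pent A B`, with their boundary vectors. -/
inductive IsSector (A B : ℂ) : ℕ → ℂ → ℂ → Prop
  | start (i : Fin 5) : IsSector A B 0 (pent A B i.castSucc) (pent A B i.succ)
  | child {n P Q} (h : IsSector A B n P Q) (c : Fin 4) :
      IsSector A B (n + 1) (beyond P Q c.castSucc) (beyond P Q c.succ)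

theorem IsSector.reach {A B P Q : ℂ} {n : ℕ} (h : IsSector A B n P Q) : Reach A B n P Q := by
  induction h with
  | start i => exact Reach.refl.pent_side i
  | @child n P Q _ c ih => exact ih.reflect.of_isSideOf (.beyond P Q c)

/-- Every ideal pentagon of the tiling but the first one lies beyond the side of a sector. -/
theorem Reach.cases_sector {A B X Y : ℂ} {k : ℕ} (h : Reach A B k X Y) :
    IsSideOf A B X Y ∨ ∃ n P Q, n < k ∧ IsSector A B n P Q ∧ IsSideOf P (-Q) X Y := by
  induction h with
  | refl => exact Or.inl (.refl A B)
  | swap _ ih => exact ih.imp .swap fun ⟨n, P, Q, hn, h, h'⟩ => ⟨n, P, Q, hn, h, h'.swap⟩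
  | neg _ ih => exact ih.imp .neg fun ⟨n, P, Q, hn, h, h'⟩ => ⟨n, P, Q, hn, h, h'.neg⟩
  | turn _ ih => exact ih.imp .turn fun ⟨n, P, Q, hn, h, h'⟩ => ⟨n, P, Q, hn, h, h'.turn⟩
  | reflect _ ih =>
    rcases ih with ⟨i, s, hs, h⟩ | ⟨n, P, Q, hn, h, h'⟩
    · exact Or.inr ⟨0, _, _, Nat.succ_pos _, .start i, .reflect hs h⟩
    · obtain ⟨s, hs, h' | ⟨c, h'⟩⟩ := h'.cases_beyond
      · cases h with
        | start i =>
          exact Or.inl (IsSideOf.of_sign ⟨i, 1, Or.inl rfl, Or.inl ⟨by simp, by simp⟩⟩ hs h')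
        | @child n P Q h c =>
          exact Or.inr ⟨n, P, Q, by omega, h, (IsSideOf.beyond P Q c).of_sign hs h'⟩
      · exact Or.inr ⟨n + 1, _, _, by omega, h.child c, .reflect hs h'⟩

/-! ### Directions and vectors -/

/-- The vector `z` has the direction `d`. -/
def Lifts (d : Direction) (z : ℂ) : Prop := ∃ hz : z ≠ 0, Projectivization.mk ℝ z hz = d

namespace Lifts

variable {d d' : Direction} {z z' : ℂ}

theorem ne_zero (h : Lifts d z) : z ≠ 0 := h.1

theorem mul (h : Lifts d z) {c : ℝ} (hc : c ≠ 0) : Lifts d (c * z) := by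
  obtain ⟨hz, rfl⟩ := h
  exact ⟨mul_ne_zero (Complex.ofReal_ne_zero.2 hc) hz,
    (Projectivization.mk_eq_mk_iff' ℝ _ _ _ _).2 ⟨c, by rw [Complex.real_smul]⟩⟩

theorem neg (h : Lifts d z) : Lifts d (-z) := by
  simpa using h.mul (c := -1) (by norm_num)

theorem sign (h : Lifts d z) {s : ℝ} (hs : s = 1 ∨ s = -1) : Lifts d (s * z) :=
  h.mul (by rcases hs with rfl | rfl <;> norm_num)

theorem eq (h : Lifts d z) (h' : Lifts d' z) : d = d' := by
  obtain ⟨_, rfl⟩ := h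
  obtain ⟨_, rfl⟩ := h'
  rfl

theorem exists_mul (h : Lifts d z) (h' : Lifts d z') : ∃ c : ℝ, c ≠ 0 ∧ z' = c * z := by
  obtain ⟨hz, rfl⟩ := h
  obtain ⟨hz', h'⟩ := h'
  obtain ⟨c, hc⟩ := (Projectivization.mk_eq_mk_iff' ℝ _ _ _ _).1 h'
  rw [Complex.real_smul] at hc
  refine ⟨c, ?_, hc.symm⟩
  rintro rfl
  exact hz' (by rw [← hc]; simp)

theorem of_sign {s : ℝ} (hs : s = 1 ∨ s = -1) (h : Lifts d (s * z)) : Lifts d z := by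
  have := h.sign hs
  rcases hs with rfl | rfl <;> simpa using this

end Lifts

theorem lifts_mk (z : ℂ) (hz : z ≠ 0) : Lifts (Projectivization.mk ℝ z hz) z := ⟨hz, rfl⟩

theorem lifts_rep (d : Direction) : Lifts d d.rep := ⟨d.rep_nonzero, d.mk_rep⟩

theorem cross_combination (a b c d : ℝ) (P Q : ℂ) :
    cross (a * P + b * Q) (c * P + d * Q) = (a * d - b * c) * cross P Q := by
  simp only [cross, Complex.add_re, Complex.add_im, Complex.re_ofReal_mul, Complex.im_ofReal_mul]
  ring

theorem eq_zero_of_combination_eq_zero {P Q : ℂ} (h : cross P Q ≠ 0) {a b : ℝ}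
    (hab : (a : ℂ) * P + b * Q = 0) : a = 0 ∧ b = 0 := by
  have h1 := cross_combination a b 0 1 P Q
  have h2 := cross_combination a b 1 0 P Q
  rw [hab] at h1 h2
  simp only [cross, Complex.zero_re, Complex.zero_im, zero_mul, sub_self] at h1 h2
  simp only [cross] at h
  constructor
  · have := mul_eq_zero.1 h1.symm
    simpa [h] using this
  · have := mul_eq_zero.1 h2.symm
    simpa [h] using this

theorem exists_combination {P Q : ℂ} (h : cross P Q ≠ 0) (z : ℂ) :
    ∃ a b : ℝ, z = a * P + b * Q := by
  refine ⟨cross z Q / cross P Q, cross P z / cross P Q, ?_⟩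
  have h' : ((cross P Q : ℝ) : ℂ) ≠ 0 := Complex.ofReal_ne_zero.2 h
  push_cast
  field_simp
  apply Complex.ext <;>
    simp only [cross, Complex.add_re, Complex.add_im, Complex.mul_re, Complex.mul_im,
      Complex.ofReal_re, Complex.ofReal_im] <;> ring

/-- A change of representatives multiplies the defining vector by the nonzero factor `a b c` and
hence does not affect its direction. -/
theorem idealReflection_lifts {p q r : Direction} {P Q : ℂ} {x y : ℝ} (hp : Lifts p P)
    (hq : Lifts q Q) (hPQ : cross P Q ≠ 0) (hr : Lifts r (x * P + y * Q)) :
    Lifts (idealReflection p q r) (x * P - y * Q) := by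
  obtain ⟨a, ha, hpa⟩ := hp.exists_mul (lifts_rep p)
  obtain ⟨b, hb, hqb⟩ := hq.exists_mul (lifts_rep q)
  obtain ⟨c, hc, hrc⟩ := hr.exists_mul (lifts_rep r)
  have hne : (x : ℂ) * P - y * Q ≠ 0 := by
    intro h
    obtain ⟨rfl, h2⟩ := eq_zero_of_combination_eq_zero hPQ (a := x) (b := -y)
      (by push_cast; linear_combination h)
    obtain rfl : y = 0 := by simpa using h2
    exact hr.ne_zero (by simp)
  have key : ((cross r.rep q.rep : ℝ) : ℂ) * p.rep - ((cross p.rep r.rep : ℝ) : ℂ) * q.rep =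
      ((a * b * c * cross P Q : ℝ) : ℂ) * (x * P - y * Q) := by
    have h1 : cross r.rep q.rep = c * b * x * cross P Q := by
      have := cross_combination (c * x) (c * y) 0 b P Q
      rw [hqb, hrc]
      convert this using 2 <;> push_cast <;> ring
    have h2 : cross p.rep r.rep = a * c * y * cross P Q := by
      have := cross_combination a 0 (c * x) (c * y) P Q
      rw [hpa, hrc]
      convert this using 2 <;> push_cast <;> ring
    rw [h1, h2, hpa, hqb]
    push_cast
    ring
  have hk : a * b * c * cross P Q ≠ 0 := by positivity
  have hne' : ((cross r.rep q.rep : ℝ) : ℂ) * p.rep - ((cross p.rep r.rep : ℝ) : ℂ) * q.rep ≠ 0 := by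
    rw [key]
    exact mul_ne_zero (Complex.ofReal_ne_zero.2 hk) hne
  have hl : Lifts (idealReflection p q r)
      (((cross r.rep q.rep : ℝ) : ℂ) * p.rep - ((cross p.rep r.rep : ℝ) : ℂ) * q.rep) := by
    refine ⟨hne', ?_⟩
    rw [idealReflection, dif_pos hne']
  rw [key] at hl
  have := hl.mul (inv_ne_zero hk)
  rwa [← mul_assoc, ← Complex.ofReal_mul, inv_mul_cancel₀ hk, Complex.ofReal_one, one_mul] at this

/-- The vertices of the ideal pentagon `V`, from the `i`-th one on, are those of `pent A B`. -/
structure Frame (V : Label → Direction) (i : Label) (A B : ℂ) : Prop where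
  cross_ne : cross A B ≠ 0
  lift0 : Lifts (V i) A
  lift1 : Lifts (V (i + 1)) B
  lift2 : Lifts (V (i + 2)) (goldenRatio * B - A)
  lift3 : Lifts (V (i + 3)) (goldenRatio * B - goldenRatio * A)
  lift4 : Lifts (V (i + 4)) (B - goldenRatio * A)

namespace Frame

variable {V : Label → Direction} {i : Label} {A B : ℂ}

theorem shift (h : Frame V i A B) : Frame V (i + 1) B (goldenRatio * B - A) := by
  have hg := goldenRatio_sq'
  obtain ⟨hc, h0, h1, h2, h3, h4⟩ := h
  have e1 : i + 1 + 1 = i + 2 := by ring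
  have e2 : i + 1 + 2 = i + 3 := by ring
  have e3 : i + 1 + 3 = i + 4 := by ring
  have e4 : i + 1 + 4 = i := by
    rw [add_assoc]; exact add_eq_left.2 (by decide)
  refine ⟨?_, h1, by rwa [e1], ?_, ?_, ?_⟩
  · have := cross_combination 0 1 (-1) goldenRatio A B
    intro h
    apply hc
    rw [show (goldenRatio : ℂ) * B - A = ((-1 : ℝ) : ℂ) * A + goldenRatio * B by push_cast; ring,
      show B = ((0 : ℝ) : ℂ) * A + ((1 : ℝ) : ℂ) * B by push_cast; ring] at h
    simp only [zero_mul, zero_add, Complex.ofReal_one, Complex.ofReal_zero, one_mul] at h this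
    rw [h] at this
    linarith
  · rw [e2]; convert h3 using 1; linear_combination B * hg
  · rw [e3]; convert h4 using 1; linear_combination B * hg
  · rw [e4]; convert h0.neg using 1; ring

theorem neg (h : Frame V i A B) : Frame V i (-A) (-B) := by
  obtain ⟨hc, h0, h1, h2, h3, h4⟩ := h
  refine ⟨by simpa [cross] using hc, h0.neg, h1.neg, ?_, ?_, ?_⟩
  · convert h2.neg using 1; ring
  · convert h3.neg using 1; ring
  · convert h4.neg using 1; ring

theorem unshift (h : Frame V i A B) : Frame V (i - 1) (goldenRatio * A - B) A := by
  have hg := goldenRatio_sq'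
  have := h.shift.shift.shift.shift.neg
  have e : i + 1 + 1 + 1 + 1 = i - 1 := by
    rw [add_assoc, add_assoc, add_assoc, sub_eq_add_neg]; congr 1
  rw [e] at this
  convert this using 1
  · linear_combination ((goldenRatio + 1) * B - A) * hg
  · linear_combination ((goldenRatio ^ 2 + goldenRatio - 1) * B - (goldenRatio + 1) * A) * hg

/-- The linear map with `A ↦ A`, `B ↦ -B` carries `pent A B` to `pent A (-B)`. -/
theorem reflect (h : Frame V i A B) :
    Frame (fun j => idealReflection (V i) (V (i + 1)) (V j)) i A (-B) := by
  obtain ⟨hc, h0, h1, h2, h3, h4⟩ := h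
  have key : ∀ (r : Direction) (x y : ℝ), Lifts r (x * A + y * B) →
      Lifts (idealReflection (V i) (V (i + 1)) r) (x * A - y * B) := fun r x y h =>
    idealReflection_lifts h0 h1 hc h
  refine ⟨fun h0 => hc ?_, ?_, ?_, ?_, ?_, ?_⟩
  · simp only [cross, Complex.neg_re, Complex.neg_im] at h0 ⊢
    linarith
  · simpa using key (V i) 1 0 (by simpa using h0)
  · simpa using key (V (i + 1)) 0 1 (by simpa using h1)
  · convert key (V (i + 2)) (-1) goldenRatio (by convert h2 using 1; push_cast; ring) using 1
    push_cast; ring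
  · convert key (V (i + 3)) (-goldenRatio) goldenRatio
      (by convert h3 using 1; rw [Complex.ofReal_neg]; ring) using 1
    rw [Complex.ofReal_neg]; ring
  · convert key (V (i + 4)) (-goldenRatio) 1
      (by convert h4 using 1; rw [Complex.ofReal_neg]; push_cast; ring) using 1
    rw [Complex.ofReal_neg]; push_cast; ring

end Frame

theorem sideVec_succ (j : Label) : sideVec (j + 1) = -sideVec' j := by
  rw [sideVec, ω_pow_val_add, sideVec', sideVec]
  have : (1 : Label).val = 1 := rfl
  rw [this]
  ring

theorem pent_sideVec (m : Fin 6) :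
    pent (sideVec 0) (sideVec' 0) m = (-1) ^ (m : ℕ) * sideVec ((m : ℕ) : Label) := by
  have h5 := ω_pow_five
  have v5 : (5 : Label).val = 0 := rfl
  have v0 : (0 : Label).val = 0 := rfl
  have v1 : (1 : Label).val = 1 := rfl
  have v2 : (2 : Label).val = 2 := rfl
  have v3 : (3 : Label).val = 3 := rfl
  have v4 : (4 : Label).val = 4 := rfl
  rw [pent, goldenRatio_eq]
  fin_cases m <;> simp [sideVec', sideVec, v0, v1, v2, v3, v4, v5]
  · linear_combination (ω - 1) * h5
  · linear_combination ω ^ 2 * h5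
  · linear_combination -ω ^ 3 * (ω - 1) * h5
  · ring

theorem frame_sideDirection : Frame sideDirection 0 (sideVec 0) (sideVec' 0) := by
  have lift : ∀ m : Fin 6, Lifts (sideDirection (0 + (m : ℕ))) (pent (sideVec 0) (sideVec' 0) m) := by
    intro m
    have h : Lifts (sideDirection (m : ℕ)) (ω ^ (2 * (m : Label).val + 1) - ω ^ (2 * (m : Label).val)) :=
      lifts_mk _ _
    rw [zero_add, pent_sideVec]
    convert h.sign (s := (-1) ^ (m : ℕ)) (neg_one_pow_eq_or ℝ _) using 1
    rw [sideVec]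
    push_cast
    ring
  refine ⟨fun h => ?_, by simpa [pent] using lift 0, lift 1, lift 2, lift 3, lift 4⟩
  have h1 : cross (sideVec 0) (sideVec' 0) = -(ω ^ 2).im * Complex.normSq (sideVec 0) := by
    rw [sideVec', cross, Complex.normSq_apply]
    simp only [Complex.mul_re, Complex.mul_im, Complex.neg_re, Complex.neg_im]
    ring
  rw [h1] at h
  have := Complex.normSq_pos.2 (sideVec_ne_zero 0)
  have := mul_pos ω_sq_im_pos this
  linarith

/-! ### Tiles and frames -/

theorem IsTile.exists_frame {k : ℕ} {V : Label → Direction} (h : IsTile k V) (j : Label) :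
    ∃ X Y, Reach (sideVec 0) (sideVec' 0) k X Y ∧ Frame V j X Y := by
  have all : ∀ {k : ℕ} {V : Label → Direction} {i : Label} {X Y : ℂ},
      Reach (sideVec 0) (sideVec' 0) k X Y → Frame V i X Y → ∀ n : ℕ,
      ∃ X Y, Reach (sideVec 0) (sideVec' 0) k X Y ∧ Frame V (i + n) X Y := by
    intro k V i X Y hr hf n
    induction n with
    | zero => exact ⟨X, Y, hr, by simpa using hf⟩
    | succ n ih =>
      obtain ⟨X, Y, hr, hf⟩ := ih
      exact ⟨_, _, hr.shift, by simpa [add_assoc] using hf.shift⟩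
  have all' : ∀ {k : ℕ} {V : Label → Direction} {i : Label} {X Y : ℂ} (j : Label),
      Reach (sideVec 0) (sideVec' 0) k X Y → Frame V i X Y →
      ∃ X Y, Reach (sideVec 0) (sideVec' 0) k X Y ∧ Frame V j X Y := by
    intro k V i X Y j hr hf
    simpa using all hr hf (j - i).val
  induction h generalizing j with
  | base => exact all' j .refl frame_sideDirection
  | reflect i _ ih =>
    obtain ⟨X, Y, hr, hf⟩ := ih i
    exact all' j hr.reflect hf.reflect

theorem Reach.exists_tile {k : ℕ} {X Y : ℂ} (h : Reach (sideVec 0) (sideVec' 0) k X Y) :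
    ∃ V, IsTile k V ∧ ∃ j, Frame V j X Y ∨ Frame V j Y X := by
  induction h with
  | refl => exact ⟨_, .base, 0, Or.inl frame_sideDirection⟩
  | swap _ ih =>
    obtain ⟨V, hV, j, h⟩ := ih
    exact ⟨V, hV, j, h.symm⟩
  | neg _ ih =>
    obtain ⟨V, hV, j, h⟩ := ih
    exact ⟨V, hV, j, h.imp .neg .neg⟩
  | turn _ ih =>
    obtain ⟨V, hV, j, h | h⟩ := ih
    · exact ⟨V, hV, j + 1, Or.inr h.shift⟩
    · exact ⟨V, hV, j - 1, Or.inl h.unshift⟩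
  | @reflect _ X Y _ ih =>
    obtain ⟨V, hV, j, h | h⟩ := ih
    · exact ⟨_, .reflect j hV, j, Or.inl h.reflect⟩
    · exact ⟨_, .reflect j hV, j, Or.inr (by simpa using h.reflect.neg)⟩

theorem joined_iff {p q : Direction} : Joined p q ↔
    ∃ k X Y, Reach (sideVec 0) (sideVec' 0) k X Y ∧ Lifts p X ∧ Lifts q Y := by
  constructor
  · rintro ⟨k, V, j, hV, h⟩
    obtain ⟨X, Y, hr, hf⟩ := hV.exists_frame j
    rcases h with ⟨rfl, rfl⟩ | ⟨rfl, rfl⟩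
    · exact ⟨k, X, Y, hr, hf.lift0, hf.lift1⟩
    · exact ⟨k, Y, X, hr.swap, hf.lift1, hf.lift0⟩
  · rintro ⟨k, X, Y, hr, hX, hY⟩
    obtain ⟨V, hV, j, h | h⟩ := hr.exists_tile
    · exact ⟨k, V, j, hV, Or.inl ⟨h.lift0.eq hX, h.lift1.eq hY⟩⟩
    · exact ⟨k, V, j, hV, Or.inr ⟨h.lift0.eq hY, h.lift1.eq hX⟩⟩

/-! ### The neighbours of a vertex -/

theorem Reach.cross_ne {A B X Y : ℂ} {k : ℕ} (h : Reach A B k X Y) (hc : cross A B ≠ 0) :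
    cross X Y ≠ 0 := by
  induction h with
  | refl => exact hc
  | swap _ ih => exact fun h => ih (by simp only [cross] at *; linarith)
  | neg _ ih => simpa [cross] using ih
  | @turn n X Y _ ih =>
    have := cross_combination (-1) goldenRatio 0 1 X Y
    simp only [Complex.ofReal_neg, Complex.ofReal_one, Complex.ofReal_zero, neg_mul, one_mul,
      zero_mul, zero_add] at this
    rw [show (goldenRatio : ℂ) * Y - X = -X + goldenRatio * Y by ring, this]
    simpa using ih
  | reflect _ ih =>
    refine fun h => ih ?_
    simp only [cross, Complex.neg_re, Complex.neg_im] at *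
    linarith

/-- The pairs of vertices at `B` that are adjacent in the tiling. -/
theorem Reach.add_mul {A A' B C : ℂ} {k : ℕ} (h : Reach A A' k C B) (n : ℤ) :
    ∃ k', Reach A A' k' (C + n * (goldenRatio * B)) B := by
  induction n with
  | zero => exact ⟨k, by simpa using h⟩
  | succ n ih =>
    obtain ⟨k', h⟩ := ih
    refine ⟨_, (?_ : Reach A A' (k' + 1) _ _)⟩
    -- A reflection in the side at `B` followed by a turn about `B` reaches the next neighbour `C +
    -- φB`, up to sign.
    have := h.reflect.turn.neg
    convert this using 1 <;> push_cast <;> ring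
  | pred n ih =>
    obtain ⟨k', h⟩ := ih
    refine ⟨_, (?_ : Reach A A' (k' + 1) _ _)⟩
    have := h.turn.neg.reflect
    convert this using 1 <;> push_cast <;> ring

/-! ### Sides of the tiling do not enter pentagons -/

/-- The closed cone spanned by two vectors. -/
def Cone (P Q z : ℂ) : Prop := ∃ x y : ℝ, 0 ≤ x ∧ 0 ≤ y ∧ z = x * P + y * Q

theorem Cone.combination {P Q z w : ℂ} (hz : Cone P Q z) (hw : Cone P Q w) {a b : ℝ} (ha : 0 ≤ a)
    (hb : 0 ≤ b) : Cone P Q (a * z + b * w) := by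
  obtain ⟨x, y, hx, hy, rfl⟩ := hz
  obtain ⟨x', y', hx', hy', rfl⟩ := hw
  refine ⟨a * x + b * x', a * y + b * y', by positivity, by positivity, ?_⟩
  push_cast
  ring

theorem cone_left (P Q : ℂ) : Cone P Q P := ⟨1, 0, by simp, by simp, by simp⟩

theorem cone_right (P Q : ℂ) : Cone P Q Q := ⟨0, 1, by simp, by simp, by simp⟩

theorem Cone.beyond {P Q P' Q' : ℂ} (hP : Cone P Q P') (hQ : Cone P Q Q') (i : Fin 5) :
    Cone P Q (beyond P' Q' i) := by
  have hg := Real.goldenRatio_pos.le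
  have key : ∀ a b : ℝ, 0 ≤ a → 0 ≤ b → Cone P Q (a * P' + b * Q') := fun a b ha hb =>
    hP.combination hQ ha hb
  fin_cases i
  · exact hP
  · simpa [DoublePentagon.beyond] using key goldenRatio 1 hg zero_le_one
  · exact key goldenRatio goldenRatio hg hg
  · simpa [DoublePentagon.beyond] using key 1 goldenRatio zero_le_one hg
  · exact hQ

theorem IsSector.exists_cone {A B P Q : ℂ} {n : ℕ} (h : IsSector A B n P Q) : ∃ i : Fin 5,
    Cone (pent A B i.castSucc) (pent A B i.succ) P ∧
      Cone (pent A B i.castSucc) (pent A B i.succ) Q := by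
  induction h with
  | start i => exact ⟨i, cone_left _ _, cone_right _ _⟩
  | child _ c ih =>
    obtain ⟨i, hP, hQ⟩ := ih
    exact ⟨i, hP.beyond hQ _, hP.beyond hQ _⟩

/-- A side of the pentagon beyond `P Q` consists of vertices of it. -/
theorem IsSideOf.exists_beyond {P Q X Y : ℂ} (h : IsSideOf P (-Q) X Y) :
    (∃ (s : ℝ) (i : Fin 5), (s = 1 ∨ s = -1) ∧ X = s * DoublePentagon.beyond P Q i) ∧
      ∃ (s : ℝ) (i : Fin 5), (s = 1 ∨ s = -1) ∧ Y = s * DoublePentagon.beyond P Q i := by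
  obtain ⟨s, hs, (⟨h1, h2⟩ | ⟨h1, h2⟩) | ⟨c, ⟨h1, h2⟩ | ⟨h1, h2⟩⟩⟩ := h.cases_beyond
  · have hs' : -s = 1 ∨ -s = -1 := by rcases hs with rfl | rfl <;> simp
    exact ⟨⟨s, 0, hs, h1⟩, -s, 4, hs', by
      push_cast; rw [neg_mul]; exact neg_eq_iff_eq_neg.1 h2⟩
  · have hs' : -s = 1 ∨ -s = -1 := by rcases hs with rfl | rfl <;> simp
    exact ⟨⟨s, 4, hs, h1⟩, -s, 0, hs', by
      push_cast; rw [neg_mul]; exact neg_eq_iff_eq_neg.1 h2⟩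
  · exact ⟨⟨s, _, hs, h1⟩, s, _, hs, h2⟩
  · exact ⟨⟨s, _, hs, h1⟩, s, _, hs, h2⟩

/-- The adjacent vertices of the tiling lie in a common closed side sector of `pent A B`, up to
sign. -/
theorem Reach.exists_cone {A B X Y : ℂ} {k : ℕ} (h : Reach A B k X Y) :
    ∃ (i : Fin 5) (s t : ℝ), s ≠ 0 ∧ t ≠ 0 ∧
      Cone (pent A B i.castSucc) (pent A B i.succ) (s * X) ∧
      Cone (pent A B i.castSucc) (pent A B i.succ) (t * Y) := by
  have hsign : ∀ {s : ℝ} (z : ℂ), (s = 1 ∨ s = -1) → s ≠ 0 ∧ (s : ℂ) * (s * z) = z := by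
    rintro s z (rfl | rfl) <;> simp
  rcases h.cases_sector with ⟨i, s, hs, h⟩ | ⟨n, P, Q, -, h, h'⟩
  · rcases h with ⟨rfl, rfl⟩ | ⟨rfl, rfl⟩
    · refine ⟨i, s, s, (hsign 0 hs).1, (hsign 0 hs).1, ?_, ?_⟩ <;> rw [(hsign _ hs).2]
      exacts [cone_left _ _, cone_right _ _]
    · refine ⟨i, s, s, (hsign 0 hs).1, (hsign 0 hs).1, ?_, ?_⟩ <;> rw [(hsign _ hs).2]
      exacts [cone_right _ _, cone_left _ _]
  · obtain ⟨i, hP, hQ⟩ := h.exists_cone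
    obtain ⟨⟨s, m, hs, rfl⟩, t, m', ht, rfl⟩ := h'.exists_beyond
    refine ⟨i, s, t, (hsign 0 hs).1, (hsign 0 ht).1, ?_, ?_⟩
    · rw [(hsign _ hs).2]; exact hP.beyond hQ _
    · rw [(hsign _ ht).2]; exact hP.beyond hQ _

/-- No side of the tiling at the vertex `B` enters the pentagon `pent A B`. -/
theorem not_reach_of_mem_Ioo {A B : ℂ} {k : ℕ} (hc : cross A B ≠ 0) {b y t : ℝ} (hb : b ≠ 0)
    (hy : y ≠ 0) (ht : 0 < t) (ht' : t < goldenRatio) :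
    ¬ Reach A B k (b * B) (y * (A - t * B)) := by
  intro h
  obtain ⟨i, s, s', hs, hs', ⟨p, q, hp, hq, h1⟩, p', q', hp', hq', h2⟩ := h.exists_cone
  have hg := Real.one_lt_goldenRatio
  have ext : ∀ a b a' b' : ℝ, (a : ℂ) * A + b * B = a' * A + b' * B → a = a' ∧ b = b' := by
    intro a b a' b' h
    have := eq_zero_of_combination_eq_zero hc (a := a - a') (b := b - b')
      (by push_cast; linear_combination h)
    exact ⟨by linarith [this.1], by linarith [this.2]⟩
  have hsb : s * b ≠ 0 := mul_ne_zero hs hb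
  have hsy : s' * y ≠ 0 := mul_ne_zero hs' hy
  set g : ℝ := goldenRatio with hgdef
  clear_value g
  have hpent : pent A B = ![A, B, g * B - A, g * B - g * A, B - g * A, -A] := by
    rw [pent, hgdef]
  rw [hpent] at h1 h2
  have keyB : ∀ α δ : ℝ, (s : ℂ) * (b * B) = α * A + δ * B → α = 0 ∧ δ ≠ 0 := by
    intro α δ h1
    obtain ⟨e1, e2⟩ := ext 0 (s * b) α δ (by rw [← h1]; push_cast; ring)
    exact ⟨e1.symm, by rwa [← e2]⟩
  have keyY : ∀ α δ : ℝ, (s' : ℂ) * (y * (A - t * B)) = α * A + δ * B → α ≠ 0 ∧ δ = -α * t := by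
    intro α δ h2
    obtain ⟨e1, e2⟩ := ext (s' * y) (-(s' * y) * t) α δ (by rw [← h2]; push_cast; ring)
    exact ⟨by rwa [← e1], by rw [← e1, ← e2]⟩
  clear ext h hc hpent
  -- The sectors `0` and `1` meet at `B` but do not contain the second vector; the sectors `2`, `3`,
  -- `4` contain no nonzero multiple of `B`.
  fin_cases i
  · obtain ⟨h3, h4⟩ := keyY p' q' (by rw [h2]; simp)
    have : 0 < p' := lt_of_le_of_ne hp' (Ne.symm h3)
    nlinarith
  · obtain ⟨h3, h4⟩ := keyY (-q') (p' + g * q') (by rw [h2]; simp; ring)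
    have : 0 < q' := lt_of_le_of_ne hq' (fun h => h3 (by simp [← h]))
    nlinarith
  · obtain ⟨h3, h4⟩ := keyB (-(p + g * q)) (g * p + g * q) (by rw [h1]; simp; ring)
    obtain rfl : q = 0 := by nlinarith
    obtain rfl : p = 0 := by linarith
    simp at h4
  · obtain ⟨h3, h4⟩ := keyB (-(g * p + g * q)) (g * p + q) (by rw [h1]; simp; ring)
    obtain rfl : q = 0 := by nlinarith
    obtain rfl : p = 0 := by nlinarith
    simp at h4
  · obtain ⟨h3, h4⟩ := keyB (-(g * p + q)) p (by rw [h1]; simp; ring)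
    obtain rfl : p = 0 := by nlinarith
    simp at h4

/-- The neighbours of the vertex `B` of the tiling. -/
theorem joined_iff_of_reach {B C : ℂ} {k : ℕ} {β r : Direction}
    (hr : Reach (sideVec 0) (sideVec' 0) k C B) (hβ : Lifts β B) :
    Joined β r ↔ ∃ n : ℤ, Lifts r (C + n * (goldenRatio * B)) := by
  have hc0 := frame_sideDirection.cross_ne
  rw [joined_iff]
  constructor
  · rintro ⟨m, X, Y, hXY, hX, hY⟩
    obtain ⟨b, hb, rfl⟩ := hβ.exists_mul hX
    have hCB := hr.cross_ne hc0
    obtain ⟨y, z, rfl⟩ := exists_combination hCB Y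
    have hy : y ≠ 0 := by
      rintro rfl
      apply hXY.cross_ne hc0
      have := cross_combination 0 b 0 z C B
      simpa using this
    have hg := Real.goldenRatio_pos
    -- With this `n` the direction lies between the neighbours `n - 1` and `n`, or is the latter.
    -- Strictly between them it would point into the pentagon at `B` that has both as vertices.
    obtain ⟨n, hn⟩ : ∃ n : ℤ, n = ⌈z / y / goldenRatio⌉ := ⟨_, rfl⟩
    obtain ⟨t, ht⟩ : ∃ t : ℝ, t = n * goldenRatio - z / y := ⟨_, rfl⟩
    have h1 : 0 ≤ t := by
      have := (div_le_iff₀ hg).1 (Int.le_ceil (z / y / goldenRatio))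
      rw [ht, hn]
      linarith
    have h2 : t < goldenRatio := by
      have := Int.ceil_lt_add_one (z / y / goldenRatio)
      rw [← hn, ← sub_lt_iff_lt_add, lt_div_iff₀ hg] at this
      rw [ht]
      linarith
    have hz : z = y * (n * goldenRatio - t) := by
      rw [ht]; field_simp; ring
    have hYeq : (y : ℂ) * C + z * B = y * ((C + n * (goldenRatio * B)) - t * B) := by
      rw [hz, Complex.ofReal_mul, Complex.ofReal_sub, Complex.ofReal_mul, Complex.ofReal_intCast]
      ring
    rw [hYeq] at hXY hY
    refine ⟨n, ?_⟩
    rcases h1.eq_or_lt with h0 | h0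
    · rw [← h0] at hY
      have := hY.mul (inv_ne_zero hy)
      rw [← mul_assoc, ← Complex.ofReal_mul, inv_mul_cancel₀ hy] at this
      simpa using this
    · obtain ⟨k', hk'⟩ := hr.add_mul n
      exact absurd (hk'.symm.trans hXY)
        (not_reach_of_mem_Ioo (hk'.cross_ne hc0) hb hy h0 h2)
  · rintro ⟨n, hn⟩
    obtain ⟨k', hk'⟩ := hr.add_mul n
    exact ⟨k', _, _, hk'.swap, hβ, hn⟩

theorem beyond_add (P Q : ℂ) {c d : Fin 4} (h : d.succ = c.castSucc) :
    beyond P Q d.castSucc + beyond P Q c.succ = goldenRatio * beyond P Q c.castSucc := by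
  have hg := goldenRatio_sq'
  simp only [beyond]
  generalize (goldenRatio : ℂ) = g at *
  fin_cases c <;> fin_cases d <;> simp [Fin.ext_iff] at h ⊢
  · linear_combination -P * hg
  · linear_combination -(P + Q) * hg
  · linear_combination -Q * hg

theorem Frame.lifts_pent {V : Label → Direction} {i : Label} {A B : ℂ} (h : Frame V i A B)
    (m : Fin 6) : ∃ j, Lifts (V j) (pent A B m) := by
  fin_cases m
  exacts [⟨_, h.lift0⟩, ⟨_, h.lift1⟩, ⟨_, h.lift2⟩, ⟨_, h.lift3⟩, ⟨_, h.lift4⟩, ⟨_, h.lift0.neg⟩]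

/-- A direction that is not the direction of a side occurs first as one of the three new vertices
of the pentagon beyond a side. -/
theorem exists_sector_of_first {β : Direction} (hβ : ∀ j, β ≠ sideDirection j) {k : ℕ}
    {V : Label → Direction} {j : Label} (hV : IsTile k V) (hj : V j = β)
    (hmin : ∀ m < k, ∀ W : Label → Direction, IsTile m W → ∀ i, W i ≠ β) :
    ∃ (n : ℕ) (P Q : ℂ) (c d : Fin 4), d.succ = c.castSucc ∧
      IsSector (sideVec 0) (sideVec' 0) n P Q ∧ Lifts β (beyond P Q c.castSucc) ∧
      ((Lifts (V (j - 1)) (beyond P Q d.castSucc) ∧ Lifts (V (j + 1)) (beyond P Q c.succ)) ∨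
        (Lifts (V (j - 1)) (beyond P Q c.succ) ∧ Lifts (V (j + 1)) (beyond P Q d.castSucc))) := by
  subst hj
  obtain ⟨X, Y, hr, hf⟩ := hV.exists_frame j
  rcases hr.cases_sector with ⟨i, s, hs, h⟩ | ⟨n, P, Q, hn, h, h'⟩
  · exfalso
    obtain ⟨m, rfl⟩ : ∃ m : Fin 6, X = s * pent (sideVec 0) (sideVec' 0) m :=
      h.elim (fun h => ⟨_, h.1⟩) (fun h => ⟨_, h.1⟩)
    obtain ⟨j', hj'⟩ := frame_sideDirection.lifts_pent m
    exact hβ j' (hf.lift0.eq (hj'.sign hs))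
  · have hPQ : ¬ Lifts (V j) P ∧ ¬ Lifts (V j) Q := by
      obtain ⟨W, hW, i, hi⟩ := h.reach.exists_tile
      have := hmin n hn W hW
      exact ⟨fun hP => hi.elim (fun hi => this i (hi.lift0.eq hP))
          (fun hi => this (i + 1) (hi.lift1.eq hP)),
        fun hQ => hi.elim (fun hi => this (i + 1) (hi.lift1.eq hQ))
          (fun hi => this i (hi.lift0.eq hQ))⟩
    obtain ⟨s, hs, (⟨rfl, -⟩ | ⟨rfl, -⟩) | ⟨c, ⟨rfl, rfl⟩ | ⟨rfl, rfl⟩⟩⟩ := h'.cases_beyond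
    · exact absurd (hf.lift0.of_sign hs) hPQ.1
    · exact absurd (hf.lift0.of_sign hs) hPQ.2
    · obtain ⟨d, hd⟩ | rfl : (∃ d : Fin 4, d.succ = c.castSucc) ∨ c = 0 := by
        clear * -; revert c; decide
      · refine ⟨n, P, Q, c, d, hd, h, hf.lift0.of_sign hs, Or.inl ⟨?_, hf.lift1.of_sign hs⟩⟩
        have := hf.unshift.lift0
        refine Lifts.of_sign hs ?_
        convert this using 1
        linear_combination s * beyond_add P Q hd
      · exact absurd (hf.lift0.of_sign hs) hPQ.1
    · obtain ⟨d, hd⟩ | rfl : (∃ d : Fin 4, c.succ = d.castSucc) ∨ c = 3 := by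
        clear * -; revert c; decide
      · rw [hd] at hf
        refine ⟨n, P, Q, d, c, hd, h, hf.lift0.of_sign hs, Or.inr ⟨?_, hf.lift1.of_sign hs⟩⟩
        have := hf.unshift.lift0
        refine Lifts.of_sign hs ?_
        convert this using 1
        linear_combination s * beyond_add P Q hd
      · exact absurd (hf.lift0.of_sign hs) hPQ.2

/-! ### The words of a sector -/

namespace Edge

theorem IsValid.child {e : Edge} (he : e.IsValid) (c : Fin 4) : (e.child c).IsValid where
  coded := he.coded.child c
  holonomic := he.holonomic.child c
  indep a b h := by
    have hg := Real.goldenRatio_sq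
    have hg1 := Real.one_lt_goldenRatio
    have key : ∀ p q : ℝ, (a : ℂ) * (e.child c).P + b * (e.child c).Q = p * e.P + q * e.Q →
        p = 0 ∧ q = 0 := fun p q hpq => he.indep p q (hpq ▸ h)
    fin_cases c
    · obtain ⟨h1, h2⟩ := key (a + goldenRatio * b) b (by
        simp only [Edge.child, Edge.vtx]; generalize goldenRatio = g; simp; ring)
      subst h2
      simpa using h1
    · obtain ⟨h1, h2⟩ := key (goldenRatio * a + goldenRatio * b) (a + goldenRatio * b) (by
        simp only [Edge.child, Edge.vtx]; generalize goldenRatio = g; simp; ring)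
      have : a + b = 0 := by
        have := mul_eq_zero.1 ((mul_add goldenRatio a b).trans h1)
        exact this.resolve_left (by positivity)
      have hb : (goldenRatio - 1) * b = 0 := by linear_combination h2 - this
      have := (mul_eq_zero.1 hb).resolve_left (by linarith)
      constructor <;> linarith
    · obtain ⟨h1, h2⟩ := key (goldenRatio * a + b) (goldenRatio * a + goldenRatio * b) (by
        simp only [Edge.child, Edge.vtx]; generalize goldenRatio = g; simp; ring)
      have : a + b = 0 := by
        have := mul_eq_zero.1 ((mul_add goldenRatio a b).trans h2)
        exact this.resolve_left (by positivity)
      have hb : (goldenRatio - 1) * a = 0 := by linear_combination h1 - this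
      have := (mul_eq_zero.1 hb).resolve_left (by linarith)
      constructor <;> linarith
    · obtain ⟨h1, h2⟩ := key a (goldenRatio * a + b) (by
        simp only [Edge.child, Edge.vtx]; generalize goldenRatio = g; simp; ring)
      subst h1
      simpa using h2

/-- The sector of an edge subdivided `n` times, keeping the boundary vector `P`. -/
def childrenP (e : Edge) : ℕ → Edge
  | 0 => e
  | n + 1 => (e.childrenP n).child 0

/-- The sector of an edge subdivided `n` times, keeping the boundary vector `Q`. -/
def childrenQ (e : Edge) : ℕ → Edge
  | 0 => e
  | n + 1 => (e.childrenQ n).child 3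

theorem IsValid.childrenP {e : Edge} (he : e.IsValid) (n : ℕ) : (e.childrenP n).IsValid := by
  induction n with
  | zero => exact he
  | succ n ih => exact ih.child 0

theorem IsValid.childrenQ {e : Edge} (he : e.IsValid) (n : ℕ) : (e.childrenQ n).IsValid := by
  induction n with
  | zero => exact he
  | succ n ih => exact ih.child 3

theorem childrenP_P (e : Edge) (n : ℕ) : (e.childrenP n).P = e.P := by
  induction n with
  | zero => rfl
  | succ n ih => exact ih

theorem childrenQ_Q (e : Edge) (n : ℕ) : (e.childrenQ n).Q = e.Q := by
  induction n with
  | zero => rfl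
  | succ n ih => exact ih

/-- The far boundaries of these sectors run through the neighbours of the vertex `P` on one side. -/
theorem childrenP_Q (e : Edge) (n : ℕ) :
    (e.childrenP n).Q = e.Q + n * (goldenRatio * e.P) := by
  induction n with
  | zero => simp [childrenP]
  | succ n ih =>
    change goldenRatio * (e.childrenP n).P + (e.childrenP n).Q = _
    rw [ih, childrenP_P, Nat.cast_succ]
    ring

theorem childrenQ_P (e : Edge) (n : ℕ) :
    (e.childrenQ n).P = e.P + n * (goldenRatio * e.Q) := by
  induction n with
  | zero => simp [childrenQ]
  | succ n ih =>
    change (e.childrenQ n).P + goldenRatio * (e.childrenQ n).Q = _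
    rw [ih, childrenQ_Q, Nat.cast_succ]
    ring

end Edge

/-! ### Powers and rotations of words -/

section wordPow

variable (u v w : List Label) (n : ℕ)

@[simp] theorem wordPow_zero : wordPow w 0 = [] := rfl

theorem wordPow_succ : wordPow w (n + 1) = w ++ wordPow w n := by
  simp [wordPow, List.replicate_succ]

theorem wordPow_append_comm : wordPow (u ++ v) n ++ u = u ++ wordPow (v ++ u) n := by
  induction n with
  | zero => simp
  | succ n ih => rw [wordPow_succ, wordPow_succ, List.append_assoc, ih]; simp

theorem wordPow_comm : wordPow w n ++ w = w ++ wordPow w n := by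
  simpa using wordPow_append_comm w [] n

end wordPow

namespace Edge

/-- The substitution `subst 0` fixes `sP` and `lP`, puts `lP` in front of `lQ` and `sQ`, and puts
`sP` behind `lQ`. -/
theorem childrenP_word (e : Edge) (n : ℕ) :
    (e.childrenP n).word sP = e.word sP ∧ (e.childrenP n).word lP = e.word lP ∧
      (e.childrenP n).word lQ = wordPow (e.word lP) n ++ e.word lQ ++ wordPow (e.word sP) n ∧
      (e.childrenP n).word sQ = wordPow (e.word lP) n ++ e.word sQ := by
  induction n with
  | zero => simp [childrenP]
  | succ n ih =>
    obtain ⟨h1, h2, h3, h4⟩ := ih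
    simp only [childrenP, child, subst, Matrix.cons_val_zero, quad_sP, quad_lP, quad_lQ, quad_sQ,
      List.flatMap_cons, List.flatMap_nil, List.append_nil, h1, h2, h3, h4, true_and]
    rw [wordPow_succ, wordPow_succ, ← wordPow_comm (e.word sP)]
    simp

theorem childrenQ_word (e : Edge) (n : ℕ) :
    (e.childrenQ n).word sQ = e.word sQ ∧ (e.childrenQ n).word lQ = e.word lQ ∧
      (e.childrenQ n).word lP = wordPow (e.word lQ) n ++ e.word lP ++ wordPow (e.word sQ) n ∧
      (e.childrenQ n).word sP = wordPow (e.word lQ) n ++ e.word sP := by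
  induction n with
  | zero => simp [childrenQ]
  | succ n ih =>
    obtain ⟨h1, h2, h3, h4⟩ := ih
    simp only [childrenQ, child, subst, Matrix.cons_val, quad_sP, quad_lP, quad_lQ, quad_sQ,
      List.flatMap_cons, List.flatMap_nil, List.append_nil, h1, h2, h3, h4, true_and]
    rw [wordPow_succ, wordPow_succ, ← wordPow_comm (e.word sQ)]
    simp

end Edge

theorem Edge.beyond_mul (e : Edge) (s : ℂ) (i : Fin 5) :
    beyond (s * e.P) (s * e.Q) i = s * e.vtx i := by
  simp only [beyond, Edge.vtx]
  generalize (goldenRatio : ℂ) = g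
  fin_cases i <;> simp <;> ring

theorem exists_edge_of_isSector {n : ℕ} {P Q : ℂ}
    (h : IsSector (sideVec 0) (sideVec' 0) n P Q) :
    ∃ (e : Edge) (s : ℝ), e.IsValid ∧ (s = 1 ∨ s = -1) ∧ P = s * e.P ∧ Q = s * e.Q := by
  induction h with
  | start i =>
    refine ⟨.base (i : ℕ), (-1) ^ (i : ℕ), Edge.isValid_base _, neg_one_pow_eq_or ℝ _, ?_, ?_⟩
    · rw [pent_sideVec]
      push_cast
      rfl
    · rw [pent_sideVec, Fin.val_succ, Nat.cast_succ, sideVec_succ, pow_succ]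
      push_cast
      simp [Edge.base]
  | @child n P Q _ c ih =>
    obtain ⟨e, s, he, hs, rfl, rfl⟩ := ih
    exact ⟨e.child c, s, he.child c, hs, e.beyond_mul s _, e.beyond_mul s _⟩

theorem Edge.IsValid.short_P {e : Edge} (he : e.IsValid) {d : Direction} (hd : Lifts d e.P) :
    IsShortOrbit d (e.word sP) ∧ IsLongOrbit d (e.word lP) := by
  obtain ⟨_, rfl⟩ := hd
  exact he.short_long_P

theorem Edge.IsValid.short_Q {e : Edge} (he : e.IsValid) {d : Direction} (hd : Lifts d e.Q) :
    IsShortOrbit d (e.word sQ) ∧ IsLongOrbit d (e.word lQ) := by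
  obtain ⟨_, rfl⟩ := hd
  exact he.short_long_Q

/-! ### Common words for the orbits of a vertex and its neighbours -/

/-- The orbits of `β`, `m n` and `p n` are composed of common words. -/
def HasOrbitWords (β : Direction) (m p : ℕ → Direction) : Prop :=
  ∃ a A A' u v x y z w : List Label,
    IsShortOrbit β (a : Cycle Label) ∧ IsLongOrbit β (A : Cycle Label) ∧ A' ~r A ∧
    a = u ++ v ∧ A = x ++ y ∧ A' = z ++ w ∧ ∀ n : ℕ,
      IsShortOrbit (m n) ((wordPow A n ++ x : List Label) : Cycle Label) ∧
      IsLongOrbit (m n) ((wordPow A' n ++ z ++ v ++ wordPow a n : List Label) : Cycle Label) ∧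
      IsShortOrbit (p n) ((y ++ wordPow A n : List Label) : Cycle Label) ∧
      IsLongOrbit (p n) ((wordPow a n ++ u ++ w ++ wordPow A' n : List Label) : Cycle Label)

theorem cycle_append_comm (s t : List Label) :
    ((s ++ t : List Label) : Cycle Label) = (t ++ s : List Label) :=
  Cycle.coe_eq_coe.2 List.isRotated_append

/-- Reversing the orientation exchanges the factors in each of the three decompositions; the new
words are rotations of the old ones. -/
theorem HasOrbitWords.symm {β : Direction} {m p : ℕ → Direction} (h : HasOrbitWords β m p) :
    HasOrbitWords β p m := by
  obtain ⟨a, A, A', u, v, x, y, z, w, ha, hA, hA', rfl, rfl, rfl, h⟩ := h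
  refine ⟨v ++ u, y ++ x, w ++ z, v, u, y, x, w, z, ?_, ?_, ?_, rfl, rfl, rfl, fun n => ?_⟩
  · rwa [Cycle.coe_eq_coe.2 (List.isRotated_append (l := v) (l' := u))]
  · rwa [Cycle.coe_eq_coe.2 (List.isRotated_append (l := y) (l' := x))]
  · exact List.isRotated_append.trans (hA'.trans List.isRotated_append)
  · obtain ⟨h1, h2, h3, h4⟩ := h n
    refine ⟨?_, ?_, ?_, ?_⟩
    · rwa [wordPow_append_comm]
    · convert h4 using 1
      rw [wordPow_append_comm w z, List.append_assoc, ← wordPow_append_comm u v]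
      simpa using cycle_append_comm (w ++ wordPow (z ++ w) n) (wordPow (u ++ v) n ++ u)
    · rwa [← wordPow_append_comm]
    · convert h2 using 1
      rw [wordPow_append_comm v u, List.append_assoc, ← wordPow_append_comm z w]
      simpa using cycle_append_comm (v ++ wordPow (u ++ v) n) (wordPow (z ++ w) n ++ z)

namespace Edge

/-- `β` is the common boundary of the subsectors `d` and `c`. Repeated subdivision of `c` next to
`β` yields the orbits of `p n`, that of `d` those of `m n`; both describe `β` by the same cyclic
words, cut at different places. -/
theorem IsValid.hasOrbitWords {e : Edge} (he : e.IsValid) {c d : Fin 4}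
    (hcd : d.succ = c.castSucc) {β : Direction} {m p : ℕ → Direction}
    (hβ : Lifts β (e.vtx c.castSucc))
    (hm : ∀ n : ℕ, Lifts (m n) (e.vtx d.castSucc + n * (goldenRatio * e.vtx c.castSucc)))
    (hp : ∀ n : ℕ, Lifts (p n) (e.vtx c.succ + n * (goldenRatio * e.vtx c.castSucc))) :
    HasOrbitWords β m p := by
  have hβ' := (he.child c).short_P hβ
  have hp' : ∀ n, IsShortOrbit (p n) (((e.child c).childrenP n).word sQ) ∧
      IsLongOrbit (p n) (((e.child c).childrenP n).word lQ) := fun n =>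
    ((he.child c).childrenP n).short_Q (by rw [childrenP_Q]; exact hp n)
  have hm' : ∀ n, IsShortOrbit (m n) (((e.child d).childrenQ n).word sP) ∧
      IsLongOrbit (m n) (((e.child d).childrenQ n).word lP) := fun n =>
    ((he.child d).childrenQ n).short_P (by
      rw [childrenQ_P]
      simp only [Edge.child, hcd]
      exact hm n)
  clear hβ hm hp
  simp only [fun n => (childrenP_word (e.child c) n).2.2.1,
    fun n => (childrenP_word (e.child c) n).2.2.2] at hp'
  simp only [fun n => (childrenQ_word (e.child d) n).2.2.1,
    fun n => (childrenQ_word (e.child d) n).2.2.2] at hm'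
  have hdet : (d = 0 ∧ c = 1) ∨ (d = 1 ∧ c = 2) ∨ (d = 2 ∧ c = 3) := by
    clear * - hcd; revert c d; decide
  simp only [Edge.child] at hβ' hp' hm'
  generalize hg : e.word sP = g at *
  generalize hb : e.word lP = b at *
  generalize hε : e.word lQ = ε at *
  generalize hz : e.word sQ = z at *
  rcases hdet with ⟨rfl, rfl⟩ | ⟨rfl, rfl⟩ | ⟨rfl, rfl⟩
  all_goals
    simp only [subst, Matrix.cons_val, quad_sP, quad_lP, quad_lQ, quad_sQ,
      List.flatMap_cons, List.flatMap_nil, List.append_nil, hg, hb, hε, hz] at hβ' hp' hm'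
  -- The parent words are `g, b, ε, z` for `sP, lP, lQ, sQ`. The factors are chosen so that `x` and
  -- `y` are the words of `m 0` and `p 0` up to rotation, and likewise the pieces of `a` and `A'`
  -- combine to their long orbits.
  · refine ⟨z ++ b, g ++ (b ++ ε), [] ++ (ε ++ (g ++ b)), z, b, g, b ++ ε, [], ε ++ (g ++ b),
      ?_, ?_, ?_, rfl, rfl, rfl, fun n => ⟨?_, ?_, ?_, ?_⟩⟩
    · rw [cycle_append_comm]; exact hβ'.1
    · convert hβ'.2 using 1
      simpa using cycle_append_comm (g ++ b) ε
    · simpa using List.isRotated_append (l := ε) (l' := g ++ b)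
    · convert (hm' n).1 using 1
      rw [wordPow_append_comm, cycle_append_comm]; simp
    · convert (hm' n).2 using 1
      have h1 := wordPow_append_comm b (ε ++ g) n
      have h2 := wordPow_append_comm b z n
      simp only [List.append_assoc, List.nil_append] at h1 h2 ⊢
      rw [← h2, ← List.append_assoc _ b, h1]
      simpa using cycle_append_comm (wordPow (ε ++ (g ++ b)) n ++ wordPow (b ++ z) n) b
    · convert (hp' n).1 using 1
      have h1 := wordPow_append_comm ε (g ++ b) n
      simp only [List.append_assoc] at h1 ⊢
      rw [← h1, ← List.append_assoc _ ε b, cycle_append_comm _ b]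
    · convert (hp' n).2 using 1
      have h1 := wordPow_append_comm z b n
      have h2 := wordPow_comm (ε ++ (g ++ b)) n
      simp only [List.append_assoc, List.nil_append] at h1 h2 ⊢
      rw [← List.append_assoc _ z, h1, ← h2]
      simpa using cycle_append_comm (z ++ wordPow (b ++ z) n)
        (wordPow (ε ++ (g ++ b)) n ++ (ε ++ (g ++ b)))
  · refine ⟨ε ++ b, (b ++ z) ++ (ε ++ g), (ε ++ g) ++ (b ++ z), ε, b, b ++ z, ε ++ g, ε ++ g,
      b ++ z, ?_, ?_, ?_, rfl, rfl, rfl, fun n => ⟨?_, ?_, ?_, ?_⟩⟩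
    · rw [cycle_append_comm]; exact hβ'.1
    · simpa using hβ'.2
    · exact List.isRotated_append
    · convert (hm' n).1 using 1
      rw [wordPow_append_comm, cycle_append_comm]; simp
    · simpa using (hm' n).2
    · convert (hp' n).1 using 1
      rw [cycle_append_comm]; simp
    · convert (hp' n).2 using 1
      rw [wordPow_append_comm ε b, List.append_assoc _ (b ++ z),
        ← wordPow_append_comm (b ++ z) (ε ++ g)]
      simpa using cycle_append_comm (ε ++ wordPow (b ++ ε) n)
        (wordPow ((b ++ z) ++ (ε ++ g)) n ++ (b ++ z))
  · refine ⟨[] ++ (ε ++ g), (ε ++ b) ++ z, (b ++ z) ++ ε, [], ε ++ g, ε ++ b, z, b ++ z,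
      ε, ?_, ?_, ?_, rfl, rfl, rfl, fun n => ⟨?_, ?_, ?_, ?_⟩⟩
    · exact hβ'.1
    · simpa using hβ'.2
    · simpa using List.isRotated_append (l := b ++ z) (l' := ε)
    · convert (hm' n).1 using 1
      have h1 := wordPow_append_comm ε (b ++ z) n
      simp only [List.append_assoc] at h1 ⊢
      rw [← List.append_assoc _ ε, h1, List.append_assoc, cycle_append_comm ε]
      simp
    · simpa using (hm' n).2
    · convert (hp' n).1 using 1
      rw [cycle_append_comm]; simp
    · convert (hp' n).2 using 1
      have h1 := wordPow_append_comm ε (b ++ z) n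
      simp only [List.append_assoc, List.nil_append, List.append_nil] at h1 ⊢
      rw [← h1, cycle_append_comm]
      simp

end Edge

/-! ### The order of the neighbours -/

/-- With `B` fixed, the coordinate is affine in `t`, so the order on the circle is the order of `t`
or its reverse. -/
theorem circleCoord_eq {β r : Direction} {B C : ℂ} {t : ℝ} (hβ : Lifts β B)
    (hr : Lifts r (C + t * B)) : circleCoord β r = ((C / B).re + t) / (C / B).im := by
  obtain ⟨b, hb, hB⟩ := hβ.exists_mul (lifts_rep β)
  obtain ⟨c, hc, hC⟩ := hr.exists_mul (lifts_rep r)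
  have h : r.rep / β.rep = ((c / b : ℝ) : ℂ) * (C / B + t) := by
    have h1 := hβ.ne_zero
    have h2 : (b : ℂ) ≠ 0 := Complex.ofReal_ne_zero.2 hb
    rw [hB, hC]
    push_cast
    field_simp
  have hcb : c / b ≠ 0 := div_ne_zero hc hb
  rw [circleCoord, h, Complex.re_ofReal_mul, Complex.im_ofReal_mul, mul_div_mul_left _ _ hcb]
  simp

/-- A value strictly between those at consecutive integers would not be attained. -/
theorem int_eq_add_of_strictMono {g : ℤ → ℤ} (hg : StrictMono g) (hs : Function.Surjective g)
    (m : ℤ) : g m = g 0 + m := by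
  have step : ∀ m, g (m + 1) = g m + 1 := by
    intro m
    obtain ⟨k, hk⟩ := hs (g m + 1)
    have h1 : m < k := hg.lt_iff_lt.1 (by omega)
    have h2 : g (m + 1) ≤ g k := hg.monotone h1
    have h3 : g m < g (m + 1) := hg (by omega)
    omega
  induction m with
  | zero => simp
  | succ n ih => rw [step, ih, add_assoc]
  | pred n ih =>
    have := step (-n - 1)
    rw [sub_add_cancel, ih] at this
    omega

theorem one_add_natCast_ne_zero (n : ℕ) : 1 + (n : ℤ) ≠ 0 := by omega

theorem neg_one_sub_natCast_ne_zero (n : ℕ) : -1 - (n : ℤ) ≠ 0 := by omega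

theorem int_eq_of_strictMono {f : {i : ℤ // i ≠ 0} → ℤ} (hf : StrictMono f)
    (hs : Function.Surjective f) (n : ℕ) :
    f ⟨1 + n, one_add_natCast_ne_zero n⟩ = f ⟨1, by norm_num⟩ + n ∧
      f ⟨-1 - n, neg_one_sub_natCast_ne_zero n⟩ = f ⟨-1, by norm_num⟩ - n := by
  -- Closing the gap at `0` turns the index set into all integers.
  have hne : ∀ m : ℤ, (if 0 ≤ m then m + 1 else m) ≠ 0 := fun m => by split_ifs <;> omega
  have hmono : StrictMono fun m : ℤ => f ⟨if 0 ≤ m then m + 1 else m, hne m⟩ := by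
    intro m m' h
    apply hf
    rw [Subtype.mk_lt_mk]
    split_ifs <;> omega
  have hsurj : Function.Surjective fun m : ℤ => f ⟨if 0 ≤ m then m + 1 else m, hne m⟩ := by
    intro k
    obtain ⟨⟨i, hi⟩, rfl⟩ := hs k
    rcases lt_or_gt_of_ne hi with h | h
    · exact ⟨i, congrArg f (Subtype.ext (by simp; omega))⟩
    · exact ⟨i - 1, congrArg f (Subtype.ext (by simp; omega))⟩
  have key := int_eq_add_of_strictMono hmono hsurj
  have k1 := key n
  have k2 := key (-1 - n)
  have k3 := key (-1)
  have e1 : f ⟨if 0 ≤ (n : ℤ) then (n : ℤ) + 1 else n, hne n⟩ = f ⟨1 + n, one_add_natCast_ne_zero n⟩ :=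
    congrArg f (Subtype.ext (by simp; omega))
  have e2 : f ⟨if 0 ≤ (-1 - n : ℤ) then (-1 - n : ℤ) + 1 else (-1 - n : ℤ), hne _⟩ =
      f ⟨-1 - n, neg_one_sub_natCast_ne_zero n⟩ := congrArg f (Subtype.ext (by simp; omega))
  have e3 : f ⟨if 0 ≤ (-1 : ℤ) then (-1 : ℤ) + 1 else (-1 : ℤ), hne _⟩ =
      f ⟨-1, by omega⟩ := congrArg f (Subtype.ext (by simp))
  have e0 : f ⟨if 0 ≤ (0 : ℤ) then (0 : ℤ) + 1 else (0 : ℤ), hne _⟩ =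
      f ⟨1, by omega⟩ := congrArg f (Subtype.ext (by simp))
  simp only [e1, e2, e3, e0] at k1 k2 k3
  constructor <;> omega

/-- The points joined to `β` are numbered as the vectors `C + n φ B`. -/
theorem IsOrderedNeighbours.exists_numbering {β : Direction} {γ : {i : ℤ // i ≠ 0} → Direction}
    (hγ : IsOrderedNeighbours β γ) {B C : ℂ} (hβ : Lifts β B) (hBC : cross B C ≠ 0)
    (hJ : ∀ r, Joined β r ↔ ∃ n : ℤ, Lifts r (C + n * (goldenRatio * B))) :
    ∃ f : {i : ℤ // i ≠ 0} → ℤ, (∀ i, Lifts (γ i) (C + f i * (goldenRatio * B))) ∧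
      (∀ i (n : ℤ), Lifts (γ i) (C + n * (goldenRatio * B)) → f i = n) ∧
      Function.Surjective f ∧ (StrictMono f ∨ StrictAnti f) := by
  have h1 : ∀ i, ∃ n : ℤ, Lifts (γ i) (C + n * (goldenRatio * B)) := fun i =>
    (hJ _).1 (hγ.range_eq.subset (Set.mem_range_self i))
  choose f hf using h1
  have hne : ∀ n : ℤ, C + n * (goldenRatio * B) ≠ 0 := by
    intro n h
    apply hBC
    have := cross_combination 1 0 (-(n * goldenRatio)) 0 B C
    rw [show C = ((-(n * goldenRatio) : ℝ) : ℂ) * B by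
      rw [Complex.ofReal_neg, Complex.ofReal_mul, Complex.ofReal_intCast]; linear_combination h]
    simpa using this
  have hcoord : ∀ (r : Direction) (n : ℤ), Lifts r (C + n * (goldenRatio * B)) →
      circleCoord β r = ((C / B).re + n * goldenRatio) / (C / B).im := by
    intro r n h
    refine circleCoord_eq hβ ?_
    rw [Complex.ofReal_mul, Complex.ofReal_intCast]
    convert h using 1
    ring
  have him : (C / B).im ≠ 0 := by
    rw [Complex.div_im, ← sub_div]
    refine div_ne_zero (fun h => hBC ?_) (Complex.normSq_pos.2 hβ.ne_zero).ne'
    rw [cross]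
    linarith
  have hg := Real.goldenRatio_pos
  have huniq : ∀ i (n : ℤ), Lifts (γ i) (C + n * (goldenRatio * B)) → f i = n := by
    intro i n h
    have := (hcoord _ _ (hf i)).symm.trans (hcoord _ _ h)
    rw [div_left_inj' him, add_right_inj, mul_left_inj' hg.ne'] at this
    exact_mod_cast this
  refine ⟨f, hf, huniq, fun n => ?_, ?_⟩
  · obtain ⟨i, hi⟩ := hγ.range_eq.superset ((hJ _).2 ⟨n, lifts_mk _ (hne n)⟩)
    exact ⟨i, huniq i n (hi ▸ lifts_mk _ (hne n))⟩
  · have hc : ∀ i, circleCoord β (γ i) = ((C / B).re + f i * goldenRatio) / (C / B).im :=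
      fun i => hcoord _ _ (hf i)
    have hord := hγ.ordered
    simp only [hc] at hord
    rcases lt_or_gt_of_ne him with h | h
    · have key : ∀ i j, ((C / B).re + f i * goldenRatio) / (C / B).im <
          ((C / B).re + f j * goldenRatio) / (C / B).im → f j < f i := by
        intro i j hij
        rw [div_lt_div_right_of_neg h, add_lt_add_iff_left, mul_lt_mul_iff_left₀ hg] at hij
        exact_mod_cast hij
      exact hord.symm.imp (fun h' i j hij => key _ _ (h' hij)) (fun h' i j hij => key _ _ (h' hij))
    · have key : ∀ i j, ((C / B).re + f i * goldenRatio) / (C / B).im <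
          ((C / B).re + f j * goldenRatio) / (C / B).im → f i < f j := by
        intro i j hij
        rw [div_lt_div_iff_of_pos_right h, add_lt_add_iff_left, mul_lt_mul_iff_left₀ hg] at hij
        exact_mod_cast hij
      exact hord.imp (fun h' i j hij => key _ _ (h' hij)) (fun h' i j hij => key _ _ (h' hij))

theorem IsOrderedNeighbours.hasOrbitWords {β : Direction} {γ : {i : ℤ // i ≠ 0} → Direction}
    (hγ : IsOrderedNeighbours β γ) (hβ : ∀ j, β ≠ sideDirection j) :
    HasOrbitWords β (fun n => γ ⟨-1 - n, neg_one_sub_natCast_ne_zero n⟩) (fun n => γ ⟨1 + n, one_add_natCast_ne_zero n⟩) := by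
  obtain ⟨k, V, j, hV, hj, hmin, hγ1⟩ := hγ.first
  obtain ⟨l, P, Q, c, d, hcd, hsec, hβP, hV'⟩ := exists_sector_of_first hβ hV hj hmin
  have hsum := beyond_add P Q hcd
  have hr := (hsec.child c).reach
  obtain ⟨f, hf, huniq, hsurj, hmono⟩ := hγ.exists_numbering hβP
    (hr.cross_ne frame_sideDirection.cross_ne) fun r => joined_iff_of_reach hr.swap hβP
  have hdir : (Lifts (γ ⟨-1, by norm_num⟩) (beyond P Q d.castSucc) ∧
        Lifts (γ ⟨1, by norm_num⟩) (beyond P Q c.succ)) ∨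
      (Lifts (γ ⟨-1, by norm_num⟩) (beyond P Q c.succ) ∧
        Lifts (γ ⟨1, by norm_num⟩) (beyond P Q d.castSucc)) := by
    rcases hγ1 with ⟨h1, h2⟩ | ⟨h1, h2⟩ <;> rw [h1, h2]
    exacts [hV', hV'.symm.imp And.symm And.symm]
  have hC : ∀ i, Lifts (γ i) (beyond P Q c.succ) → f i = 0 := fun i h =>
    huniq i 0 (by simpa using h)
  -- By `beyond_add` the other neighbour in the first pentagon is `-(C - φB)`, which has the number
  -- `-1`.
  have hD : ∀ i, Lifts (γ i) (beyond P Q d.castSucc) → f i = -1 := fun i h =>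
    huniq i (-1) (by
      convert h.neg using 1
      rw [Int.cast_neg, Int.cast_one]
      linear_combination hsum)
  obtain ⟨e, s, he, hs, rfl, rfl⟩ := exists_edge_of_isSector hsec
  simp only [e.beyond_mul] at hsum hβP hf
  have hfC : ∀ i (n : ℕ), f i = n →
      Lifts (γ i) (e.vtx c.succ + n * (goldenRatio * e.vtx c.castSucc)) := by
    intro i n h
    refine Lifts.of_sign hs ?_
    convert hf i using 1
    rw [h, Int.cast_natCast]
    ring
  have hfD : ∀ i (n : ℕ), f i = -1 - n →
      Lifts (γ i) (e.vtx d.castSucc + n * (goldenRatio * e.vtx c.castSucc)) := by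
    intro i n h
    refine Lifts.of_sign hs ?_
    convert (hf i).neg using 1
    rw [h, Int.cast_sub, Int.cast_neg, Int.cast_one, Int.cast_natCast]
    linear_combination hsum
  have hlt : (⟨-1, by norm_num⟩ : {i : ℤ // i ≠ 0}) < ⟨1, by norm_num⟩ := by
    rw [Subtype.mk_lt_mk]; norm_num
  rcases hdir with ⟨h1, h2⟩ | ⟨h1, h2⟩
  · have e1 := hD _ h1
    have e2 := hC _ h2
    have hm : StrictMono f := hmono.resolve_right fun h => by
      have := h hlt
      omega
    refine he.hasOrbitWords hcd (hβP.of_sign hs) (fun n => hfD _ _ ?_) (fun n => hfC _ _ ?_)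
    · rw [(int_eq_of_strictMono hm hsurj n).2, e1]
    · rw [(int_eq_of_strictMono hm hsurj n).1, e2, zero_add]
  · have e1 := hC _ h1
    have e2 := hD _ h2
    -- Here the numbering runs backwards; `n ↦ -1 - n` exchanges the two first neighbours and
    -- restores the increasing case.
    have hm : StrictMono fun i => -1 - f i := fun i j hij => by
      have := (hmono.resolve_left fun h => by have := h hlt; omega) hij
      simp only
      omega
    have hs' : Function.Surjective fun i => -1 - f i := fun k => by
      obtain ⟨i, hi⟩ := hsurj (-1 - k)
      exact ⟨i, by simp only [hi]; ring⟩
    refine (he.hasOrbitWords hcd (hβP.of_sign hs) (fun n => hfD _ _ ?_) (fun n => hfC _ _ ?_)).symm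
    · have := (int_eq_of_strictMono hm hs' n).1
      simp only [e2] at this
      omega
    · have := (int_eq_of_strictMono hm hs' n).2
      simp only [e1] at this
      omega

end DoublePentagon

end

theorem theorem4 (β : DoublePentagon.Direction)
    (hβ : DoublePentagon.IsPeriodicDirection β)
    (hβ_side : ∀ j : DoublePentagon.Label, β ≠ DoublePentagon.sideDirection j)
    (γ : {i : ℤ // i ≠ 0} → DoublePentagon.Direction)
    (hγ : DoublePentagon.IsOrderedNeighbours β γ) :
    ∃ a A A' u v x y z w : List DoublePentagon.Label,
      DoublePentagon.IsShortOrbit β (a : Cycle DoublePentagon.Label) ∧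
      DoublePentagon.IsLongOrbit β (A : Cycle DoublePentagon.Label) ∧
      A' ~r A ∧
      a = u ++ v ∧ A = x ++ y ∧ A' = z ++ w ∧
      ∀ n : ℕ,
        DoublePentagon.IsShortOrbit (γ ⟨-1 - (n : ℤ), by omega⟩)
          ((DoublePentagon.wordPow A n ++ x : List DoublePentagon.Label) :
            Cycle DoublePentagon.Label) ∧
        DoublePentagon.IsLongOrbit (γ ⟨-1 - (n : ℤ), by omega⟩)
          ((DoublePentagon.wordPow A' n ++ z ++ v ++ DoublePentagon.wordPow a n :
            List DoublePentagon.Label) : Cycle DoublePentagon.Label) ∧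
        DoublePentagon.IsShortOrbit (γ ⟨1 + (n : ℤ), by omega⟩)
          ((y ++ DoublePentagon.wordPow A n : List DoublePentagon.Label) :
            Cycle DoublePentagon.Label) ∧
        DoublePentagon.IsLongOrbit (γ ⟨1 + (n : ℤ), by omega⟩)
          ((DoublePentagon.wordPow a n ++ u ++ w ++ DoublePentagon.wordPow A' n :
            List DoublePentagon.Label) : Cycle DoublePentagon.Label) := by
  exact hγ.hasOrbitWords hβ_side
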